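/- Let $F\in\mathbb C[\xi,\eta,\zeta]$ be homogeneous of degree $n\ge 2$ and suppose that the plane projective curve $C=\{F=0\}\subset\mathbb{CP}^2$ is smooth. Let the points of $C$ be expressed as functions of a uniformizing parameter $t$: let $D\subset\mathbb C$ be open and connected and let $t\mapsto(\xi(t),\eta(t),\zeta(t))\in\mathbb C^3\setminus\{0\}$ be a holomorphic map on $D$ with $F(\xi(t),\eta(t),\zeta(t))=0$ for all $t\in D$, such that the point $[\xi(t),\eta(t),\zeta(t)]$ of $C$ is not constant. Then the following hold. (1) There is a continuously differentiable path $\gamma:[0,1]\to D$ such that every real-analytic solution $V$ of $F\left(\frac{\partial}{\partial x},\frac{\partial}{\partial y},\frac{\partial}{\partial z}\right)V=0$, complex-valued and defined on an open set $U\subset\mathbb R^3$, has the following property. Every point of $U$ has an open neighbourhood $O\subset U$ for which there are an open set $W\subset\mathbb C^2$ and a holomorphic function $\Phi:W\to\mathbb C$ such that, for all $(x,y,z)\in O$, the set $W$ contains $(\xi(t)x+\eta(t)y+\zeta(t)z,\,t)$ for every $t$ on $\gamma$, and $$V(x,y,z)=\int_\gamma \Phi\bigl(\xi(t)x+\eta(t)y+\zeta(t)z,\,t\bigr)\,dt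 .$$ (2) For every integer $m\ge 0$, the complex vector space of all homogeneous polynomials $P\in\mathbb C[x,y,z]$ of degree $m$ (together with $0$) that satisfy $F\left(\frac{\partial}{\partial x},\frac{\partial}{\partial y},\frac{\partial}{\partial z}\right)P=0$ has dimension $$r=\begin{cases} mn+1-\tfrac12(n-1)(n-2), & m\ge n,\\[2pt] \binom{m+2}{2}, & m<n,\end{cases}$$ and there are $t_1,\dots,t_r\in D$ such that the powers $(\xi(t_i)x+\eta(t_i)y+\zeta(t_i)z)^m$, $1\le i\le r$, form a basis of it. -/

import Mathlib

open MvPolynomial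

noncomputable section

/-- The plane projective curve `F = 0` over `ℂ` is smooth: the gradient of `F` vanishes at no
point of the affine cone over the curve other than the origin. -/
def IsSmoothPlaneCurve (F : MvPolynomial (Fin 3) ℂ) : Prop :=
  ∀ v : Fin 3 → ℂ, v ≠ 0 → eval v F = 0 → ∃ i : Fin 3, eval v (pderiv i F) ≠ 0

/-- The homogeneous coordinates of the points of the curve `F = 0` as functions `ξ` of a complex
parameter `t` that ranges over a domain `D`: `ξ` is holomorphic, `ξ t` is a nonzero vector on the
cone over the curve, and the point `[ξ t]` of the projective plane is not constant. Local
coordinates of the curve and global uniformizations are both of this kind. -/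
structure IsUniformizedBy (F : MvPolynomial (Fin 3) ℂ) (D : Set ℂ) (ξ : ℂ → Fin 3 → ℂ) : Prop where
  isOpen : IsOpen D
  isPreconnected : IsPreconnected D
  differentiableOn : DifferentiableOn ℂ ξ D
  ne_zero : ∀ t ∈ D, ξ t ≠ 0
  mem_curve : ∀ t ∈ D, eval (ξ t) F = 0
  nonconstant : ∃ s ∈ D, ∃ t ∈ D, LinearIndependent ℂ ![ξ s, ξ t]

/-- The partial derivative `∂f/∂xᵢ` of a complex-valued function on `ℝ³`. -/
def partialDeriv (i : Fin 3) (f : (Fin 3 → ℝ) → ℂ) : (Fin 3 → ℝ) → ℂ :=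
  fun x => fderiv ℝ f x (Pi.single i 1)

/-- The function `F(∂/∂x, ∂/∂y, ∂/∂z) f` on `ℝ³`. -/
def diffOp (F : MvPolynomial (Fin 3) ℂ) (f : (Fin 3 → ℝ) → ℂ) : (Fin 3 → ℝ) → ℂ :=
  fun x => ∑ d ∈ F.support, F.coeff d *
    ((partialDeriv 0)^[d 0] ((partialDeriv 1)^[d 1] ((partialDeriv 2)^[d 2] f))) x

/-- The operator `F(∂/∂x, ∂/∂y, ∂/∂z)` on complex polynomials in `x, y, z`. -/
def polyDiffOp (F : MvPolynomial (Fin 3) ℂ) :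
    MvPolynomial (Fin 3) ℂ →ₗ[ℂ] MvPolynomial (Fin 3) ℂ :=
  ∑ d ∈ F.support, F.coeff d •
    (((pderiv 0).toLinearMap : Module.End ℂ (MvPolynomial (Fin 3) ℂ)) ^ d 0 *
      (pderiv 1).toLinearMap ^ d 1 * (pderiv 2).toLinearMap ^ d 2)

/-- The space of complex homogeneous polynomials `P` of degree `m` in `x, y, z` (with `0`) such
that `F(∂/∂x, ∂/∂y, ∂/∂z) P = 0`. -/
def homogeneousSolutions (F : MvPolynomial (Fin 3) ℂ) (m : ℕ) :
    Submodule ℂ (MvPolynomial (Fin 3) ℂ) :=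
  homogeneousSubmodule (Fin 3) ℂ m ⊓ LinearMap.ker (polyDiffOp F)

/-- The linear form `a₀ x + a₁ y + a₂ z`, as a polynomial. -/
def linearForm (a : Fin 3 → ℂ) : MvPolynomial (Fin 3) ℂ :=
  ∑ i, C (a i) * X i

/-- `m n + 1 - (n - 1)(n - 2)/2` for `m ≥ n`, and `binom(m + 2, 2)` for `m < n`. -/
def solutionCount (n m : ℕ) : ℕ :=
  if n ≤ m then m * n + 1 - (n - 1) * (n - 2) / 2 else (m + 2).choose 2

end

/-!
Write `Sₘ` for the forms of degree `m` in three variables. A smooth plane curve is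
irreducible (`IsSmoothPlaneCurve.prime`), so a form that vanishes along the parametrized part of
the curve is a multiple of `F` (`IsUniformizedBy.dvd`).

**Homogeneous solutions.** For the apolar pairing `⟨G, P⟩ = (G(∂)P)(0)`, multiplication by `F` is
adjoint to `F(∂)`, and pairing with the `m`-th power of the linear form `a ⬝ (x, y, z)` is `m!`
times evaluation at `a`. Hence the solutions in `Sₘ` are the orthogonal complement of `F Sₘ₋ₙ`,
which gives their dimension, and the orthogonal complement of the powers of the linear forms of
the points `ξ(t)` consists of the forms that vanish along the curve, that is, of `F Sₘ₋ₙ` again.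
So these powers span the solutions (`homogeneousSolutions_basis`).

**Integral representation.** A real-analytic solution has near `p` an expansion
`V(p + h) = ∑ Pₘ(h)` into homogeneous solutions whose coefficients grow at most exponentially
(`HasFormExpansion.polyDiffOp_eq_zero`). Fix a small disc `K ⊆ D`, and let `γ` be a larger
concentric circle. The functional `G ∘ ξ|_K ↦ ⟨G, Pₘ⟩ / m!` is well defined on the restrictions of
forms of degree `m`; extend it to a functional `ℓₘ` on the continuous functions on `K` by the
Hahn–Banach theorem. Its Cauchy kernel `φₘ(t) = (2πi)⁻¹ ℓₘ((t - ·)⁻¹)` is holomorphic off `K`, and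
`∮ φₘ(t) (ξ(t) ⬝ h)ᵐ dt = Pₘ(h)`. So `Φ(σ, t) = ∑ φₘ(t) (σ - ξ(t) ⬝ p)ᵐ` represents `V`, provided
the norms of the `ℓₘ` grow at most exponentially in `m`.

This is the key estimate `exists_division_bound`: a form `G ∈ Sₘ` with `|G ∘ ξ| ≤ ε` on `K` is
congruent modulo `F` to a form with coefficients of size at most `Aᵐ⁺¹ ε`, with `A` independent of
`m`. After a linear change of coordinates the curve is a branched covering of degree `n` of the
line, and `G` may be taken of degree less than `n` in the fiber coordinate and with coefficients
of size `1`. By the two-constants theorem, smallness of `G` on `K` spreads along the branches of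
the covering, at the cost of a root and of a constant to the power `m` (`IsControlled.spread`). It
reaches all branches since the curve is connected off its branch points
(`forall_of_locally_constant`): otherwise a trace over the branches that are reached would be a
nonzero form of degree `n - 1` that vanishes on a piece of the curve. Smallness on all `n`
branches over a disc bounds the coefficients of `G` by inversion of a Vandermonde matrix.
-/

noncomputable section

/-! ### Irreducibility of the curve and divisibility of forms that vanish on it -/

lemma MvPolynomial.IsHomogeneous.eval_smul {n : ℕ} {H : MvPolynomial (Fin 3) ℂ}
    (h : H.IsHomogeneous n) (c : ℂ) (v : Fin 3 → ℂ) : eval (c • v) H = c ^ n * eval v H := by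
  rw [eval_eq', eval_eq', Finset.mul_sum]
  refine Finset.sum_congr rfl fun d hd => ?_
  have hd' : ∑ i, d i = n := by
    rw [h.degree_eq_sum_deg_support hd, Finset.sum_subset (Finset.subset_univ d.support)
      fun i _ hi => Finsupp.notMem_support_iff.1 hi]
  rw [← hd', ← Finset.prod_pow_eq_pow_sum, mul_left_comm, ← Finset.prod_mul_distrib]
  simp [mul_pow]

lemma eval_aeval_line (a : Fin 3 → ℂ) (H : MvPolynomial (Fin 3) ℂ) (c : ℂ) :
    (aeval (fun i => Polynomial.C (a i) * Polynomial.X) H).eval c = eval (c • a) H := by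
  rw [← Polynomial.coe_aeval_eq_eval, ← AlgHom.comp_apply, comp_aeval, ← coe_aeval_eq_eval]
  have : (fun i => (Polynomial.aeval c) (Polynomial.C (a i) * Polynomial.X)) = c • a := by
    ext i
    rw [map_mul, Polynomial.aeval_C, Polynomial.aeval_X, Pi.smul_apply, smul_eq_mul, mul_comm]
    rfl
  rw [this]
  rfl

/-- The ideal of the line through the origin spanned by `a`. -/
def lineIdeal (a : Fin 3 → ℂ) : Ideal (MvPolynomial (Fin 3) ℂ) :=
  RingHom.ker (aeval (fun i => Polynomial.C (a i) * Polynomial.X) :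
    MvPolynomial (Fin 3) ℂ →ₐ[ℂ] Polynomial ℂ)

instance lineIdeal_isPrime (a : Fin 3 → ℂ) : (lineIdeal a).IsPrime := RingHom.ker_isPrime _

/-- The ideal of the origin of `ℂ³`. -/
def originIdeal : Ideal (MvPolynomial (Fin 3) ℂ) := RingHom.ker (eval (0 : Fin 3 → ℂ))

instance originIdeal_isPrime : originIdeal.IsPrime := RingHom.ker_isPrime _

lemma mem_originIdeal {H : MvPolynomial (Fin 3) ℂ} : H ∈ originIdeal ↔ eval 0 H = 0 := Iff.rfl

lemma mem_lineIdeal {a : Fin 3 → ℂ} {H : MvPolynomial (Fin 3) ℂ} :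
    H ∈ lineIdeal a ↔ ∀ c : ℂ, eval (c • a) H = 0 := by
  simp only [← eval_aeval_line]
  constructor
  · intro h c
    have h' : aeval (fun i => Polynomial.C (a i) * Polynomial.X) H = 0 := h
    rw [h', Polynomial.eval_zero]
  · intro h
    exact Polynomial.funext (by simpa using h)

lemma lineIdeal_lt_originIdeal {a : Fin 3 → ℂ} (ha : a ≠ 0) : lineIdeal a < originIdeal := by
  obtain ⟨i, hi⟩ := Function.ne_iff.mp ha
  refine lt_of_le_of_ne (fun H hH => ?_) fun h => ?_
  · rw [mem_originIdeal, ← zero_smul ℂ a]; exact mem_lineIdeal.1 hH 0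
  · have : (X i : MvPolynomial (Fin 3) ℂ) ∈ lineIdeal a := by
      rw [h, mem_originIdeal]; simp
    have := mem_lineIdeal.1 this 1
    simp at this
    exact hi this

lemma originIdeal_height_le : originIdeal.height ≤ 3 := by
  have h := Ideal.height_le_ringKrullDim_of_isPrime (I := originIdeal)
  rw [MvPolynomial.ringKrullDim_of_isNoetherianRing, ringKrullDim_eq_zero_of_field] at h
  have h' : (originIdeal.height : WithBot ℕ∞) ≤ ((3 : ℕ∞) : WithBot ℕ∞) := by simpa using h
  exact WithBot.coe_le_coe.1 h'

lemma height_add_two_le {P : Ideal (MvPolynomial (Fin 3) ℂ)} [P.IsPrime] {a : Fin 3 → ℂ}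
    (ha : a ≠ 0) (hP : P < lineIdeal a) : P.height + 2 ≤ originIdeal.height := by
  calc P.height + 2 = P.height + 1 + 1 := by rw [add_assoc]; norm_num
    _ ≤ (lineIdeal a).height + 1 := by
      gcongr; exact Ideal.height_add_one_le_of_lt_of_isPrime hP
    _ ≤ _ := Ideal.height_add_one_le_of_lt_of_isPrime (lineIdeal_lt_originIdeal ha)

lemma one_le_height_span_of_prime {G : MvPolynomial (Fin 3) ℂ} (hG : Prime G) :
    1 ≤ (Ideal.span {G}).height := by
  have : (Ideal.span {G}).IsPrime := (Ideal.span_singleton_prime hG.ne_zero).2 hG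
  have h : (⊥ : Ideal (MvPolynomial (Fin 3) ℂ)) < Ideal.span {G} := by
    rw [bot_lt_iff_ne_bot, Ne, Ideal.span_singleton_eq_bot]; exact hG.ne_zero
  have := Ideal.height_add_one_le_of_lt_of_isPrime h
  exact le_trans (by simp) this

/-- Two surfaces through the origin of `ℂ³` meet in a second point: the maximal ideal of the
origin has height `3`, so it is not a minimal prime over an ideal with two generators. -/
lemma exists_common_zero (A B : MvPolynomial (Fin 3) ℂ) (hA : eval 0 A = 0) (hB : eval 0 B = 0) :
    ∃ v : Fin 3 → ℂ, v ≠ 0 ∧ eval v A = 0 ∧ eval v B = 0 := by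
  by_contra! hcon
  -- the chain `0 < (X₀) < (X₀, X₁) < (X₀, X₁, X₂)`
  have hlow : 3 ≤ originIdeal.height := by
    have hX : Prime (X 0 : MvPolynomial (Fin 3) ℂ) := X_prime
    have : (Ideal.span {(X 0 : MvPolynomial (Fin 3) ℂ)}).IsPrime :=
      (Ideal.span_singleton_prime hX.ne_zero).2 hX
    let a : Fin 3 → ℂ := Pi.single 2 1
    have ha : a ≠ 0 := by simp [a]
    have hlt : Ideal.span {(X 0 : MvPolynomial (Fin 3) ℂ)} < lineIdeal a := by
      refine lt_of_le_of_ne ?_ fun h => ?_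
      · rw [Ideal.span_singleton_le_iff_mem, mem_lineIdeal]
        simp [a]
      · have h1 : (X 1 : MvPolynomial (Fin 3) ℂ) ∈ Ideal.span {(X 0 : MvPolynomial (Fin 3) ℂ)} := by
          rw [h, mem_lineIdeal]; simp [a]
        obtain ⟨q, hq⟩ := Ideal.mem_span_singleton'.1 h1
        have := congrArg (eval (Pi.single 1 1 : Fin 3 → ℂ)) hq
        simp at this
    calc (3 : ℕ∞) = 1 + 2 := by norm_num
      _ ≤ _ := by gcongr; exact one_le_height_span_of_prime hX
      _ ≤ _ := height_add_two_le ha hlt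
  -- by the Nullstellensatz the maximal ideal is the radical of `(A, B)`
  have hrad : (Ideal.span (({A, B} : Finset (MvPolynomial (Fin 3) ℂ)) : Set _)).radical
      = originIdeal := by
    rw [← vanishingIdeal_zeroLocus_eq_radical (K := ℂ), zeroLocus_span]
    ext H
    rw [mem_vanishingIdeal_iff, mem_originIdeal]
    constructor
    · intro h
      exact h 0 (by rintro p hp; simp at hp; rcases hp with rfl | rfl <;> assumption)
    · intro h v hv
      have hv' : eval v A = 0 ∧ eval v B = 0 := ⟨hv A (by simp), hv B (by simp)⟩
      have : v = 0 := by
        by_contra hne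
        exact hcon v hne hv'.1 hv'.2
      rw [this]; exact h
  have hmin : originIdeal ∈
      (Ideal.span (({A, B} : Finset (MvPolynomial (Fin 3) ℂ)) : Set _)).minimalPrimes := by
    rw [← Ideal.radical_minimalPrimes, hrad, Ideal.minimalPrimes_eq_subsingleton_self]
    rfl
  have h1 := Ideal.height_le_card_of_mem_minimalPrimes_span_finset hmin
  have h2 : (({A, B} : Finset (MvPolynomial (Fin 3) ℂ)).card : ℕ∞) ≤ 2 := by
    exact_mod_cast Finset.card_le_two
  have := (hlow.trans h1).trans h2
  norm_num at this

/-- A factor of a form that does not vanish at the origin is a constant. -/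
lemma isUnit_of_mul_isHomogeneous {n : ℕ} {A B : MvPolynomial (Fin 3) ℂ}
    (h : (A * B).IsHomogeneous n) (hne : A * B ≠ 0) (hA : eval 0 A ≠ 0) : IsUnit A := by
  have hA0 : A ≠ 0 := left_ne_zero_of_mul hne
  have hB0 : B ≠ 0 := right_ne_zero_of_mul hne
  have hdeg : A.totalDegree + B.totalDegree = n := by
    rw [← totalDegree_mul_of_isDomain hA0 hB0]; exact h.totalDegree hne
  -- restriction to a line through the origin on which `B` does not vanish
  obtain ⟨v, hv⟩ : ∃ v, eval v (A * B) ≠ 0 := by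
    by_contra! hcon
    exact hne (MvPolynomial.funext (by simpa using hcon))
  let φ : MvPolynomial (Fin 3) ℂ →ₐ[ℂ] Polynomial ℂ :=
    aeval (fun i => Polynomial.C (v i) * Polynomial.X)
  have hφe : ∀ (H : MvPolynomial (Fin 3) ℂ) (c : ℂ), (φ H).eval c = eval (c • v) H :=
    eval_aeval_line v
  have hφdeg : ∀ H : MvPolynomial (Fin 3) ℂ, (φ H).natDegree ≤ H.totalDegree := by
    intro H
    have hs : φ H = ∑ d ∈ H.support, Polynomial.C (H.coeff d) *
        ∏ i, (Polynomial.C (v i) * Polynomial.X) ^ d i := by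
      simp only [φ, aeval_def, eval₂_eq']
      rfl
    rw [hs]
    refine Polynomial.natDegree_sum_le_of_forall_le _ _ fun d hd => ?_
    refine (Polynomial.natDegree_C_mul_le _ _).trans ((Polynomial.natDegree_prod_le _ _).trans ?_)
    refine le_trans (Finset.sum_le_sum fun i _ => ?_)
      ((Finsupp.sum_fintype d (fun _ k => k) (fun _ => rfl)).symm.le.trans (le_totalDegree hd))
    refine Polynomial.natDegree_pow_le.trans ?_
    have : (Polynomial.C (v i) * Polynomial.X).natDegree ≤ 1 :=
      (Polynomial.natDegree_C_mul_le _ _).trans Polynomial.natDegree_X_le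
    simpa using Nat.mul_le_mul_left (d i) this
  -- on the line, `φ A` divides a power of the coordinate and is prime to the coordinate
  have hprod : φ A * φ B = Polynomial.C (eval v (A * B)) * Polynomial.X ^ n := by
    rw [← map_mul]
    refine Polynomial.funext fun c => ?_
    rw [hφe, h.eval_smul]
    simp [mul_comm]
  have hXA : ¬ Polynomial.X ∣ φ A := by
    rw [Polynomial.X_dvd_iff, Polynomial.coeff_zero_eq_eval_zero, hφe]
    simpa using hA
  have hXB : Polynomial.X ^ n ∣ φ B := by
    refine (Polynomial.prime_X.pow_dvd_of_dvd_mul_left n hXA) ?_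
    rw [hprod]
    exact Dvd.intro_left _ rfl
  have hφB : φ B ≠ 0 := by
    intro h0
    rw [h0, mul_zero] at hprod
    have := congrArg (Polynomial.eval 1) hprod
    simp at this
    simp at hv
    tauto
  have hnB : n ≤ B.totalDegree := by
    have := Polynomial.natDegree_le_of_dvd hXB hφB
    rw [Polynomial.natDegree_X_pow] at this
    exact this.trans (hφdeg B)
  have hA1 : A.totalDegree = 0 := by omega
  rw [totalDegree_eq_zero_iff_eq_C] at hA1
  rw [hA1]
  refine (IsUnit.mk0 _ fun h0 => hA0 ?_).map C
  rw [hA1, h0, C_0]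

/-- A smooth plane curve is irreducible: two factors would have a common zero, and the gradient
of the product vanishes there. -/
lemma IsSmoothPlaneCurve.prime {n : ℕ} (hn : 2 ≤ n) {F : MvPolynomial (Fin 3) ℂ}
    (hF : F.IsHomogeneous n) (hs : IsSmoothPlaneCurve F) : Prime F := by
  have hF0 : F ≠ 0 := by
    rintro rfl
    obtain ⟨i, hi⟩ := hs 1 one_ne_zero (by simp)
    simp at hi
  have hFz : eval 0 F = 0 := by
    have := hF.eval_smul 0 0
    rwa [smul_zero, zero_pow (by omega), zero_mul] at this
  rw [← irreducible_iff_prime]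
  refine ⟨fun hu => ?_, fun A B hAB => ?_⟩
  · have := hu.map (eval (0 : Fin 3 → ℂ))
    rw [hFz] at this
    exact not_isUnit_zero this
  by_contra! hcon
  have hA : eval 0 A = 0 := by
    by_contra h
    exact hcon.1 (isUnit_of_mul_isHomogeneous (hAB ▸ hF) (hAB ▸ hF0) h)
  have hB : eval 0 B = 0 := by
    by_contra h
    rw [mul_comm] at hAB
    exact hcon.2 (isUnit_of_mul_isHomogeneous (hAB ▸ hF) (hAB ▸ hF0) h)
  obtain ⟨v, hv, hvA, hvB⟩ := exists_common_zero A B hA hB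
  obtain ⟨i, hi⟩ := hs v hv (by rw [hAB, map_mul, hvA, zero_mul])
  apply hi
  rw [hAB, Derivation.leibniz]
  simp [hvA, hvB]

lemma differentiableOn_eval_comp {D : Set ℂ} {ξ : ℂ → Fin 3 → ℂ} (hξ : DifferentiableOn ℂ ξ D)
    (H : MvPolynomial (Fin 3) ℂ) : DifferentiableOn ℂ (fun t => eval (ξ t) H) D := by
  have hc : ∀ i, DifferentiableOn ℂ (fun t => ξ t i) D := fun i =>
    differentiableOn_pi.1 hξ i
  simp only [eval_eq']
  fun_prop

/-- The polynomials that vanish on the cone over the parametrized part of a curve form a prime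
ideal. -/
lemma exists_coneIdeal {D : Set ℂ} {ξ : ℂ → Fin 3 → ℂ} (hD : IsOpen D) (hc : IsPreconnected D)
    (hne : D.Nonempty) (hξ : DifferentiableOn ℂ ξ D) :
    ∃ P : Ideal (MvPolynomial (Fin 3) ℂ), P.IsPrime ∧
      ∀ H, H ∈ P ↔ ∀ c : ℂ, ∀ t ∈ D, eval (c • ξ t) H = 0 := by
  let P : Ideal (MvPolynomial (Fin 3) ℂ) :=
    { carrier := {H | ∀ c : ℂ, ∀ t ∈ D, eval (c • ξ t) H = 0}
      add_mem' := fun {a b} ha hb c t ht => by rw [map_add, ha c t ht, hb c t ht, add_zero]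
      zero_mem' := fun c t _ => by simp
      smul_mem' := fun a b hb c t ht => by rw [smul_eq_mul, map_mul, hb c t ht, mul_zero] }
  have hP : ∀ H, H ∈ P ↔ ∀ c : ℂ, ∀ t ∈ D, eval (c • ξ t) H = 0 := fun H => Iff.rfl
  refine ⟨P, ⟨?_, ?_⟩, hP⟩
  · rw [Ideal.ne_top_iff_one, hP]
    obtain ⟨t, ht⟩ := hne
    intro h
    simpa using h 0 t ht
  · intro A B hAB
    rw [or_iff_not_imp_left]
    intro hA
    rw [hP] at hA hAB ⊢
    push Not at hA
    obtain ⟨c₀, t₀, ht₀, hne₀⟩ := hA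
    have hξc : ∀ c : ℂ, DifferentiableOn ℂ (fun t => c • ξ t) D := fun c => hξ.const_smul c
    have hzero : ∀ c : ℂ, eval (c • ξ t₀) A ≠ 0 → ∀ t ∈ D, eval (c • ξ t) B = 0 := by
      intro c hc0
      have hBan : AnalyticOnNhd ℂ (fun t => eval (c • ξ t) B) D :=
        (differentiableOn_eval_comp (hξc c) B).analyticOnNhd hD
      have hcont : ContinuousAt (fun t => eval (c • ξ t) A) t₀ :=
        ((differentiableOn_eval_comp (hξc c) A).differentiableAt (hD.mem_nhds ht₀)).continuousAt
      refine hBan.eqOn_zero_of_preconnected_of_eventuallyEq_zero hc ht₀ ?_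
      filter_upwards [hcont.eventually_ne hc0, hD.mem_nhds ht₀] with t ht htD
      have := hAB c t htD
      rw [map_mul] at this
      exact (mul_eq_zero.1 this).resolve_left ht
    intro c t ht
    -- for fixed `t` a polynomial in `c` that vanishes near `c₀`
    have han : ∀ (H : MvPolynomial (Fin 3) ℂ) (s : ℂ),
        Differentiable ℂ (fun c : ℂ => eval (c • ξ s) H) := by
      intro H s
      rw [← differentiableOn_univ]
      exact differentiableOn_eval_comp (ξ := fun c : ℂ => c • ξ s) (by fun_prop) H
    have hBan : AnalyticOnNhd ℂ (fun c : ℂ => eval (c • ξ t) B) Set.univ :=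
      (han B t).differentiableOn.analyticOnNhd isOpen_univ
    refine hBan.eqOn_zero_of_preconnected_of_eventuallyEq_zero isPreconnected_univ
      (Set.mem_univ c₀) ?_ (Set.mem_univ c)
    filter_upwards [(han A t₀).continuous.continuousAt.eventually_ne hne₀] with c' hc'
    exact hzero c' hc' t ht

/-- A form that vanishes along the parametrized part of an irreducible curve is divisible by the
equation of the curve. Otherwise the ideals of the curve, of the cone over its parametrized part,
of a line of this cone and of the origin would be a chain of primes that is too long for a
polynomial ring in three variables. -/
theorem IsUniformizedBy.dvd {F : MvPolynomial (Fin 3) ℂ} (hF : Prime F) {n : ℕ}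
    (hFh : F.IsHomogeneous n) {D : Set ℂ} {ξ : ℂ → Fin 3 → ℂ} (hξ : IsUniformizedBy F D ξ)
    {m : ℕ} {G : MvPolynomial (Fin 3) ℂ} (hG : G.IsHomogeneous m)
    (h0 : ∀ t ∈ D, eval (ξ t) G = 0) : F ∣ G := by
  by_contra hcon
  obtain ⟨s, hs, t, ht, hli⟩ := hξ.nonconstant
  obtain ⟨P, hPp, hP⟩ := exists_coneIdeal hξ.isOpen hξ.isPreconnected ⟨s, hs⟩ hξ.differentiableOn
  have hFP : F ∈ P := (hP F).2 fun c t ht => by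
    rw [hFh.eval_smul, hξ.mem_curve t ht, mul_zero]
  have hGP : G ∈ P := (hP G).2 fun c t ht => by
    rw [hG.eval_smul, h0 t ht, mul_zero]
  have : (Ideal.span {F}).IsPrime := (Ideal.span_singleton_prime hF.ne_zero).2 hF
  have hlt : Ideal.span {F} < P := by
    refine lt_of_le_of_ne (by rwa [Ideal.span_singleton_le_iff_mem]) fun h => hcon ?_
    rwa [← Ideal.mem_span_singleton, h]
  have hlt2 : P < lineIdeal (ξ s) := by
    refine lt_of_le_of_ne (fun H hH => mem_lineIdeal.2 fun c => (hP H).1 hH c s hs) fun h => ?_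
    -- a coordinate minor of `ξ s` and `ξ t` is a linear form vanishing on the line of `ξ s` only
    obtain ⟨i, hi⟩ := Function.ne_iff.mp (hξ.ne_zero s hs)
    have hsub : ∀ j, ξ s i * ξ t j = ξ s j * ξ t i := by
      intro j
      have hm : (C (ξ s i) * X j - C (ξ s j) * X i : MvPolynomial (Fin 3) ℂ) ∈ P := by
        rw [h, mem_lineIdeal]
        intro c
        simp
        ring
      have := (hP _).1 hm 1 t ht
      simp at this
      linear_combination this
    rw [LinearIndependent.pair_iff] at hli
    have := (hli (ξ t i) (-ξ s i) (by
      ext j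
      simp
      linear_combination (-1 : ℂ) * hsub j)).2
    exact hi (by simpa using this)
  have h1 := one_le_height_span_of_prime hF
  have h2 := Ideal.height_add_one_le_of_lt_of_isPrime hlt
  have h3 := height_add_two_le (hξ.ne_zero s hs) hlt2
  have h4 : (4 : ℕ∞) ≤ 3 := by
    calc (4 : ℕ∞) = 1 + 1 + 2 := by norm_num
      _ ≤ (Ideal.span {F}).height + 1 + 2 := by gcongr
      _ ≤ P.height + 2 := by gcongr
      _ ≤ _ := h3.trans originIdeal_height_le
  norm_num at h4

/-! ### The apolar pairing and the homogeneous solutions -/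

/-- The differential operator `∂^d` on polynomials. -/
def monomialDiffOp (d : Fin 3 →₀ ℕ) : Module.End ℂ (MvPolynomial (Fin 3) ℂ) :=
  (pderiv 0).toLinearMap ^ d 0 * (pderiv 1).toLinearMap ^ d 1 * (pderiv 2).toLinearMap ^ d 2

/-- `polyDiffOp F` as a linear function of `F`. -/
def polyDiffOpLinear : MvPolynomial (Fin 3) ℂ →ₗ[ℂ] Module.End ℂ (MvPolynomial (Fin 3) ℂ) :=
  (basisMonomials (Fin 3) ℂ).constr ℂ monomialDiffOp

lemma polyDiffOpLinear_monomial (d : Fin 3 →₀ ℕ) (c : ℂ) :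
    polyDiffOpLinear (monomial d c) = c • monomialDiffOp d := by
  have : (monomial d c : MvPolynomial (Fin 3) ℂ) = c • basisMonomials (Fin 3) ℂ d := by
    rw [coe_basisMonomials, smul_monomial, smul_eq_mul, mul_one]
  rw [this, map_smul, polyDiffOpLinear, Module.Basis.constr_basis]

lemma polyDiffOpLinear_apply (F : MvPolynomial (Fin 3) ℂ) : polyDiffOpLinear F = polyDiffOp F := by
  conv_lhs => rw [F.as_sum, map_sum]
  exact Finset.sum_congr rfl fun d _ => polyDiffOpLinear_monomial d _

lemma commute_pderiv (i j : Fin 3) :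
    Commute ((pderiv i).toLinearMap : Module.End ℂ (MvPolynomial (Fin 3) ℂ))
      (pderiv j).toLinearMap := by
  refine LinearMap.ext fun P => ?_
  induction P using MvPolynomial.induction_on' with
  | add p q hp hq => rw [map_add, map_add, hp, hq]
  | monomial u a =>
    change pderiv i (pderiv j (monomial u a)) = pderiv j (pderiv i (monomial u a))
    simp only [pderiv_monomial]
    rcases eq_or_ne i j with rfl | hij
    · rfl
    · rw [tsub_right_comm]
      congr 1
      simp [hij, hij.symm]
      ring

lemma monomialDiffOp_add (d e : Fin 3 →₀ ℕ) :
    monomialDiffOp (d + e) = monomialDiffOp d * monomialDiffOp e := by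
  have h1 := (commute_pderiv 1 0).pow_pow (d 1) (e 0)
  have h2 := (commute_pderiv 2 0).pow_pow (d 2) (e 0)
  have h3 := (commute_pderiv 2 1).pow_pow (d 2) (e 1)
  simp only [monomialDiffOp, Finsupp.add_apply, pow_add]
  simp only [mul_assoc]
  congr 1
  rw [← mul_assoc (_ ^ d 2) (_ ^ e 0), h2.eq]
  simp only [← mul_assoc]
  rw [h1.eq]
  simp only [mul_assoc]
  congr 2
  rw [← mul_assoc (_ ^ d 2) (_ ^ e 1), h3.eq]
  simp only [mul_assoc]

lemma polyDiffOp_mul (A B : MvPolynomial (Fin 3) ℂ) :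
    polyDiffOp (A * B) = polyDiffOp A * polyDiffOp B := by
  simp only [← polyDiffOpLinear_apply]
  induction A using MvPolynomial.induction_on' with
  | add p q hp hq => rw [add_mul, map_add, map_add, hp, hq, add_mul]
  | monomial u a =>
    induction B using MvPolynomial.induction_on' with
    | add p q hp hq => rw [mul_add, map_add, map_add, hp, hq, mul_add]
    | monomial w b =>
      rw [monomial_mul]
      simp only [polyDiffOpLinear_monomial, monomialDiffOp_add, smul_mul_smul_comm]

lemma pderiv_pow_monomial (i : Fin 3) (k : ℕ) (d : Fin 3 →₀ ℕ) (c : ℂ) :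
    ((pderiv i).toLinearMap ^ k : Module.End ℂ (MvPolynomial (Fin 3) ℂ)) (monomial d c) =
      monomial (d - Finsupp.single i k) (c * (d i).descFactorial k) := by
  induction k with
  | zero => simp
  | succ k ih =>
    rw [pow_succ', Module.End.mul_apply, ih]
    change pderiv i _ = _
    rw [pderiv_monomial, tsub_tsub, ← Finsupp.single_add, Nat.descFactorial_succ]
    congr 1
    simp
    ring

/-- `d! = d₀! d₁! d₂!`. -/
def multiFactorial (d : Fin 3 →₀ ℕ) : ℕ := (d 0).factorial * (d 1).factorial * (d 2).factorial

lemma coeff_zero_monomialDiffOp (d : Fin 3 →₀ ℕ) (P : MvPolynomial (Fin 3) ℂ) :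
    coeff 0 (monomialDiffOp d P) = multiFactorial d * coeff d P := by
  induction P using MvPolynomial.induction_on' with
  | add p q hp hq => rw [map_add, coeff_add, coeff_add, hp, hq, mul_add]
  | monomial u a =>
    simp only [monomialDiffOp, Module.End.mul_apply, pderiv_pow_monomial]
    rw [coeff_monomial, coeff_monomial]
    have he : u - Finsupp.single 2 (d 2) - Finsupp.single 1 (d 1) - Finsupp.single 0 (d 0)
        = u - d := by
      ext i
      fin_cases i <;> simp
    rw [he]
    by_cases hud : u = d
    · subst hud
      simp [multiFactorial, Nat.descFactorial_self]
      ring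
    · rw [if_neg hud, mul_zero]
      split_ifs with h
      · have hle : ∀ i, u i ≤ d i := fun i => by
          have := DFunLike.congr_fun h i
          simpa [tsub_eq_zero_iff_le] using this
        obtain ⟨i, hi⟩ : ∃ i, u i < d i := by
          by_contra! hc
          exact hud (Finsupp.ext fun i => le_antisymm (hle i) (hc i))
        have h0 : (u i).descFactorial (d i) = 0 := Nat.descFactorial_of_lt hi
        fin_cases i <;> simp at h0 <;> simp [h0]
      · rfl

/-- The apolar pairing `⟨G, P⟩ = (G(∂/∂x, ∂/∂y, ∂/∂z) P)(0)`. -/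
def apolar : LinearMap.BilinForm ℂ (MvPolynomial (Fin 3) ℂ) :=
  polyDiffOpLinear.compr₂ (lcoeff ℂ 0)

lemma apolar_apply (G P : MvPolynomial (Fin 3) ℂ) : apolar G P = coeff 0 (polyDiffOp G P) := by
  rw [← polyDiffOpLinear_apply]; rfl

lemma apolar_eq_sum (G P : MvPolynomial (Fin 3) ℂ) :
    apolar G P = ∑ d ∈ G.support, multiFactorial d * (coeff d G * coeff d P) := by
  rw [apolar_apply, polyDiffOp, LinearMap.sum_apply, coeff_sum]
  refine Finset.sum_congr rfl fun d _ => ?_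
  rw [LinearMap.smul_apply, coeff_smul, smul_eq_mul]
  have := coeff_zero_monomialDiffOp d P
  rw [monomialDiffOp] at this
  rw [this]
  ring

lemma apolar_comm (G P : MvPolynomial (Fin 3) ℂ) : apolar G P = apolar P G := by
  classical
  have key : ∀ A B : MvPolynomial (Fin 3) ℂ, apolar A B =
      ∑ d ∈ A.support ∪ B.support, multiFactorial d * (coeff d A * coeff d B) := by
    intro A B
    rw [apolar_eq_sum]
    refine Finset.sum_subset Finset.subset_union_left fun d _ hd => ?_
    rw [notMem_support_iff] at hd
    simp [hd]
  rw [key, key, Finset.union_comm]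
  exact Finset.sum_congr rfl fun d _ => by ring

lemma apolar_monomial (d : Fin 3 →₀ ℕ) (P : MvPolynomial (Fin 3) ℂ) :
    apolar (monomial d 1) P = multiFactorial d * coeff d P := by
  rw [apolar_apply, ← polyDiffOpLinear_apply, polyDiffOpLinear_monomial, one_smul,
    coeff_zero_monomialDiffOp]

lemma multiFactorial_ne_zero (d : Fin 3 →₀ ℕ) : (multiFactorial d : ℂ) ≠ 0 := by
  simp [multiFactorial, Nat.factorial_ne_zero]

/-- Multiplication by `B` is adjoint to the operator of `B`. -/
lemma apolar_mul (A B P : MvPolynomial (Fin 3) ℂ) :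
    apolar (A * B) P = apolar A (polyDiffOp B P) := by
  rw [apolar_apply, apolar_apply, polyDiffOp_mul]; rfl

lemma pderiv_pow_linearForm_pow (i : Fin 3) (a : Fin 3 → ℂ) (k m : ℕ) :
    ((pderiv i).toLinearMap ^ k : Module.End ℂ (MvPolynomial (Fin 3) ℂ)) (linearForm a ^ m) =
      ((m.descFactorial k : ℂ) * a i ^ k) • linearForm a ^ (m - k) := by
  induction k with
  | zero => simp
  | succ k ih =>
    have hp : pderiv i (linearForm a) = C (a i) := by
      simp only [linearForm, map_sum, Derivation.leibniz, pderiv_C, pderiv_X, smul_eq_mul]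
      simp [Pi.single_apply]
    rw [pow_succ', Module.End.mul_apply, ih, map_smul]
    change _ • pderiv i _ = _
    rw [Derivation.leibniz_pow, hp, Nat.descFactorial_succ, Nat.sub_sub]
    simp only [smul_eq_C_mul, smul_eq_mul, nsmul_eq_mul, map_mul, map_pow, map_natCast]
    push_cast
    ring

lemma polyDiffOp_linearForm_pow {k : ℕ} {G : MvPolynomial (Fin 3) ℂ} (hG : G.IsHomogeneous k)
    (a : Fin 3 → ℂ) (m : ℕ) : polyDiffOp G (linearForm a ^ m) =
      ((m.descFactorial k : ℂ) * eval a G) • linearForm a ^ (m - k) := by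
  rw [polyDiffOp, LinearMap.sum_apply, eval_eq', Finset.mul_sum, Finset.sum_smul]
  refine Finset.sum_congr rfl fun d hd => ?_
  have hdk : d 2 + d 1 + d 0 = k := by
    rw [hG.degree_eq_sum_deg_support hd, Finset.sum_subset (Finset.subset_univ d.support)
      fun i _ hi => Finsupp.notMem_support_iff.1 hi, Fin.sum_univ_three]
    ring
  simp only [LinearMap.smul_apply, Module.End.mul_apply, pderiv_pow_linearForm_pow, map_smul,
    smul_smul]
  rw [Nat.sub_sub, Nat.sub_sub, hdk, Fin.prod_univ_three]
  congr 1
  have h1 := Nat.descFactorial_mul_descFactorial (n := m) (Nat.le_add_right (d 2) (d 1))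
  have h2 := Nat.descFactorial_mul_descFactorial (n := m) (Nat.le_add_right (d 2 + d 1) (d 0))
  rw [Nat.add_sub_cancel_left] at h1 h2
  rw [hdk] at h2
  rw [← h2, ← h1]
  push_cast
  ring

lemma linearForm_isHomogeneous (a : Fin 3 → ℂ) : (linearForm a).IsHomogeneous 1 :=
  IsHomogeneous.sum _ _ _ fun i _ => (isHomogeneous_X ℂ i).C_mul (a i)

lemma linearForm_pow_isHomogeneous (a : Fin 3 → ℂ) (m : ℕ) :
    (linearForm a ^ m).IsHomogeneous m := by
  simpa using (linearForm_isHomogeneous a).pow m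

/-- Evaluation at `a` is the apolar pairing with a power of the linear form of `a`. -/
lemma apolar_linearForm_pow {m : ℕ} {G : MvPolynomial (Fin 3) ℂ} (hG : G.IsHomogeneous m)
    (a : Fin 3 → ℂ) : apolar G (linearForm a ^ m) = m.factorial * eval a G := by
  rw [apolar_apply, polyDiffOp_linearForm_pow hG, Nat.descFactorial_self]
  simp

lemma apolar_eq_zero_of_isHomogeneous {k l : ℕ} (hkl : k ≠ l) {G P : MvPolynomial (Fin 3) ℂ}
    (hG : G.IsHomogeneous k) (hP : P.IsHomogeneous l) : apolar G P = 0 := by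
  rw [apolar_eq_sum]
  refine Finset.sum_eq_zero fun d hd => ?_
  have h1 := hG.degree_eq_sum_deg_support hd
  have : coeff d P = 0 := by
    by_contra h
    have h2 := hP.degree_eq_sum_deg_support (mem_support_iff.2 h)
    omega
  simp [this]

/-- For `m < n` the truncated degree is `0`, and the result is in fact `0`. -/
lemma polyDiffOp_isHomogeneous {n m : ℕ} {F P : MvPolynomial (Fin 3) ℂ} (hF : F.IsHomogeneous n)
    (hP : P.IsHomogeneous m) : (polyDiffOp F P).IsHomogeneous (m - n) := by
  intro d hd
  by_contra hne
  -- pair the operator with a monomial of the wrong degree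
  have h1 : apolar (monomial d 1 * F) P = 0 := by
    refine apolar_eq_zero_of_isHomogeneous (k := d.degree + n) (l := m) ?_
      ((isHomogeneous_monomial 1 rfl).mul hF) hP
    intro h
    apply hne
    rw [Pi.one_def, ← Finsupp.degree_eq_weight_one]
    exact (Nat.sub_eq_of_eq_add h.symm).symm
  rw [apolar_mul, apolar_monomial] at h1
  exact hd ((mul_eq_zero.1 h1).resolve_left (multiFactorial_ne_zero d))

lemma homogeneousComponent_mul_of_isHomogeneous {n : ℕ} {F : MvPolynomial (Fin 3) ℂ}
    (hF : F.IsHomogeneous n) (H : MvPolynomial (Fin 3) ℂ) (m : ℕ) :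
    homogeneousComponent m (F * H) =
      if n ≤ m then F * homogeneousComponent (m - n) H else 0 := by
  induction H using MvPolynomial.induction_on' with
  | add p q hp hq =>
    rw [mul_add, map_add, hp, hq, map_add, mul_add]
    split_ifs <;> simp
  | monomial u a =>
    have hu : (monomial u a : MvPolynomial (Fin 3) ℂ).IsHomogeneous u.degree :=
      isHomogeneous_monomial a rfl
    have hFu := hF.mul hu
    rw [homogeneousComponent_of_mem hFu]
    split_ifs with h1 h2 h2
    · rw [homogeneousComponent_of_mem hu, if_pos (by omega)]
    · omega
    · rw [homogeneousComponent_of_mem hu, if_neg (by omega), mul_zero]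
    · rfl

lemma exists_isHomogeneous_of_dvd {n m : ℕ} {F G : MvPolynomial (Fin 3) ℂ}
    (hF : F.IsHomogeneous n) (hG : G.IsHomogeneous m) (hdvd : F ∣ G) :
    ∃ H, G = F * H ∧ H.IsHomogeneous (m - n) ∧ (m < n → G = 0) := by
  obtain ⟨H, rfl⟩ := hdvd
  have h := homogeneousComponent_mul_of_isHomogeneous hF H m
  rw [homogeneousComponent_of_mem hG, if_pos rfl] at h
  split_ifs at h with hnm
  · exact ⟨_, h, homogeneousComponent_isHomogeneous _ _, fun h => by omega⟩
  · exact ⟨0, by rw [h, mul_zero], isHomogeneous_zero _ _ _, fun _ => h⟩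

/-- A homogeneous polynomial is a solution if and only if it is apolar to the multiples of `F`. -/
lemma polyDiffOp_eq_zero_iff {n m : ℕ} {F P : MvPolynomial (Fin 3) ℂ} (hF : F.IsHomogeneous n)
    (hP : P.IsHomogeneous m) :
    polyDiffOp F P = 0 ↔ ∀ G : MvPolynomial (Fin 3) ℂ, G.IsHomogeneous m → F ∣ G →
      apolar G P = 0 := by
  constructor
  · rintro h G - ⟨H, rfl⟩
    rw [mul_comm, apolar_mul, h, map_zero]
  · intro h
    ext d
    rw [coeff_zero]
    have key : apolar (monomial d 1 * F) P = 0 := by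
      have hG := (isHomogeneous_monomial (1 : ℂ) (rfl : d.degree = d.degree)).mul hF
      by_cases hd : d.degree + n = m
      · exact h _ (hd ▸ hG) (Dvd.intro_left _ rfl)
      · exact apolar_eq_zero_of_isHomogeneous hd hG hP
    rw [apolar_mul, apolar_monomial] at key
    exact (mul_eq_zero.1 key).resolve_left (multiFactorial_ne_zero d)

/-- Forms of degree `m` are given by their coefficients. -/
def homogeneousEquiv (m : ℕ) : homogeneousSubmodule (Fin 3) ℂ m ≃ₗ[ℂ]
    ((Finset.univ : Finset (Fin 3)).finsuppAntidiag m → ℂ) where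
  toFun P d := coeff d.1 P.1
  map_add' P Q := by ext d; simp
  map_smul' c P := by ext d; simp
  invFun f := ⟨∑ d, monomial d.1 (f d), IsHomogeneous.sum _ _ _ fun d _ =>
    isHomogeneous_monomial _ (by
      have := (Finset.mem_finsuppAntidiag.1 d.2).1
      exact (Finsupp.degree_eq_sum d.1).trans this)⟩
  left_inv P := by
    ext e
    simp only [coeff_sum, coeff_monomial]
    by_cases he : e ∈ (Finset.univ : Finset (Fin 3)).finsuppAntidiag m
    · rw [Finset.sum_eq_single ⟨e, he⟩]
      · simp
      · intro d _ hd
        rw [if_neg]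
        rintro rfl
        exact hd rfl
      · simp
    · rw [Finset.sum_eq_zero]
      · symm
        by_contra h
        apply he
        rw [Finset.mem_finsuppAntidiag]
        refine ⟨?_, Finset.subset_univ _⟩
        have := P.2.degree_eq_sum_deg_support (mem_support_iff.2 h)
        rw [this, Finset.sum_subset (Finset.subset_univ e.support)
          fun i _ hi => Finsupp.notMem_support_iff.1 hi]
      · rintro ⟨d, hd⟩ _
        rw [if_neg]
        rintro rfl
        exact he hd
  right_inv f := by
    ext e
    simp only [coeff_sum, coeff_monomial]
    rw [Finset.sum_eq_single e]
    · simp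
    · intro d _ hd
      rw [if_neg]
      intro h
      exact hd (Subtype.ext h)
    · simp

instance finiteDimensional_homogeneousSubmodule (m : ℕ) :
    FiniteDimensional ℂ (homogeneousSubmodule (Fin 3) ℂ m) :=
  Module.Finite.equiv (homogeneousEquiv m).symm

lemma finrank_homogeneousSubmodule (m : ℕ) :
    Module.finrank ℂ (homogeneousSubmodule (Fin 3) ℂ m) = (m + 2).choose 2 := by
  rw [(homogeneousEquiv m).finrank_eq, Module.finrank_fintype_fun_eq_card, Fintype.card_coe,
    Finset.card_finsuppAntidiag_nat_eq_choose]
  simp only [Finset.card_univ, Fintype.card_fin]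
  rw [show 3 + m - 1 = m + 2 by omega, Nat.choose_symm_add]

/-- The apolar pairing on forms of degree `m`. -/
def apolarForm (m : ℕ) : LinearMap.BilinForm ℂ (homogeneousSubmodule (Fin 3) ℂ m) :=
  apolar.restrict _

lemma apolarForm_apply {m : ℕ} (G P : homogeneousSubmodule (Fin 3) ℂ m) :
    apolarForm m G P = apolar G.1 P.1 := rfl

lemma apolarForm_isRefl (m : ℕ) : (apolarForm m).IsRefl := fun G P h => by
  rw [apolarForm_apply] at h ⊢
  rwa [apolar_comm]

lemma apolarForm_nondegenerate (m : ℕ) : (apolarForm m).Nondegenerate := by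
  have key : (apolarForm m).SeparatingRight := by
    intro P h
    ext d
    by_contra hd
    have hd' : d.degree = m := by
      have := P.2 hd
      rwa [Pi.one_def, ← Finsupp.degree_eq_weight_one] at this
    have := h ⟨monomial d 1, isHomogeneous_monomial _ hd'⟩
    rw [apolarForm_apply, apolar_monomial] at this
    exact hd ((mul_eq_zero.1 this).resolve_left (multiFactorial_ne_zero d))
  refine ⟨fun P h => key P fun G => ?_, key⟩
  rw [apolarForm_apply, apolar_comm]
  exact h G

/-- The forms of degree `m` that are multiples of `F`. -/
def multiples (F : MvPolynomial (Fin 3) ℂ) (m : ℕ) :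
    Submodule ℂ (homogeneousSubmodule (Fin 3) ℂ m) where
  carrier := {G | F ∣ G.1}
  add_mem' ha hb := dvd_add ha hb
  zero_mem' := dvd_zero F
  smul_mem' c G hG := by
    change F ∣ c • G.1
    rw [smul_eq_C_mul]
    exact dvd_mul_of_dvd_right hG _

lemma mem_multiples {F : MvPolynomial (Fin 3) ℂ} {m : ℕ} {G : homogeneousSubmodule (Fin 3) ℂ m} :
    G ∈ multiples F m ↔ F ∣ G.1 := Iff.rfl

lemma finrank_multiples {n : ℕ} {F : MvPolynomial (Fin 3) ℂ} (hF : F.IsHomogeneous n)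
    (hF0 : F ≠ 0) (m : ℕ) : Module.finrank ℂ (multiples F m) =
      if n ≤ m then (m - n + 2).choose 2 else 0 := by
  split_ifs with hnm
  · let φ : homogeneousSubmodule (Fin 3) ℂ (m - n) →ₗ[ℂ] homogeneousSubmodule (Fin 3) ℂ m :=
      { toFun := fun H => ⟨F * H.1, by
          have := hF.mul H.2
          rwa [Nat.add_sub_cancel' hnm] at this⟩
        map_add' := fun A B => Subtype.ext (mul_add F A.1 B.1)
        map_smul' := fun c A => Subtype.ext (mul_smul_comm c F A.1) }
    have hφ : Function.Injective φ := fun A B h =>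
      Subtype.ext (mul_left_cancel₀ hF0 (congrArg Subtype.val h))
    have hr : LinearMap.range φ = multiples F m := by
      ext G
      rw [LinearMap.mem_range, mem_multiples]
      constructor
      · rintro ⟨H, rfl⟩
        exact Dvd.intro _ rfl
      · intro h
        obtain ⟨H, hH, hH', -⟩ := exists_isHomogeneous_of_dvd hF G.2 h
        exact ⟨⟨H, hH'⟩, Subtype.ext hH.symm⟩
    rw [← hr, LinearMap.finrank_range_of_inj hφ, finrank_homogeneousSubmodule]
  · have : multiples F m = ⊥ := by
      rw [eq_bot_iff]
      intro G hG
      obtain ⟨H, -, -, h⟩ := exists_isHomogeneous_of_dvd hF G.2 hG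
      rw [Submodule.mem_bot]
      exact Subtype.ext (h (by omega))
    rw [this, finrank_bot]

lemma solutionCount_eq {n : ℕ} (hn : 2 ≤ n) (m : ℕ) : solutionCount n m =
    (m + 2).choose 2 - if n ≤ m then (m - n + 2).choose 2 else 0 := by
  rw [solutionCount]
  split_ifs with h
  · obtain ⟨k, rfl⟩ := Nat.exists_eq_add_of_le h
    obtain ⟨l, rfl⟩ := Nat.exists_eq_add_of_le hn
    rw [Nat.add_sub_cancel_left, Nat.choose_two_right, Nat.choose_two_right,
      show 2 + l - 1 = l + 1 by omega, Nat.add_sub_cancel_left,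
      show 2 + l + k + 2 - 1 = l + k + 3 by omega, show k + 2 - 1 = k + 1 by omega]
    have e1 : 2 ∣ (l + 1) * l := (Nat.even_mul_pred_self (l + 1)).two_dvd
    have e2 : 2 ∣ (2 + l + k + 2) * (l + k + 3) := by
      have := (Nat.even_mul_pred_self (2 + l + k + 2)).two_dvd
      rwa [show 2 + l + k + 2 - 1 = l + k + 3 by omega] at this
    have e3 : 2 ∣ (k + 2) * (k + 1) := (Nat.even_mul_pred_self (k + 2)).two_dvd
    obtain ⟨a, ha⟩ := e1
    obtain ⟨b, hb⟩ := e2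
    obtain ⟨c, hc⟩ := e3
    rw [ha, hb, hc]
    simp only [Nat.mul_div_cancel_left _ (by norm_num : 0 < 2)]
    have : (2 + l + k) * (2 + l) + 1 + c = a + b := by nlinarith
    omega
  · simp

/-- The span of the `m`-th powers of the linear forms of the points of the curve, inside the forms
of degree `m`. -/
def powerSpan (D : Set ℂ) (ξ : ℂ → Fin 3 → ℂ) (m : ℕ) :
    Submodule ℂ (homogeneousSubmodule (Fin 3) ℂ m) :=
  Submodule.span ℂ ((fun t => ⟨linearForm (ξ t) ^ m, linearForm_pow_isHomogeneous _ m⟩) '' D)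

/-- A form is orthogonal to the powers if and only if it vanishes along the curve. -/
lemma orthogonal_powerSpan {n : ℕ} {F : MvPolynomial (Fin 3) ℂ} (hF : Prime F)
    (hFh : F.IsHomogeneous n) {D : Set ℂ} {ξ : ℂ → Fin 3 → ℂ} (hξ : IsUniformizedBy F D ξ) (m : ℕ) :
    (apolarForm m).orthogonal (powerSpan D ξ m) = multiples F m := by
  ext G
  rw [LinearMap.BilinForm.mem_orthogonal_iff, mem_multiples]
  constructor
  · intro h
    refine hξ.dvd hF hFh G.2 fun t ht => ?_
    have := h _ (Submodule.subset_span ⟨t, ht, rfl⟩)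
    rw [apolarForm_apply, apolar_comm, apolar_linearForm_pow G.2] at this
    exact (mul_eq_zero.1 this).resolve_left (by exact_mod_cast m.factorial_ne_zero)
  · intro h P hP
    induction hP using Submodule.span_induction with
    | mem P hP =>
      obtain ⟨t, ht, rfl⟩ := hP
      rw [apolarForm_apply, apolar_comm, apolar_linearForm_pow G.2]
      obtain ⟨H, hH⟩ := h
      rw [hH, map_mul, hξ.mem_curve t ht, zero_mul, mul_zero]
    | zero => simp
    | add P Q _ _ hP hQ => rw [map_add, LinearMap.add_apply, hP, hQ, add_zero]
    | smul c P _ hP => rw [map_smul, LinearMap.smul_apply, hP, smul_zero]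

/-- The homogeneous solutions are the orthogonal complement of the multiples of `F`. -/
lemma map_orthogonal_multiples {n : ℕ} {F : MvPolynomial (Fin 3) ℂ} (hFh : F.IsHomogeneous n)
    (m : ℕ) : ((apolarForm m).orthogonal (multiples F m)).map (Submodule.subtype _) =
      homogeneousSolutions F m := by
  ext P
  rw [Submodule.mem_map, homogeneousSolutions, Submodule.mem_inf, LinearMap.mem_ker]
  constructor
  · rintro ⟨Q, hQ, rfl⟩
    refine ⟨Q.2, (polyDiffOp_eq_zero_iff hFh Q.2).2 fun G hG hd => ?_⟩
    exact LinearMap.BilinForm.mem_orthogonal_iff.1 hQ ⟨G, hG⟩ hd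
  · rintro ⟨hP, h⟩
    refine ⟨⟨P, hP⟩, LinearMap.BilinForm.mem_orthogonal_iff.2 fun G hG => ?_, rfl⟩
    exact (polyDiffOp_eq_zero_iff hFh hP).1 h G.1 G.2 hG

/-- By double orthogonality, the powers span the homogeneous solutions. -/
lemma span_linearForm_pow {n : ℕ} {F : MvPolynomial (Fin 3) ℂ} (hF : Prime F)
    (hFh : F.IsHomogeneous n) {D : Set ℂ} {ξ : ℂ → Fin 3 → ℂ} (hξ : IsUniformizedBy F D ξ) (m : ℕ) :
    Submodule.span ℂ ((fun t => linearForm (ξ t) ^ m) '' D) = homogeneousSolutions F m := by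
  rw [← map_orthogonal_multiples hFh m, ← orthogonal_powerSpan hF hFh hξ,
    LinearMap.BilinForm.orthogonal_orthogonal (apolarForm_nondegenerate m) (apolarForm_isRefl m),
    powerSpan, Submodule.map_span, Set.image_image]
  rfl

lemma finrank_homogeneousSolutions {n : ℕ} (hn : 2 ≤ n) {F : MvPolynomial (Fin 3) ℂ} (hF : F ≠ 0)
    (hFh : F.IsHomogeneous n) (m : ℕ) :
    Module.finrank ℂ (homogeneousSolutions F m) = solutionCount n m := by
  rw [← map_orthogonal_multiples hFh m,
    Submodule.finrank_map_subtype_eq,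
    LinearMap.BilinForm.finrank_orthogonal (apolarForm_nondegenerate m),
    finrank_multiples hFh hF, finrank_homogeneousSubmodule, solutionCount_eq hn]

/-- A basis of the homogeneous solutions is selected from the spanning set of powers. -/
theorem homogeneousSolutions_basis {n : ℕ} (hn : 2 ≤ n) {F : MvPolynomial (Fin 3) ℂ}
    (hF : Prime F) (hFh : F.IsHomogeneous n) {D : Set ℂ} {ξ : ℂ → Fin 3 → ℂ}
    (hξ : IsUniformizedBy F D ξ) (m : ℕ) :
    Module.finrank ℂ (homogeneousSolutions F m) = solutionCount n m ∧
      ∃ t : Fin (solutionCount n m) → ℂ, (∀ i, t i ∈ D) ∧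
        ∃ b : Module.Basis (Fin (solutionCount n m)) ℂ (homogeneousSolutions F m),
          ∀ i, (b i : MvPolynomial (Fin 3) ℂ) = linearForm (ξ (t i)) ^ m := by
  have hfr := finrank_homogeneousSolutions hn hF.ne_zero hFh m
  refine ⟨hfr, ?_⟩
  have hspan := span_linearForm_pow hF hFh hξ m
  have : FiniteDimensional ℂ (homogeneousSolutions F m) :=
    Submodule.finiteDimensional_of_le (inf_le_left : _ ≤ homogeneousSubmodule (Fin 3) ℂ m)
  rw [← hfr]
  generalize homogeneousSolutions F m = E at *
  subst hspan
  obtain ⟨f, hf, hsp, hli⟩ := Submodule.exists_fun_fin_finrank_span_eq ℂ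
    ((fun t => linearForm (ξ t) ^ m) '' D)
  choose t ht htf using hf
  refine ⟨t, ht, (Module.Basis.span hli).map (LinearEquiv.ofEq _ _ hsp), fun i => ?_⟩
  rw [Module.Basis.map_apply]
  simp only [LinearEquiv.coe_ofEq_apply]
  rw [Module.Basis.span_apply]
  exact (htf i).symm

/-! ### Estimates for holomorphic functions of one variable -/

/-- The `j`-th Taylor coefficient of `g` at `c`. -/
def taylorCoeff (g : ℂ → ℂ) (c : ℂ) (j : ℕ) : ℂ := (j.factorial : ℂ)⁻¹ * iteratedDeriv j g c

lemma hasSum_taylorCoeff {g : ℂ → ℂ} {c : ℂ} {R : ℝ} (hg : DifferentiableOn ℂ g (Metric.ball c R))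
    {z : ℂ} (hz : z ∈ Metric.ball c R) :
    HasSum (fun j => taylorCoeff g c j * (z - c) ^ j) (g z) := by
  refine (Complex.hasSum_taylorSeries_on_ball hg hz).congr_fun fun j => ?_
  simp only [taylorCoeff, smul_eq_mul]
  ring

lemma norm_taylorCoeff_le {g : ℂ → ℂ} {c : ℂ} {r e : ℝ} (hr : 0 < r)
    (hg : DiffContOnCl ℂ g (Metric.ball c r)) (he : ∀ z ∈ Metric.sphere c r, ‖g z‖ ≤ e) (j : ℕ) :
    ‖taylorCoeff g c j‖ ≤ e / r ^ j := by
  have h := Complex.norm_iteratedDeriv_le_of_forall_mem_sphere_norm_le j hr hg he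
  have hj : (0 : ℝ) < j.factorial := by exact_mod_cast j.factorial_pos
  rw [taylorCoeff, norm_mul, norm_inv, Complex.norm_natCast, inv_mul_le_iff₀ hj]
  exact h.trans_eq (by ring)

/-- A two-constants theorem for concentric discs, with integral exponents. A function that is
bounded by `M` and that is at most `e` on a small disc is small on every disc in between. -/
theorem exists_two_constants {r s R : ℝ} (hr : 0 < r) (hs : 0 < s) (hsR : s < R) :
    ∃ (l : ℕ) (A : ℝ), 1 ≤ A ∧ ∀ (c : ℂ) (g : ℂ → ℂ) (e M : ℝ), 0 ≤ e → 0 ≤ M →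
      DifferentiableOn ℂ g (Metric.ball c R) → (∀ z ∈ Metric.ball c R, ‖g z‖ ≤ M) →
      (∀ z ∈ Metric.ball c r, ‖g z‖ ≤ e) →
      ∀ z ∈ Metric.ball c s, ‖g z‖ ^ (l + 1) ≤ A * (e * M ^ l) := by
  obtain ⟨r₀, hr₀, hr₀r, hr₀R⟩ : ∃ r₀, 0 < r₀ ∧ r₀ < r ∧ r₀ < R :=
    ⟨min r R / 2, by have := lt_min hr (hs.trans hsR); linarith,
      by have := min_le_left r R; linarith [lt_min hr (hs.trans hsR)],
      by have := min_le_right r R; linarith [lt_min hr (hs.trans hsR)]⟩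
  obtain ⟨R₀, hsR₀, hR₀⟩ := exists_between hsR
  have hR₀pos : 0 < R₀ := hs.trans hsR₀
  obtain ⟨l, hl⟩ := exists_pow_lt_of_lt_one (div_pos hr₀ hR₀pos)
    ((div_lt_one hR₀pos).2 hsR₀)
  -- `θ` is a weighted geometric mean of the radii, with weights that make it exceed `s`
  obtain ⟨θ, hθ0, hθ⟩ : ∃ θ : ℝ, 0 ≤ θ ∧ θ ^ (l + 1) = r₀ * R₀ ^ l :=
    ⟨(r₀ * R₀ ^ l) ^ (((l + 1 : ℕ) : ℝ)⁻¹), by positivity,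
      Real.rpow_inv_natCast_pow (by positivity) (by omega)⟩
  have hsθ : s < θ := by
    refine lt_of_pow_lt_pow_left₀ (l + 1) hθ0 ?_
    rw [hθ, pow_succ]
    rw [div_pow, div_lt_div_iff₀ (by positivity) hR₀pos] at hl
    have h1 : s ^ l * s ≤ s ^ l * R₀ := by gcongr
    linarith
  have hθpos : 0 < θ := hs.trans hsθ
  have hq : s / θ < 1 := (div_lt_one hθpos).2 hsθ
  have hq1 : 1 ≤ (1 - s / θ)⁻¹ := by
    rw [one_le_inv₀ (by linarith)]
    have : 0 ≤ s / θ := by positivity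
    linarith
  refine ⟨l, (1 - s / θ)⁻¹ ^ (l + 1), one_le_pow₀ hq1, ?_⟩
  intro c g e M he hM hg hgM hge z hz
  obtain ⟨β, hβ0, hβ⟩ : ∃ β : ℝ, 0 ≤ β ∧ β ^ (l + 1) = e * M ^ l :=
    ⟨(e * M ^ l) ^ (((l + 1 : ℕ) : ℝ)⁻¹), by positivity,
      Real.rpow_inv_natCast_pow (by positivity) (by omega)⟩
  have hcoeff : ∀ j, ‖taylorCoeff g c j‖ ≤ β / θ ^ j := by
    intro j
    have h1 : ‖taylorCoeff g c j‖ ≤ e / r₀ ^ j :=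
      norm_taylorCoeff_le hr₀ (hg.diffContOnCl_ball (Metric.closedBall_subset_ball hr₀R))
        (fun w hw => hge w (Metric.closedBall_subset_ball hr₀r
          (Metric.sphere_subset_closedBall hw))) j
    have h2 : ‖taylorCoeff g c j‖ ≤ M / R₀ ^ j :=
      norm_taylorCoeff_le hR₀pos (hg.diffContOnCl_ball (Metric.closedBall_subset_ball hR₀))
        (fun w hw => hgM w (Metric.closedBall_subset_ball hR₀
          (Metric.sphere_subset_closedBall hw))) j
    rw [← pow_le_pow_iff_left₀ (norm_nonneg _) (by positivity) (Nat.succ_ne_zero l)]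
    calc ‖taylorCoeff g c j‖ ^ (l + 1)
        = ‖taylorCoeff g c j‖ * ‖taylorCoeff g c j‖ ^ l := pow_succ' _ _
      _ ≤ (e / r₀ ^ j) * (M / R₀ ^ j) ^ l := by gcongr
      _ = (β / θ ^ j) ^ (l + 1) := by
        rw [div_pow β, hβ, ← pow_mul, mul_comm j, pow_mul, hθ, div_pow, div_mul_div_comm, mul_pow,
          ← pow_mul, ← pow_mul, mul_comm j l]
  have hsum : ‖g z‖ ≤ β * (1 - s / θ)⁻¹ := by
    refine (hasSum_taylorCoeff hg (Metric.ball_subset_ball hsR.le hz)).norm_le_of_bounded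
      ((hasSum_geometric_of_lt_one (by positivity) hq).mul_left β) fun j => ?_
    rw [norm_mul, norm_pow, div_pow, mul_div_assoc', mul_div_right_comm]
    have : ‖z - c‖ ≤ s := (mem_ball_iff_norm.1 hz).le
    gcongr
    exact hcoeff j
  calc ‖g z‖ ^ (l + 1) ≤ (β * (1 - s / θ)⁻¹) ^ (l + 1) := by gcongr
    _ = _ := by rw [mul_pow, hβ, mul_comm]

lemma iteratedDeriv_polynomial_eval (p : Polynomial ℂ) (k : ℕ) :
    iteratedDeriv k (fun x => p.eval x) = fun x => (Polynomial.derivative^[k] p).eval x := by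
  induction k with
  | zero => simp
  | succ k ih =>
    rw [iteratedDeriv_succ, ih]
    ext x
    rw [Function.iterate_succ_apply', Polynomial.deriv]

lemma taylorCoeff_polynomial (p : Polynomial ℂ) (c : ℂ) (k : ℕ) :
    taylorCoeff (fun x => p.eval x) c k = (Polynomial.taylor c p).coeff k := by
  rw [taylorCoeff, iteratedDeriv_polynomial_eval, Polynomial.taylor_coeff,
    ← Polynomial.factorial_smul_hasseDeriv]
  have : (k.factorial : ℂ) ≠ 0 := by exact_mod_cast k.factorial_ne_zero
  simp [this]

/-- The coefficients of a polynomial of degree at most `m` are bounded by its values on a disc, up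
to a constant to the power `m`. -/
theorem norm_coeff_le_of_ball {c : ℂ} {r e : ℝ} (hr : 0 < r) {m : ℕ} {p : Polynomial ℂ}
    (hm : p.natDegree ≤ m) (hp : ∀ x ∈ Metric.closedBall c r, ‖p.eval x‖ ≤ e) (k : ℕ) :
    ‖p.coeff k‖ ≤ e * (2 * ((1 + r⁻¹) * (1 + ‖c‖))) ^ m := by
  have he : 0 ≤ e := (norm_nonneg _).trans (hp c (Metric.mem_closedBall_self hr.le))
  have hb : ∀ j, ‖(Polynomial.taylor c p).coeff j‖ ≤ e / r ^ j := by
    intro j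
    rw [← taylorCoeff_polynomial]
    exact norm_taylorCoeff_le hr p.differentiable.diffContOnCl
      (fun z hz => hp z (Metric.sphere_subset_closedBall hz)) j
  have hs := Polynomial.sum_taylor_eq p c
  rw [Polynomial.sum_over_range' _ (by simp) (m + 1)
    (by rw [Polynomial.natDegree_taylor]; omega)] at hs
  conv_lhs => rw [← hs]
  rw [Polynomial.finsetSum_coeff]
  refine (norm_sum_le _ _).trans ?_
  have hterm : ∀ j ∈ Finset.range (m + 1),
      ‖(Polynomial.C ((Polynomial.taylor c p).coeff j) * (Polynomial.X - Polynomial.C c) ^ j).coeff k‖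
        ≤ e * ((1 + r⁻¹) * (1 + ‖c‖)) ^ m := by
    intro j hj
    have hjm : j ≤ m := by simpa [Nat.lt_succ_iff] using hj
    have h1 : ‖((Polynomial.X - Polynomial.C c) ^ j).coeff k‖ ≤ (1 + ‖c‖) ^ j := by
      rw [sub_eq_add_neg, ← Polynomial.C_neg, Polynomial.coeff_X_add_C_pow, norm_mul, norm_pow,
        norm_neg, Complex.norm_natCast]
      by_cases hkj : k ≤ j
      · rw [add_pow]
        have := Finset.single_le_sum (f := fun i => (1 : ℝ) ^ i * ‖c‖ ^ (j - i) * (j.choose i))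
          (fun i _ => by positivity) (Finset.mem_range.2 (Nat.lt_succ_of_le hkj))
        simpa using this
      · rw [Nat.choose_eq_zero_of_lt (by omega)]
        simp
        positivity
    rw [Polynomial.coeff_C_mul, norm_mul]
    calc _ ≤ (e / r ^ j) * (1 + ‖c‖) ^ j := by gcongr; exact hb j
      _ = e * (r⁻¹ * (1 + ‖c‖)) ^ j := by rw [mul_pow, inv_pow]; ring
      _ ≤ e * ((1 + r⁻¹) * (1 + ‖c‖)) ^ j := by gcongr; linarith
      _ ≤ e * ((1 + r⁻¹) * (1 + ‖c‖)) ^ m := by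
        gcongr
        have : 0 < r⁻¹ := by positivity
        nlinarith [norm_nonneg c]
  refine (Finset.sum_le_sum hterm).trans ?_
  rw [Finset.sum_const, Finset.card_range, nsmul_eq_mul, mul_pow 2]
  have : ((m + 1 : ℕ) : ℝ) ≤ 2 ^ m := by exact_mod_cast Nat.lt_two_pow_self
  calc _ ≤ 2 ^ m * (e * ((1 + r⁻¹) * (1 + ‖c‖)) ^ m) := by gcongr
    _ = _ := by ring

/-- An entire function of polynomial growth is a polynomial. -/
lemma exists_polynomial_of_growth {h : ℂ → ℂ} (hh : Differentiable ℂ h) {A : ℝ} {j : ℕ}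
    (hA : ∀ x, ‖h x‖ ≤ A * (1 + ‖x‖) ^ j) :
    ∃ p : Polynomial ℂ, p.natDegree ≤ j ∧ ∀ x, h x = p.eval x := by
  have hA0 : 0 ≤ A := by simpa using (norm_nonneg _).trans (hA 0)
  have hzero : ∀ k, j < k → taylorCoeff h 0 k = 0 := by
    intro k hk
    have hle : ∀ R : ℝ, 1 ≤ R → ‖taylorCoeff h 0 k‖ ≤ A * 2 ^ j * R⁻¹ := by
      intro R hR
      have hR0 : 0 < R := by linarith
      refine (norm_taylorCoeff_le (e := A * (1 + R) ^ j) hR0 hh.diffContOnCl (fun z hz => ?_) k).trans ?_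
      · have : ‖z‖ = R := by simpa using hz
        simpa [this] using hA z
      · obtain ⟨i, rfl⟩ := Nat.exists_eq_add_of_lt hk
        rw [div_le_iff₀ (by positivity)]
        calc A * (1 + R) ^ j ≤ A * (2 * R) ^ j := by gcongr; linarith
          _ = A * 2 ^ j * R ^ j * 1 := by rw [mul_pow]; ring
          _ ≤ A * 2 ^ j * R ^ j * R ^ i := by gcongr; exact one_le_pow₀ hR
          _ = A * 2 ^ j * R⁻¹ * R ^ (j + i + 1) := by field_simp; ring
    have hlim : Filter.Tendsto (fun R : ℝ => A * 2 ^ j * R⁻¹) Filter.atTop (nhds 0) := by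
      simpa using tendsto_inv_atTop_zero.const_mul (A * 2 ^ j)
    have := ge_of_tendsto hlim ((Filter.eventually_ge_atTop 1).mono hle)
    simpa using this
  refine ⟨∑ k ∈ Finset.range (j + 1), Polynomial.C (taylorCoeff h 0 k) * Polynomial.X ^ k, ?_, ?_⟩
  · refine Polynomial.natDegree_sum_le_of_forall_le _ _ fun k hk => ?_
    exact (Polynomial.natDegree_C_mul_X_pow_le _ _).trans (by simpa [Nat.lt_succ_iff] using hk)
  · intro x
    have h1 := hasSum_taylorCoeff (g := h) (c := 0) (R := ‖x‖ + 1) (z := x) hh.differentiableOn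
      (by simp)
    have h2 : HasSum (fun k => taylorCoeff h 0 k * (x - 0) ^ k)
        (∑ k ∈ Finset.range (j + 1), taylorCoeff h 0 k * (x - 0) ^ k) :=
      hasSum_sum_of_ne_finset_zero fun k hk => by
        rw [hzero k (by simpa [Nat.lt_succ_iff] using hk), zero_mul]
    rw [h1.unique h2, Polynomial.eval_finsetSum]
    simp

/-- A function that is holomorphic off a finite set and of polynomial growth is a polynomial. -/
theorem exists_polynomial_of_growth_off_finite {h : ℂ → ℂ} {Z : Set ℂ} (hZ : Z.Finite)
    (hh : DifferentiableOn ℂ h Zᶜ) {A : ℝ} {j : ℕ} (hA : ∀ x ∉ Z, ‖h x‖ ≤ A * (1 + ‖x‖) ^ j) :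
    ∃ p : Polynomial ℂ, p.natDegree ≤ j ∧ ∀ x ∉ Z, h x = p.eval x := by
  let g : ℂ → ℂ := fun c => (nhdsWithin c {c}ᶜ).limUnder h
  have hopen : IsOpen Zᶜ := hZ.isClosed.isOpen_compl
  have hgh : ∀ x ∉ Z, g x = h x := fun x hx =>
    (((hh.differentiableAt (hopen.mem_nhds hx)).continuousAt.tendsto).mono_left
      nhdsWithin_le_nhds).limUnder_eq
  have hgd : Differentiable ℂ g := by
    intro c
    let s : Set ℂ := Metric.ball c 1 ∩ (Z \ {c})ᶜ
    have hs : IsOpen s :=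
      Metric.isOpen_ball.inter (hZ.subset Set.sdiff_subset).isClosed.isOpen_compl
    have hcs : c ∈ s := ⟨Metric.mem_ball_self one_pos, by simp⟩
    have hsub : s \ {c} ⊆ Zᶜ := fun x hx hxZ => hx.1.2 ⟨hxZ, hx.2⟩
    have hd := Complex.differentiableOn_update_limUnder_of_bddAbove (hs.mem_nhds hcs)
      (hh.mono hsub) (by
        refine ⟨|A| * (1 + (‖c‖ + 1)) ^ j, ?_⟩
        rintro _ ⟨x, hx, rfl⟩
        refine (hA x (hsub hx)).trans ?_
        have hx1 : ‖x‖ ≤ ‖c‖ + 1 := by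
          have := mem_ball_iff_norm.1 hx.1.1
          have := norm_le_norm_add_norm_sub' x c
          linarith
        gcongr
        exact le_abs_self A)
    refine (hd.congr fun x hx => ?_).differentiableAt (hs.mem_nhds hcs)
    by_cases hxc : x = c
    · subst hxc; simp [g]
    · rw [Function.update_of_ne hxc, hgh x (hsub ⟨hx, hxc⟩)]
  have hgA : ∀ x, ‖g x‖ ≤ A * (1 + ‖x‖) ^ j := by
    have hcl : IsClosed {x | ‖g x‖ ≤ A * (1 + ‖x‖) ^ j} :=
      isClosed_le hgd.continuous.norm (by fun_prop)
    have hdense : Dense Zᶜ := hZ.countable.dense_compl ℂ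
    intro x
    have : closure Zᶜ ⊆ {x | ‖g x‖ ≤ A * (1 + ‖x‖) ^ j} :=
      hcl.closure_subset_iff.2 fun x hx => by
        simpa [hgh x hx] using hA x hx
    exact this (hdense x)
  obtain ⟨p, hp, hpe⟩ := exists_polynomial_of_growth hgd hgA
  exact ⟨p, hp, fun x hx => by rw [← hgh x hx, hpe]⟩

/-! ### The curve as a branched covering of the line -/

/-- The polynomial `F(z, x, 1)` in `z`. -/
def fiber (F : MvPolynomial (Fin 3) ℂ) (x : ℂ) : Polynomial ℂ :=
  Polynomial.map (eval ![x, 1]) (finSuccEquiv ℂ 2 F)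

lemma eval_fiber (F : MvPolynomial (Fin 3) ℂ) (x z : ℂ) :
    (fiber F x).eval z = eval ![z, x, 1] F :=
  (eval_eq_eval_mv_eval' ![x, 1] z F).symm

lemma finSuccEquiv_monic {n : ℕ} {F : MvPolynomial (Fin 3) ℂ} (hF : F.IsHomogeneous n)
    (h1 : eval (Pi.single 0 1) F = 1) :
    (finSuccEquiv ℂ 2 F).Monic ∧ (finSuccEquiv ℂ 2 F).natDegree = n := by
  have hdeg : (finSuccEquiv ℂ 2 F).natDegree ≤ n := by
    rw [natDegree_finSuccEquiv]
    exact (degreeOf_le_totalDegree F 0).trans hF.totalDegree_le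
  have hev : eval (0 : Fin 2 → ℂ) ((finSuccEquiv ℂ 2 F).coeff n) = 1 := by
    have hs : (Pi.single 0 1 : Fin 3 → ℂ) = Fin.cons 1 (0 : Fin 2 → ℂ) := by
      ext i
      refine Fin.cases ?_ (fun j => ?_) i <;> simp
    rw [hs, eval_eq_eval_mv_eval', Polynomial.eval_eq_sum_range' (n := n + 1)
      ((Polynomial.natDegree_map_le).trans_lt (by omega)), Finset.sum_range_succ] at h1
    rw [Finset.sum_eq_zero, zero_add] at h1
    · simpa [Polynomial.coeff_map] using h1
    · intro k hk
      rw [Finset.mem_range] at hk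
      have hc := hF.finSuccEquiv_coeff_isHomogeneous k (n - k) (by omega)
      have h0 : constantCoeff ((finSuccEquiv ℂ 2 F).coeff k) = 0 :=
        hc.coeff_eq_zero (by simp; omega)
      rw [Polynomial.coeff_map]
      simp [h0]
  have hcoeff : (finSuccEquiv ℂ 2 F).coeff n = 1 := by
    have hc := hF.finSuccEquiv_coeff_isHomogeneous n 0 (by omega)
    have ht := totalDegree_eq_zero_iff_eq_C.1 (Nat.le_zero.1 hc.totalDegree_le)
    rw [ht, eval_C] at hev
    rw [ht, hev, C_1]
  refine ⟨Polynomial.monic_of_natDegree_le_of_coeff_eq_one n hdeg hcoeff, le_antisymm hdeg ?_⟩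
  exact Polynomial.le_natDegree_of_ne_zero (by rw [hcoeff]; exact one_ne_zero)

lemma fiber_monic {n : ℕ} {F : MvPolynomial (Fin 3) ℂ} (hF : F.IsHomogeneous n)
    (h1 : eval (Pi.single 0 1) F = 1) (x : ℂ) : (fiber F x).Monic :=
  (finSuccEquiv_monic hF h1).1.map _

lemma natDegree_fiber {n : ℕ} {F : MvPolynomial (Fin 3) ℂ} (hF : F.IsHomogeneous n)
    (h1 : eval (Pi.single 0 1) F = 1) (x : ℂ) : (fiber F x).natDegree = n := by
  rw [fiber, (finSuccEquiv_monic hF h1).1.natDegree_map, (finSuccEquiv_monic hF h1).2]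

/-- An irreducible polynomial and its derivative generate an ideal that contains a nonzero
constant: the derivative divides a constant in the domain `R[X]/(f)`, which is integral over `R`. -/
lemma exists_discriminant {n : ℕ} (hn : n ≠ 0) {f : Polynomial (MvPolynomial (Fin 2) ℂ)}
    (hf : f.Monic) (hfn : f.natDegree = n) (hp : Prime f) :
    ∃ d : MvPolynomial (Fin 2) ℂ, d ≠ 0 ∧ ∀ (s : Fin 2 → ℂ) (z : ℂ),
      (f.map (eval s)).eval z = 0 → (f.map (eval s)).derivative.eval z = 0 → eval s d = 0 := by
  have : IsDomain (AdjoinRoot f) := AdjoinRoot.isDomain_of_prime hp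
  have : Module.Finite (MvPolynomial (Fin 2) ℂ) (AdjoinRoot f) := hf.finite_adjoinRoot
  have hder : f.derivative ≠ 0 := by
    intro h
    have := congrArg (fun p => Polynomial.coeff p (n - 1)) h
    simp only [Polynomial.coeff_derivative, Polynomial.coeff_zero] at this
    rw [Nat.sub_add_cancel (Nat.one_le_iff_ne_zero.2 hn), ← hfn, hf.coeff_natDegree, hfn, one_mul,
      ← Nat.cast_succ, Nat.succ_eq_add_one, Nat.sub_add_cancel (Nat.one_le_iff_ne_zero.2 hn)] at this
    exact hn (by exact_mod_cast this)
  have hmk : AdjoinRoot.mk f f.derivative ≠ 0 :=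
    AdjoinRoot.mk_ne_zero_of_natDegree_lt hf hder (Polynomial.natDegree_derivative_lt (by omega))
  have hne := Ideal.comap_ne_bot_of_integral_mem (R := MvPolynomial (Fin 2) ℂ)
    (I := Ideal.span {AdjoinRoot.mk f f.derivative}) hmk (Ideal.mem_span_singleton_self _)
    (Algebra.IsIntegral.isIntegral _)
  obtain ⟨d, hd, hd0⟩ := Submodule.exists_mem_ne_zero_of_ne_bot hne
  refine ⟨d, hd0, fun s z h1 h2 => ?_⟩
  rw [Ideal.mem_comap, Ideal.mem_span_singleton] at hd
  obtain ⟨b, hb⟩ := hd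
  obtain ⟨b, rfl⟩ := AdjoinRoot.mk_surjective b
  rw [← map_mul, AdjoinRoot.algebraMap_eq, ← AdjoinRoot.mk_C, AdjoinRoot.mk_eq_mk] at hb
  obtain ⟨a, ha⟩ := hb
  have := congrArg (fun p => (Polynomial.map (eval s) p).eval z) ha
  simp only [Polynomial.map_sub, Polynomial.map_mul, Polynomial.map_C, Polynomial.eval_sub,
    Polynomial.eval_mul, Polynomial.eval_C, h1, zero_mul, ← Polynomial.derivative_map, h2,
    sub_zero] at this
  simpa using this

/-- All but finitely many fibers of the curve over the `x`-line have only simple points. -/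
lemma exists_fiber_discriminant {n : ℕ} (hn : n ≠ 0) {F : MvPolynomial (Fin 3) ℂ}
    (hF : F.IsHomogeneous n) (h1 : eval (Pi.single 0 1) F = 1) (hp : Prime F) :
    ∃ d : Polynomial ℂ, d ≠ 0 ∧ ∀ x z : ℂ, d.eval x ≠ 0 → (fiber F x).eval z = 0 →
      (fiber F x).derivative.eval z ≠ 0 := by
  obtain ⟨hm, hdeg⟩ := finSuccEquiv_monic hF h1
  obtain ⟨d, hd0, hd⟩ := exists_discriminant hn hm hdeg
    ((MulEquiv.prime_iff (finSuccEquiv ℂ 2)).2 hp)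
  obtain ⟨v, hv⟩ : ∃ v, eval v (d * X 1) ≠ 0 := by
    by_contra! hcon
    exact mul_ne_zero hd0 (X_ne_zero 1) (MvPolynomial.funext (by simpa using hcon))
  rw [map_mul, eval_X] at hv
  have hv0 := left_ne_zero_of_mul hv
  have hv1 := right_ne_zero_of_mul hv
  let e : Polynomial ℂ := aeval ![Polynomial.C (v 1) * Polynomial.X, Polynomial.C (v 1)] d
  have he : ∀ x, e.eval x = eval ![v 1 * x, v 1] d := by
    intro x
    rw [← Polynomial.coe_aeval_eq_eval, ← AlgHom.comp_apply, comp_aeval, ← coe_aeval_eq_eval]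
    have : (fun i => (Polynomial.aeval x)
        ((![Polynomial.C (v 1) * Polynomial.X, Polynomial.C (v 1)] : Fin 2 → Polynomial ℂ) i))
        = ![v 1 * x, v 1] := by
      ext i
      fin_cases i <;> simp
    rw [this]
    rfl
  refine ⟨e, fun h0 => hv0 ?_, fun x z hx hz hz' => hx ?_⟩
  · have := he (v 0 / v 1)
    rw [h0, Polynomial.eval_zero, mul_div_cancel₀ _ hv1] at this
    rw [this]
    congr 2
    ext i
    fin_cases i <;> simp
  · rw [he]
    let g := Polynomial.map (eval ![v 1 * x, v 1]) (finSuccEquiv ℂ 2 F)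
    have hg : ∀ w, g.eval (v 1 * w) = v 1 ^ n * (fiber F x).eval w := by
      intro w
      rw [eval_fiber, ← hF.eval_smul]
      simp only [g]
      rw [← eval_eq_eval_mv_eval']
      congr 1
      congr 1
      ext i
      refine Fin.cases ?_ (fun j => ?_) i
      · simp
      · fin_cases j <;> simp
    have hgp : g.comp (Polynomial.C (v 1) * Polynomial.X) = Polynomial.C (v 1 ^ n) * fiber F x :=
      Polynomial.funext fun w => by
        rw [Polynomial.eval_comp]
        simpa using hg w
    have hgd := congrArg (fun p => (Polynomial.derivative p).eval z) hgp
    simp only [Polynomial.derivative_comp, Polynomial.derivative_C_mul, Polynomial.derivative_X,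
      Polynomial.eval_mul, Polynomial.eval_comp, Polynomial.eval_C, Polynomial.eval_X, hz',
      mul_one, mul_zero] at hgd
    exact hd _ (v 1 * z) (by rw [hg, hz, mul_zero]) ((mul_eq_zero.1 hgd).resolve_left hv1)

lemma contDiff_eval_comp {E : Type*} [NormedAddCommGroup E] [NormedSpace ℂ E] {g : E → Fin 3 → ℂ}
    (hg : ContDiff ℂ 1 g) (H : MvPolynomial (Fin 3) ℂ) : ContDiff ℂ 1 fun v => eval (g v) H := by
  have hc : ∀ i, ContDiff ℂ 1 (fun t => g t i) := contDiff_pi.1 hg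
  simp only [eval_eq']
  fun_prop

/-- The implicit function theorem at a simple point of a fiber. -/
lemma exists_branch_at {F : MvPolynomial (Fin 3) ℂ} {x₁ z₁ : ℂ} (h0 : (fiber F x₁).eval z₁ = 0)
    (hd : (fiber F x₁).derivative.eval z₁ ≠ 0) :
    ∃ ζ : ℂ → ℂ, ζ x₁ = z₁ ∧ (∀ᶠ x in nhds x₁, DifferentiableAt ℂ ζ x) ∧
      ∀ᶠ x in nhds x₁, (fiber F x).eval (ζ x) = 0 := by
  let f : ℂ × ℂ → ℂ := fun v => eval ![v.2, v.1, 1] F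
  have hf : ContDiff ℂ 1 f := by
    refine contDiff_eval_comp (contDiff_pi.2 fun i => ?_) F
    fin_cases i
    · exact contDiff_snd
    · exact contDiff_fst
    · exact contDiff_const
  have cdf : ContDiffAt ℂ 1 f (x₁, z₁) := hf.contDiffAt
  have hder : (fderiv ℂ f (x₁, z₁) ∘SL ContinuousLinearMap.inr ℂ ℂ ℂ) 1 =
      (fiber F x₁).derivative.eval z₁ := by
    have h1 : HasFDerivAt f (fderiv ℂ f (x₁, z₁)) (x₁, z₁) :=
      (cdf.differentiableAt one_ne_zero).hasFDerivAt
    have h2 : HasFDerivAt (fun z => f (x₁, z))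
        (fderiv ℂ f (x₁, z₁) ∘SL ContinuousLinearMap.inr ℂ ℂ ℂ) z₁ :=
      HasFDerivAt.comp z₁ h1 (hasFDerivAt_prodMk_right x₁ z₁)
    have h3 : HasDerivAt (fun z => f (x₁, z)) ((fiber F x₁).derivative.eval z₁) z₁ := by
      have := (fiber F x₁).hasDerivAt z₁
      simpa only [eval_fiber] using this
    exact h2.hasDerivAt.unique h3
  have hinv : (fderiv ℂ f (x₁, z₁) ∘SL ContinuousLinearMap.inr ℂ ℂ ℂ).IsInvertible := by
    refine ⟨ContinuousLinearEquiv.unitsEquivAut ℂ (Units.mk0 _ hd), ?_⟩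
    ext
    rw [hder]
    simp
  have hfu : f (x₁, z₁) = 0 := by rw [← h0, eval_fiber]
  refine ⟨cdf.implicitFunction one_ne_zero hinv, cdf.implicitFunction_apply_self one_ne_zero hinv,
    ?_, ?_⟩
  · have := (cdf.contDiffAt_implicitFunction one_ne_zero hinv).eventually (by simp)
    exact this.mono fun x hx => hx.differentiableAt one_ne_zero
  · filter_upwards [cdf.eventually_apply_implicitFunction one_ne_zero hinv] with x hx
    rw [eval_fiber]
    rw [hfu] at hx
    exact hx

/-- `ζ₁, …, ζₙ` are holomorphic branches over the disc of radius `δ` about `x₁`: they parametrize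
the part of the curve over that disc, without overlaps. -/
structure IsBranchSystem (F : MvPolynomial (Fin 3) ℂ) {n : ℕ} (x₁ : ℂ) (δ : ℝ)
    (ζ : Fin n → ℂ → ℂ) : Prop where
  pos : 0 < δ
  differentiableOn : ∀ i, DifferentiableOn ℂ (ζ i) (Metric.ball x₁ δ)
  injective : ∀ x ∈ Metric.ball x₁ δ, Function.Injective fun i => ζ i x
  root_iff : ∀ x ∈ Metric.ball x₁ δ, ∀ z, (fiber F x).eval z = 0 ↔ ∃ i, ζ i x = z

lemma exists_isBranchSystem {n : ℕ} {F : MvPolynomial (Fin 3) ℂ}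
    (hF : F.IsHomogeneous n) (h1 : eval (Pi.single 0 1) F = 1) {x₁ : ℂ}
    (hs : ∀ z, (fiber F x₁).eval z = 0 → (fiber F x₁).derivative.eval z ≠ 0) :
    ∃ (δ : ℝ) (ζ : Fin n → ℂ → ℂ), IsBranchSystem F x₁ δ ζ := by
  have hm := fiber_monic hF h1
  have hdeg := natDegree_fiber hF h1
  have hsep : (fiber F x₁).Separable := by
    rw [Polynomial.Separable, Polynomial.isCoprime_iff_aeval_ne_zero_of_isAlgClosed ℂ ℂ]
    intro z
    by_contra! h
    simp only [Polynomial.coe_aeval_eq_eval] at h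
    exact hs z h.1 h.2
  have hcard : Fintype.card ((fiber F x₁).rootSet ℂ) = n := by
    rw [Polynomial.card_rootSet_eq_natDegree hsep (IsAlgClosed.splits _), hdeg]
  let e : Fin n ≃ (fiber F x₁).rootSet ℂ := (Fintype.equivFinOfCardEq hcard).symm
  have he : ∀ i, (fiber F x₁).eval (e i : ℂ) = 0 := fun i => by
    have := ((Polynomial.mem_rootSet).1 (e i).2).2
    simpa using this
  choose ζ hζ0 hζd hζr using fun i => exists_branch_at (he i) (hs _ (he i))
  have hinj : ∀ᶠ x in nhds x₁, ∀ i j, i ≠ j → ζ i x ≠ ζ j x := by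
    refine Filter.eventually_all.2 fun i => Filter.eventually_all.2 fun j => ?_
    by_cases hij : i = j
    · exact Filter.Eventually.of_forall fun x h => absurd hij h
    · have hc : ContinuousAt (fun x => ζ i x - ζ j x) x₁ :=
        (hζd i).self_of_nhds.continuousAt.sub (hζd j).self_of_nhds.continuousAt
      have hne : ζ i x₁ - ζ j x₁ ≠ 0 := by
        rw [hζ0, hζ0, sub_ne_zero]
        exact fun h => hij (e.injective (Subtype.ext h))
      filter_upwards [hc.eventually_ne hne] with x hx _
      exact sub_ne_zero.1 hx
  have hall : ∀ᶠ x in nhds x₁, (∀ i, DifferentiableAt ℂ (ζ i) x) ∧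
      (∀ i, (fiber F x).eval (ζ i x) = 0) ∧ ∀ i j, i ≠ j → ζ i x ≠ ζ j x :=
    (Filter.eventually_all.2 hζd).and ((Filter.eventually_all.2 hζr).and hinj)
  obtain ⟨δ, hδ, hball⟩ := Metric.eventually_nhds_iff_ball.1 hall
  refine ⟨δ, ζ, hδ, fun i x hx => ((hball x hx).1 i).differentiableWithinAt, fun x hx i j hij => ?_,
    fun x hx z => ⟨fun hz => ?_, ?_⟩⟩
  · by_contra hne
    exact (hball x hx).2.2 i j hne hij
  · classical
    -- the `n` distinct values of the branches exhaust the roots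
    by_contra! hcon
    let s : Finset ℂ := insert z (Finset.univ.image fun i => ζ i x)
    have hsc : s.card = n + 1 := by
      rw [Finset.card_insert_of_notMem (by simpa using hcon), Finset.card_image_of_injective,
        Finset.card_univ, Fintype.card_fin]
      intro i j hij
      by_contra hne
      exact (hball x hx).2.2 i j hne hij
    have hsub : s ⊆ (fiber F x).roots.toFinset := by
      intro w hw
      rw [Multiset.mem_toFinset, Polynomial.mem_roots (hm x).ne_zero, Polynomial.IsRoot.def]
      rcases Finset.mem_insert.1 hw with rfl | hw
      · exact hz
      · obtain ⟨i, -, rfl⟩ := Finset.mem_image.1 hw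
        exact (hball x hx).2.1 i
    have h2 := (Finset.card_le_card hsub).trans ((Multiset.toFinset_card_le _).trans
      (Polynomial.card_roots' _))
    rw [hsc, hdeg] at h2
    omega
  · rintro ⟨i, rfl⟩
    exact (hball x hx).2.1 i

namespace IsBranchSystem

variable {F : MvPolynomial (Fin 3) ℂ} {n : ℕ} {x₁ : ℂ} {δ : ℝ} {ζ : Fin n → ℂ → ℂ}

lemma continuousAt (h : IsBranchSystem F x₁ δ ζ) (i : Fin n) {x : ℂ} (hx : x ∈ Metric.ball x₁ δ) :
    ContinuousAt (ζ i) x :=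
  ((h.differentiableOn i).differentiableAt (Metric.isOpen_ball.mem_nhds hx)).continuousAt

/-- Near a point of a branch the curve consists of that branch only. -/
lemma eventually_eq (h : IsBranchSystem F x₁ δ ζ) (i : Fin n) {w : ℂ}
    (hw : w ∈ Metric.ball x₁ δ) : ∀ᶠ v : ℂ × ℂ in nhds (w, ζ i w),
      (fiber F v.1).eval v.2 = 0 → v.2 = ζ i v.1 := by
  have h1 : ∀ᶠ v : ℂ × ℂ in nhds (w, ζ i w), ∀ j, j ≠ i → v.2 ≠ ζ j v.1 := by
    refine Filter.eventually_all.2 fun j => ?_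
    by_cases hij : j = i
    · exact Filter.Eventually.of_forall fun x h => absurd hij h
    · have hc : ContinuousAt (fun v : ℂ × ℂ => v.2 - ζ j v.1) (w, ζ i w) :=
        continuousAt_snd.sub
          (ContinuousAt.comp (f := Prod.fst) (x := (w, ζ i w)) (h.continuousAt j hw)
            continuousAt_fst)
      have hne : ζ i w - ζ j w ≠ 0 :=
        sub_ne_zero.2 fun h' => hij (h.injective w hw h').symm
      filter_upwards [hc.eventually_ne hne] with v hv _
      exact sub_ne_zero.1 hv
  have h2 : ∀ᶠ v : ℂ × ℂ in nhds (w, ζ i w), v.1 ∈ Metric.ball x₁ δ :=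
    continuousAt_fst.eventually (Metric.isOpen_ball.mem_nhds hw)
  filter_upwards [h1, h2] with v hv1 hv2 hv
  obtain ⟨j, hj⟩ := (h.root_iff v.1 hv2 v.2).1 hv
  by_cases hij : j = i
  · rw [← hij, hj]
  · exact absurd hj.symm (hv1 j hij)

/-- A branch is a parametrization of the curve. -/
lemma isUniformizedBy (h : IsBranchSystem F x₁ δ ζ) (i : Fin n) :
    IsUniformizedBy F (Metric.ball x₁ δ) fun x => ![ζ i x, x, 1] where
  isOpen := Metric.isOpen_ball
  isPreconnected := (convex_ball x₁ δ).isPreconnected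
  differentiableOn := by
    refine differentiableOn_pi.2 fun j => ?_
    fin_cases j
    · exact h.differentiableOn i
    · exact differentiableOn_id
    · exact differentiableOn_const 1
  ne_zero x _ h0 := by simpa using congrFun h0 2
  mem_curve x hx := by
    rw [← eval_fiber]
    exact (h.root_iff x hx _).2 ⟨i, rfl⟩
  nonconstant := by
    have hδ := h.pos
    have hx : x₁ + (δ / 2 : ℝ) ≠ x₁ := by
      simp [hδ.ne']
    refine ⟨x₁, Metric.mem_ball_self hδ, x₁ + (δ / 2 : ℝ), ?_, ?_⟩
    · rw [mem_ball_iff_norm, add_sub_cancel_left, Complex.norm_real, Real.norm_of_nonneg (by linarith)]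
      linarith
    · rw [LinearIndependent.pair_iff]
      intro a b hab
      have h1 := congrFun hab 1
      have h2 := congrFun hab 2
      simp at h1 h2
      have hb : b * (δ / 2 : ℂ) = 0 := by linear_combination h1 - x₁ * h2
      have hb0 : b = 0 := by
        rcases mul_eq_zero.1 hb with h | h
        · exact h
        · exfalso
          have : (δ : ℂ) = 0 := by linear_combination 2 * h
          exact hδ.ne' (by exact_mod_cast this)
      exact ⟨by simpa [hb0] using h2, hb0⟩

end IsBranchSystem

/-! ### The coefficient norm of a polynomial -/

/-- The sum of the absolute values of the coefficients. -/
def coeffNorm (G : MvPolynomial (Fin 3) ℂ) : ℝ := ∑ d ∈ G.support, ‖coeff d G‖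

lemma coeffNorm_nonneg (G : MvPolynomial (Fin 3) ℂ) : 0 ≤ coeffNorm G :=
  Finset.sum_nonneg fun _ _ => norm_nonneg _

lemma coeffNorm_eq_sum {G : MvPolynomial (Fin 3) ℂ} {s : Finset (Fin 3 →₀ ℕ)}
    (hs : G.support ⊆ s) : coeffNorm G = ∑ d ∈ s, ‖coeff d G‖ :=
  Finset.sum_subset hs fun d _ hd => by rw [notMem_support_iff.1 hd, norm_zero]

@[simp] lemma coeffNorm_zero : coeffNorm 0 = 0 := by simp [coeffNorm]

lemma coeffNorm_monomial (d : Fin 3 →₀ ℕ) (c : ℂ) : coeffNorm (monomial d c) = ‖c‖ := by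
  rw [coeffNorm_eq_sum support_monomial_subset]
  simp

lemma coeffNorm_add_le (G H : MvPolynomial (Fin 3) ℂ) :
    coeffNorm (G + H) ≤ coeffNorm G + coeffNorm H := by
  classical
  rw [coeffNorm_eq_sum (support_add (p := G) (q := H)),
    coeffNorm_eq_sum (G := G) (Finset.subset_union_left (s₂ := H.support)),
    coeffNorm_eq_sum (G := H) (Finset.subset_union_right (s₁ := G.support)),
    ← Finset.sum_add_distrib]
  exact Finset.sum_le_sum fun d _ => by rw [coeff_add]; exact norm_add_le _ _

lemma coeffNorm_sum_le {ι : Type*} (s : Finset ι) (f : ι → MvPolynomial (Fin 3) ℂ) :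
    coeffNorm (∑ i ∈ s, f i) ≤ ∑ i ∈ s, coeffNorm (f i) := by
  classical
  induction s using Finset.induction_on with
  | empty => simp
  | insert a s ha ih =>
    rw [Finset.sum_insert ha, Finset.sum_insert ha]
    exact (coeffNorm_add_le _ _).trans (by gcongr)

lemma coeffNorm_smul (c : ℂ) (G : MvPolynomial (Fin 3) ℂ) :
    coeffNorm (c • G) = ‖c‖ * coeffNorm G := by
  rw [coeffNorm_eq_sum (support_smul (a := c) (f := G)), coeffNorm, Finset.mul_sum]
  exact Finset.sum_congr rfl fun d _ => by rw [coeff_smul, smul_eq_mul, norm_mul]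

lemma coeffNorm_mul_le (G H : MvPolynomial (Fin 3) ℂ) :
    coeffNorm (G * H) ≤ coeffNorm G * coeffNorm H := by
  conv_lhs => rw [G.as_sum, H.as_sum, Finset.sum_mul_sum]
  refine (coeffNorm_sum_le _ _).trans ?_
  rw [coeffNorm, coeffNorm, Finset.sum_mul_sum]
  refine Finset.sum_le_sum fun d _ => (coeffNorm_sum_le _ _).trans (Finset.sum_le_sum fun e _ => ?_)
  rw [monomial_mul, coeffNorm_monomial, norm_mul]

lemma coeffNorm_one : coeffNorm 1 = 1 := by
  rw [← C_1, C_apply, coeffNorm_monomial, norm_one]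

lemma coeffNorm_pow_le (G : MvPolynomial (Fin 3) ℂ) (k : ℕ) :
    coeffNorm (G ^ k) ≤ coeffNorm G ^ k := by
  induction k with
  | zero => simp [coeffNorm_one]
  | succ k ih =>
    rw [pow_succ, pow_succ]
    exact (coeffNorm_mul_le _ _).trans (by gcongr; exact coeffNorm_nonneg _)

lemma norm_coeff_le_coeffNorm (G : MvPolynomial (Fin 3) ℂ) (d : Fin 3 →₀ ℕ) :
    ‖coeff d G‖ ≤ coeffNorm G := by
  by_cases hd : d ∈ G.support
  · exact Finset.single_le_sum (f := fun d => ‖coeff d G‖) (fun _ _ => norm_nonneg _) hd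
  · rw [notMem_support_iff.1 hd, norm_zero]
    exact coeffNorm_nonneg G

lemma MvPolynomial.IsHomogeneous.sum_eq {m : ℕ} {G : MvPolynomial (Fin 3) ℂ}
    (hG : G.IsHomogeneous m)
    {d : Fin 3 →₀ ℕ} (hd : d ∈ G.support) : ∑ i, d i = m := by
  rw [hG.degree_eq_sum_deg_support hd, Finset.sum_subset (Finset.subset_univ d.support)
    fun i _ hi => Finsupp.notMem_support_iff.1 hi]

lemma norm_eval_le {m : ℕ} {G : MvPolynomial (Fin 3) ℂ} (hG : G.IsHomogeneous m)
    {v : Fin 3 → ℂ} {B : ℝ} (hv : ∀ i, ‖v i‖ ≤ B) : ‖eval v G‖ ≤ coeffNorm G * B ^ m := by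
  rw [eval_eq', coeffNorm, Finset.sum_mul]
  refine (norm_sum_le _ _).trans (Finset.sum_le_sum fun d hd => ?_)
  rw [norm_mul, norm_prod]
  gcongr
  rw [← hG.sum_eq hd, ← Finset.prod_pow_eq_pow_sum]
  refine Finset.prod_le_prod (fun i _ => norm_nonneg _) fun i _ => ?_
  rw [norm_pow]
  gcongr
  exact hv i

/-! ### Propagation of smallness along the curve -/

/-- `G` is a form of degree `m` with coefficient norm at most `1`, and at most `ε` on the part of
the curve that is parametrized by `K`. -/
structure IsSmallForm (ξ : ℂ → Fin 3 → ℂ) (K : Set ℂ) (m : ℕ) (ε : ℝ)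
    (G : MvPolynomial (Fin 3) ℂ) : Prop where
  isHomogeneous : G.IsHomogeneous m
  coeffNorm_le : coeffNorm G ≤ 1
  nonneg : 0 ≤ ε
  norm_le : ∀ t ∈ K, ‖eval (ξ t) G‖ ≤ ε

/-- Smallness of forms on the part of the curve parametrized by `K` implies smallness near the
point `(z, x, 1)` of the curve, up to a root and a constant to the power of the degree. -/
def IsControlled (F : MvPolynomial (Fin 3) ℂ) (ξ : ℂ → Fin 3 → ℂ) (K : Set ℂ) (x z : ℂ) : Prop :=
  ∃ (k : ℕ) (A : ℝ), 0 < k ∧ 1 ≤ A ∧ ∀ᶠ v : ℂ × ℂ in nhds (x, z), (fiber F v.1).eval v.2 = 0 →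
    ∀ (m : ℕ) (ε : ℝ) (G : MvPolynomial (Fin 3) ℂ), IsSmallForm ξ K m ε G →
      ‖eval ![v.2, v.1, 1] G‖ ^ k ≤ A ^ (m + 1) * ε

section Controlled

variable {F : MvPolynomial (Fin 3) ℂ} {ξ : ℂ → Fin 3 → ℂ} {K : Set ℂ} {n : ℕ} {x₁ : ℂ} {δ : ℝ}
  {ζ : Fin n → ℂ → ℂ}

lemma isControlled_branch_iff (h : IsBranchSystem F x₁ δ ζ) (i : Fin n) {w : ℂ}
    (hw : w ∈ Metric.ball x₁ δ) : IsControlled F ξ K w (ζ i w) ↔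
      ∃ (k : ℕ) (A : ℝ), 0 < k ∧ 1 ≤ A ∧ ∀ᶠ y in nhds w,
        ∀ (m : ℕ) (ε : ℝ) (G : MvPolynomial (Fin 3) ℂ), IsSmallForm ξ K m ε G →
          ‖eval ![ζ i y, y, 1] G‖ ^ k ≤ A ^ (m + 1) * ε := by
  constructor
  · rintro ⟨k, A, hk, hA, hv⟩
    refine ⟨k, A, hk, hA, ?_⟩
    have hc : Filter.Tendsto (fun y => (y, ζ i y)) (nhds w) (nhds (w, ζ i w)) :=
      continuousAt_id.prodMk (h.continuousAt i hw)
    filter_upwards [hc.eventually hv, Metric.isOpen_ball.mem_nhds hw] with y hy hyb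
    exact hy ((h.root_iff y hyb _).2 ⟨i, rfl⟩)
  · rintro ⟨k, A, hk, hA, hv⟩
    refine ⟨k, A, hk, hA, ?_⟩
    filter_upwards [h.eventually_eq i hw,
      (continuousAt_fst : ContinuousAt Prod.fst (w, ζ i w)).eventually hv] with v hv1 hv2 hv0
    rw [hv1 hv0]
    exact hv2

lemma differentiableOn_branch (h : IsBranchSystem F x₁ δ ζ) (i : Fin n)
    (G : MvPolynomial (Fin 3) ℂ) :
    DifferentiableOn ℂ (fun y => eval ![ζ i y, y, 1] G) (Metric.ball x₁ δ) :=
  differentiableOn_eval_comp (h.isUniformizedBy i).differentiableOn G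

/-- Control spreads along the branches, by the two-constants theorem. -/
lemma IsControlled.spread (h : IsBranchSystem F x₁ δ ζ) (i : Fin n) {y : ℂ}
    (hy : y ∈ Metric.ball x₁ δ) (hc : IsControlled F ξ K y (ζ i y)) {w : ℂ}
    (hw : w ∈ Metric.ball x₁ δ) : IsControlled F ξ K w (ζ i w) := by
  let u : Set ℂ := {w | ∃ (k : ℕ) (A : ℝ), 0 < k ∧ 1 ≤ A ∧ ∀ᶠ y in nhds w,
        ∀ (m : ℕ) (ε : ℝ) (G : MvPolynomial (Fin 3) ℂ), IsSmallForm ξ K m ε G →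
          ‖eval ![ζ i y, y, 1] G‖ ^ k ≤ A ^ (m + 1) * ε}
  suffices hsub : Metric.ball x₁ δ ⊆ u from (isControlled_branch_iff h i hw).2 (hsub hw)
  have huo : IsOpen u := by
    rw [isOpen_iff_mem_nhds]
    rintro w ⟨k, A, hk, hA, hv⟩
    filter_upwards [eventually_eventually_nhds.2 hv] with y hy
    exact ⟨k, A, hk, hA, hy⟩
  -- the controlled part of the branch is open; by the estimate below it is closed as well
  refine (convex_ball x₁ δ).isPreconnected.subset_of_closure_inter_subset huo
    ⟨y, hy, (isControlled_branch_iff h i hy).1 hc⟩ ?_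
  rintro w ⟨hwc, hwb⟩
  -- a ball around `w` on which the branch is bounded
  obtain ⟨R, hR, hRb⟩ : ∃ R > 0, ∀ y ∈ Metric.ball w (2 * R),
      y ∈ Metric.ball x₁ δ ∧ ‖ζ i y‖ ≤ ‖ζ i w‖ + 1 ∧ ‖y‖ ≤ ‖w‖ + 1 := by
    have h1 : ∀ᶠ y in nhds w, ‖ζ i y‖ < ‖ζ i w‖ + 1 :=
      (h.continuousAt i hwb).norm.eventually_lt_const (lt_add_one _)
    have h2 : ∀ᶠ y in nhds w, ‖y‖ < ‖w‖ + 1 :=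
      continuousAt_id.norm.eventually_lt_const (lt_add_one _)
    obtain ⟨R, hR, hb⟩ := Metric.eventually_nhds_iff_ball.1
      ((Metric.isOpen_ball.eventually_mem hwb).and (h1.and h2))
    refine ⟨R / 2, by positivity, fun y hy => ?_⟩
    have := hb y (by rwa [mul_div_cancel₀ _ (two_ne_zero)] at hy)
    exact ⟨this.1, this.2.1.le, this.2.2.le⟩
  obtain ⟨y, ⟨k, A, hk, hA, hv⟩, hyw⟩ := Metric.mem_closure_iff.1 hwc (R / 4) (by positivity)
  obtain ⟨r, hr, hrb⟩ := Metric.eventually_nhds_iff_ball.1 hv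
  obtain ⟨l, A', hA', htwo⟩ := exists_two_constants hr (half_pos hR) (half_lt_self hR)
  let B : ℝ := ‖ζ i w‖ + ‖w‖ + 1
  have hB : 1 ≤ B := by
    have := norm_nonneg (ζ i w)
    have := norm_nonneg w
    simp only [B]; linarith
  refine ⟨(l + 1) * k, A' ^ k * A * B ^ (l * k), by positivity, ?_, ?_⟩
  · exact one_le_mul_of_one_le_of_one_le (one_le_mul_of_one_le_of_one_le (one_le_pow₀ hA') hA)
      (one_le_pow₀ hB)
  have hball : Metric.ball y R ⊆ Metric.ball w (2 * R) := by
    intro v hv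
    rw [Metric.mem_ball] at hv ⊢
    have := dist_triangle v y w
    rw [dist_comm w y] at hyw
    linarith
  filter_upwards [Metric.ball_mem_nhds w (show 0 < R / 4 by positivity)] with v hv m ε G hG
  have hvy : v ∈ Metric.ball y (R / 2) := by
    rw [Metric.mem_ball] at hv ⊢
    have := dist_triangle v w y
    linarith
  -- `e` bounds the form near the controlled point `y`, and `Bᵐ` bounds it on the large disc
  obtain ⟨e, he0, he⟩ : ∃ e : ℝ, 0 ≤ e ∧ e ^ k = A ^ (m + 1) * ε :=
    ⟨(A ^ (m + 1) * ε) ^ ((k : ℝ)⁻¹), by have := hG.nonneg; positivity,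
      Real.rpow_inv_natCast_pow (by have := hG.nonneg; positivity) hk.ne'⟩
  have key := htwo y (fun y => eval ![ζ i y, y, 1] G) e (B ^ m) he0 (by positivity)
    ((differentiableOn_branch h i G).mono fun v hv => (hRb v (hball hv)).1)
    (fun v hv => by
      refine (norm_eval_le (B := B) hG.isHomogeneous fun j => ?_).trans ?_
      · have := hRb v (hball hv)
        have := norm_nonneg (ζ i w)
        have := norm_nonneg w
        fin_cases j <;> simp [B] <;> linarith
      · have := hG.coeffNorm_le
        have : (0 : ℝ) < B ^ m := by positivity
        nlinarith)
    (fun v hv => by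
      rw [← pow_le_pow_iff_left₀ (norm_nonneg _) he0 hk.ne', he]
      exact hrb v hv m ε G hG) v hvy
  calc ‖eval ![ζ i v, v, 1] G‖ ^ ((l + 1) * k)
      = (‖eval ![ζ i v, v, 1] G‖ ^ (l + 1)) ^ k := pow_mul _ _ _
    _ ≤ (A' * (e * (B ^ m) ^ l)) ^ k := by gcongr
    _ = (A' ^ k * A ^ (m + 1) * (B ^ (l * k)) ^ m) * ε := by
      rw [mul_pow, mul_pow, he]; ring
    _ ≤ ((A' ^ k) ^ (m + 1) * A ^ (m + 1) * (B ^ (l * k)) ^ (m + 1)) * ε := by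
      have := hG.nonneg
      gcongr
      · exact le_self_pow₀ (one_le_pow₀ hA') (by omega)
      · exact one_le_pow₀ hB
      · omega
    _ = _ := by rw [mul_pow, mul_pow]

/-- A form of degree less than `n` that vanishes along a parametrized part of the curve is `0`. -/
lemma IsUniformizedBy.eq_zero_of_lt {D : Set ℂ} (hξ : IsUniformizedBy F D ξ) (hF : Prime F)
    (hFh : F.IsHomogeneous n) {m : ℕ} (hm : m < n) {G : MvPolynomial (Fin 3) ℂ}
    (hG : G.IsHomogeneous m) {U : Set ℂ} (hU : IsOpen U) (hUD : U ⊆ D) (hne : U.Nonempty)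
    (h0 : ∀ t ∈ U, eval (ξ t) G = 0) : G = 0 := by
  have han : AnalyticOnNhd ℂ (fun t => eval (ξ t) G) D :=
    (differentiableOn_eval_comp hξ.differentiableOn G).analyticOnNhd hξ.isOpen
  obtain ⟨t, ht⟩ := hne
  have hz := han.eqOn_zero_of_preconnected_of_eventuallyEq_zero hξ.isPreconnected (hUD ht)
    (Filter.eventually_of_mem (hU.mem_nhds ht) h0)
  obtain ⟨H, -, -, h⟩ := exists_isHomogeneous_of_dvd hFh hG (hξ.dvd hF hFh hG hz)
  exact h hm

/-- Some point of the curve is controlled: one on the part parametrized by `K`. -/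
lemma exists_isControlled (hn : 2 ≤ n) (hF : Prime F) (hFh : F.IsHomogeneous n)
    (h1 : eval (Pi.single 0 1) F = 1) {D : Set ℂ} (hξ : IsUniformizedBy F D ξ) {t₀ : ℂ} {ρ : ℝ}
    (hρ : 0 < ρ) (hD : Metric.ball t₀ ρ ⊆ D) (hK : Metric.ball t₀ ρ ⊆ K)
    {d : Polynomial ℂ} (hd0 : d ≠ 0) (hd : ∀ x z : ℂ, d.eval x ≠ 0 → (fiber F x).eval z = 0 →
      (fiber F x).derivative.eval z ≠ 0) :
    ∃ x z, d.eval x ≠ 0 ∧ (fiber F x).eval z = 0 ∧ IsControlled F ξ K x z := by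
  have hdiff : ∀ t ∈ Metric.ball t₀ ρ, ∀ i, DifferentiableAt ℂ (fun t => ξ t i) t := fun t ht i =>
    differentiableAt_pi.1 (hξ.differentiableOn.differentiableAt (hξ.isOpen.mem_nhds (hD ht))) i
  obtain ⟨t₁, ht₁, hne₁⟩ : ∃ t ∈ Metric.ball t₀ ρ, ξ t 2 ≠ 0 := by
    by_contra! hcon
    have := hξ.eq_zero_of_lt hF hFh (m := 1) (by omega) (isHomogeneous_X ℂ 2) Metric.isOpen_ball hD
      ⟨t₀, Metric.mem_ball_self hρ⟩ (fun t ht => by simpa using hcon t ht)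
    exact X_ne_zero 2 this
  let N : Set ℂ := Metric.ball t₀ ρ ∩ {t | ξ t 2 ≠ 0}
  have hNo : IsOpen N := by
    rw [isOpen_iff_mem_nhds]
    rintro t ⟨ht, ht2⟩
    exact Filter.inter_mem (Metric.isOpen_ball.mem_nhds ht)
      ((hdiff t ht 2).continuousAt.eventually_ne ht2)
  let X : ℂ → ℂ := fun t => ξ t 1 / ξ t 2
  let Y : ℂ → ℂ := fun t => ξ t 0 / ξ t 2
  have hXd : DifferentiableOn ℂ X N := fun t ht =>
    ((hdiff t ht.1 1).div (hdiff t ht.1 2) ht.2).differentiableWithinAt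
  -- `X` is open: if it were constant, a linear form would vanish along the curve
  have hmap : ∀ t ∈ N, nhds (X t) ≤ Filter.map X (nhds t) := by
    intro t ht
    rcases (hXd.analyticAt (hNo.mem_nhds ht)).eventually_constant_or_nhds_le_map_nhds with hc | h
    · exfalso
      obtain ⟨U, hU, hUo, htU⟩ := eventually_nhds_iff.1 (hc.and (hNo.eventually_mem ht))
      have := hξ.eq_zero_of_lt hF hFh (m := 1) (by omega)
        ((isHomogeneous_X ℂ 1).sub ((isHomogeneous_X ℂ 2).C_mul (X t))) hUo
        (fun s hs => hD (hU s hs).2.1) ⟨t, htU⟩ (fun s hs => by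
          have h1 := (hU s hs).1
          have h2 : ξ s 2 ≠ 0 := (hU s hs).2.2
          simp only [map_sub, map_mul, eval_X, eval_C, ← h1, X]
          field_simp
          ring)
      have := congrArg (eval (Pi.single 1 1 : Fin 3 → ℂ)) this
      simp at this
    · exact h
  obtain ⟨t₂, ht₂, hdt₂⟩ : ∃ t ∈ N, d.eval (X t) ≠ 0 := by
    by_contra! hcon
    have hmem : {x | d.eval x = 0} ∈ nhds (X t₁) :=
      hmap t₁ ⟨ht₁, hne₁⟩ (Filter.mem_map.2 (Filter.mem_of_superset
        (hNo.mem_nhds ⟨ht₁, hne₁⟩) hcon))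
    have hinf := infinite_of_mem_nhds _ hmem
    exact hinf (by simpa [Polynomial.IsRoot] using Polynomial.finite_setOfPred_isRoot hd0)
  have hroot : ∀ t ∈ N, (fiber F (X t)).eval (Y t) = 0 := by
    intro t ht
    have h2 : ξ t 2 ≠ 0 := ht.2
    have : (![Y t, X t, 1] : Fin 3 → ℂ) = (ξ t 2)⁻¹ • ξ t := by
      ext i
      fin_cases i <;> simp [X, Y, h2, div_eq_inv_mul]
    rw [eval_fiber, this, hFh.eval_smul, hξ.mem_curve t (hD ht.1), mul_zero]
  refine ⟨X t₂, Y t₂, hdt₂, hroot t₂ ht₂, ?_⟩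
  obtain ⟨δ, ζ, hB⟩ := exists_isBranchSystem hFh h1 (x₁ := X t₂) fun z => hd _ z hdt₂
  have hxb : X t₂ ∈ Metric.ball (X t₂) δ := Metric.mem_ball_self hB.pos
  obtain ⟨i, hi⟩ := (hB.root_iff _ hxb _).1 (hroot t₂ ht₂)
  have hc2 : 0 < ‖ξ t₂ 2‖ := norm_pos_iff.2 ht₂.2
  rw [← hi, isControlled_branch_iff hB i hxb]
  refine ⟨1, 1 + (‖ξ t₂ 2‖ / 2)⁻¹, one_pos, by simp; positivity, ?_⟩
  refine Filter.Eventually.filter_mono (hmap t₂ ht₂) (Filter.eventually_map.2 ?_)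
  have hcont : Filter.Tendsto (fun t => (X t, Y t)) (nhds t₂) (nhds (X t₂, ζ i (X t₂))) := by
    rw [hi]
    exact ((hXd.differentiableAt (hNo.mem_nhds ht₂)).continuousAt).prodMk
      (((hdiff t₂ ht₂.1 0).div (hdiff t₂ ht₂.1 2) ht₂.2).continuousAt)
  filter_upwards [hcont.eventually (hB.eventually_eq i hxb), hNo.eventually_mem ht₂,
    (hdiff t₂ ht₂.1 2).continuousAt.norm.eventually_const_lt (half_lt_self hc2)]
    with t ht htN htn m ε G hG
  have h2 : ξ t 2 ≠ 0 := htN.2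
  have hpt : (![ζ i (X t), X t, 1] : Fin 3 → ℂ) = (ξ t 2)⁻¹ • ξ t := by
    rw [← ht (hroot t htN)]
    ext i
    fin_cases i <;> simp [X, Y, h2, div_eq_inv_mul]
  rw [pow_one, hpt, hG.isHomogeneous.eval_smul, norm_mul, norm_pow, norm_inv]
  have hε := hG.nonneg
  calc ‖ξ t 2‖⁻¹ ^ m * ‖eval (ξ t) G‖ ≤ (1 + (‖ξ t₂ 2‖ / 2)⁻¹) ^ m * ε := by
        gcongr
        · have : ‖ξ t 2‖⁻¹ ≤ (‖ξ t₂ 2‖ / 2)⁻¹ := by gcongr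
          linarith
        · exact hG.norm_le t (hK htN.1)
    _ ≤ (1 + (‖ξ t₂ 2‖ / 2)⁻¹) ^ (m + 1) * ε := by
        gcongr
        · simp; positivity
        · omega

end Controlled

/-! ### Connectedness of the curve -/

section Connected

variable {F : MvPolynomial (Fin 3) ℂ} {n : ℕ}

lemma IsBranchSystem.mono {x₁ : ℂ} {δ δ' : ℝ} {ζ : Fin n → ℂ → ℂ} (h : IsBranchSystem F x₁ δ ζ)
    (hpos : 0 < δ') (hle : δ' ≤ δ) : IsBranchSystem F x₁ δ' ζ where
  pos := hpos
  differentiableOn i := (h.differentiableOn i).mono (Metric.ball_subset_ball hle)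
  injective x hx := h.injective x (Metric.ball_subset_ball hle hx)
  root_iff x hx := h.root_iff x (Metric.ball_subset_ball hle hx)

/-- The roots of the fiber over `x` grow at most linearly. -/
lemma exists_root_bound (hF : F.IsHomogeneous n) (h1 : eval (Pi.single 0 1) F = 1) :
    ∃ B : ℝ, 0 ≤ B ∧ ∀ x z : ℂ, (fiber F x).eval z = 0 → ‖z‖ ≤ B * (1 + ‖x‖) := by
  have hcont : Continuous fun v : ℂ × ℂ => eval ![1, v.1, v.2] F := by
    refine (contDiff_eval_comp (contDiff_pi.2 fun i => ?_) F).continuous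
    fin_cases i
    · exact contDiff_const
    · exact contDiff_fst
    · exact contDiff_snd
  have h0 : eval ![1, (0 : ℂ × ℂ).1, (0 : ℂ × ℂ).2] F ≠ 0 := by
    have : (![1, (0 : ℂ × ℂ).1, (0 : ℂ × ℂ).2] : Fin 3 → ℂ) = Pi.single 0 1 := by
      ext i
      fin_cases i <;> simp
    rw [this, h1]
    exact one_ne_zero
  obtain ⟨η, hη, hb⟩ := Metric.eventually_nhds_iff_ball.1 (hcont.continuousAt.eventually_ne h0)
  refine ⟨η⁻¹, by positivity, fun x z hz => ?_⟩
  by_contra! hlt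
  have hx := norm_nonneg x
  have hz1 : 1 + ‖x‖ < η * ‖z‖ := by rwa [inv_mul_lt_iff₀ hη] at hlt
  have hzpos : 0 < ‖z‖ := lt_of_le_of_lt (by positivity) hlt
  have hz0 : z ≠ 0 := norm_pos_iff.1 hzpos
  refine hb (x / z, 1 / z) ?_ ?_
  · rw [mem_ball_zero_iff, Prod.norm_def, max_lt_iff, norm_div, norm_div, norm_one,
      div_lt_iff₀ hzpos, div_lt_iff₀ hzpos]
    constructor <;> linarith
  · have : (![1, x / z, 1 / z] : Fin 3 → ℂ) = z⁻¹ • ![z, x, 1] := by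
      ext i
      fin_cases i <;> simp [hz0, div_eq_inv_mul]
    simp only
    rw [this, hF.eval_smul, ← eval_fiber, hz, mul_zero]

/-- The form `∑ᵢ,ⱼ Aᵢ₊ⱼ₊₁ zⁱ Sⱼ`, where `F = ∑ₖ Aₖ zᵏ`. If `Sⱼ` is the sum of the `j`-th powers of
some roots `w` of a fiber, it is the sum of the quotients `(F(z) - F(w)) / (z - w)`. -/
def traceForm (F : MvPolynomial (Fin 3) ℂ) (S : ℕ → MvPolynomial (Fin 3) ℂ) :
    MvPolynomial (Fin 3) ℂ :=
  ∑ d ∈ F.support, C (coeff d F) * (X 1 ^ d 1 * X 2 ^ d 2 *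
    ∑ i ∈ Finset.range (d 0), X 0 ^ i * S (d 0 - 1 - i))

lemma traceForm_isHomogeneous (hF : F.IsHomogeneous n) {S : ℕ → MvPolynomial (Fin 3) ℂ}
    (hS : ∀ j, (S j).IsHomogeneous j) : (traceForm F S).IsHomogeneous (n - 1) := by
  refine IsHomogeneous.sum _ _ _ fun d hd => IsHomogeneous.C_mul ?_ _
  have hsum := hF.sum_eq hd
  rw [Fin.sum_univ_three] at hsum
  rw [Finset.mul_sum]
  refine IsHomogeneous.sum _ _ _ fun i hi => ?_
  rw [Finset.mem_range] at hi
  have hX : ∀ (j : Fin 3) (k : ℕ), (X j ^ k : MvPolynomial (Fin 3) ℂ).IsHomogeneous k := by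
    intro j k
    simpa using (isHomogeneous_X ℂ j).pow k
  have := ((hX 1 (d 1)).mul (hX 2 (d 2))).mul ((hX 0 i).mul (hS (d 0 - 1 - i)))
  rwa [show d 1 + d 2 + (i + (d 0 - 1 - i)) = n - 1 by omega] at this

lemma fiber_eq_sum (F : MvPolynomial (Fin 3) ℂ) (x : ℂ) : fiber F x =
    ∑ d ∈ F.support, Polynomial.C (coeff d F * x ^ d 1) * Polynomial.X ^ d 0 := by
  refine Polynomial.funext fun z => ?_
  rw [eval_fiber, eval_eq', Polynomial.eval_finsetSum]
  refine Finset.sum_congr rfl fun d _ => ?_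
  simp [Fin.prod_univ_three]
  ring

lemma eval_traceForm {S : ℕ → MvPolynomial (Fin 3) ℂ} {x z : ℂ} {T : Finset ℂ}
    (hS : ∀ j, eval ![z, x, 1] (S j) = ∑ w ∈ T, w ^ j) :
    eval ![z, x, 1] (traceForm F S) = ∑ w ∈ T, ∑ d ∈ F.support, coeff d F * x ^ d 1 *
      ∑ i ∈ Finset.range (d 0), z ^ i * w ^ (d 0 - 1 - i) := by
  rw [traceForm, map_sum, Finset.sum_comm]
  refine Finset.sum_congr rfl fun d _ => ?_
  simp only [map_mul, map_sum, map_pow, eval_C, eval_X, hS]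
  rw [← Finset.mul_sum, Finset.sum_comm]
  simp [Finset.mul_sum, mul_assoc]

/-- At a root `z` of a fiber, the quotients `(F(z) - F(w)) / (z - w)` vanish at the other roots
`w`, and for `w = z` the quotient is the derivative. -/
lemma eval_traceForm_of_root {S : ℕ → MvPolynomial (Fin 3) ℂ} {x z : ℂ} {T : Finset ℂ}
    (hS : ∀ j, eval ![z, x, 1] (S j) = ∑ w ∈ T, w ^ j) (hT : ∀ w ∈ T, (fiber F x).eval w = 0)
    (hz : (fiber F x).eval z = 0) :
    eval ![z, x, 1] (traceForm F S) = if z ∈ T then (fiber F x).derivative.eval z else 0 := by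
  classical
  rw [eval_traceForm hS, ← Finset.sum_ite_eq' T z fun w => (fiber F x).derivative.eval w]
  refine Finset.sum_congr rfl fun w hw => ?_
  split_ifs with hwz
  · subst hwz
    rw [fiber_eq_sum, Polynomial.derivative_sum, Polynomial.eval_finsetSum]
    refine Finset.sum_congr rfl fun d _ => ?_
    rw [Polynomial.derivative_C_mul_X_pow, Polynomial.eval_mul, Polynomial.eval_C,
      Polynomial.eval_pow, Polynomial.eval_X]
    have : ∀ i ∈ Finset.range (d 0), w ^ i * w ^ (d 0 - 1 - i) = w ^ (d 0 - 1) := by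
      intro i hi
      rw [Finset.mem_range] at hi
      rw [← pow_add]
      congr 1
      omega
    rw [Finset.sum_congr rfl this]
    simp
    ring
  · have hne : z - w ≠ 0 := sub_ne_zero.2 fun h => hwz h.symm
    refine (mul_eq_zero.1 ?_).resolve_right hne
    rw [Finset.sum_mul]
    simp only [mul_assoc, geom_sum₂_mul]
    have h1 := hT w hw
    have h2 := hz
    rw [fiber_eq_sum, Polynomial.eval_finsetSum] at h1 h2
    simp only [Polynomial.eval_mul, Polynomial.eval_C, Polynomial.eval_pow,
      Polynomial.eval_X] at h1 h2
    have : ∑ d ∈ F.support, coeff d F * (x ^ d 1 * (z ^ d 0 - w ^ d 0)) =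
        ∑ d ∈ F.support, coeff d F * x ^ d 1 * z ^ d 0 -
          ∑ d ∈ F.support, coeff d F * x ^ d 1 * w ^ d 0 := by
      rw [← Finset.sum_sub_distrib]
      exact Finset.sum_congr rfl fun d _ => by ring
    rw [this, h1, h2, sub_zero]

/-- The homogenization of a polynomial in `x` of degree at most `j`. -/
def homogenization (p : Polynomial ℂ) (j : ℕ) : MvPolynomial (Fin 3) ℂ :=
  ∑ k ∈ Finset.range (j + 1), C (p.coeff k) * (X 1 ^ k * X 2 ^ (j - k))

lemma homogenization_isHomogeneous (p : Polynomial ℂ) (j : ℕ) :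
    (homogenization p j).IsHomogeneous j := by
  refine IsHomogeneous.sum _ _ _ fun k hk => IsHomogeneous.C_mul ?_ _
  rw [Finset.mem_range] at hk
  have := ((isHomogeneous_X ℂ (1 : Fin 3)).pow k).mul ((isHomogeneous_X ℂ (2 : Fin 3)).pow (j - k))
  rwa [show 1 * k + 1 * (j - k) = j by omega] at this

lemma eval_homogenization {p : Polynomial ℂ} {j : ℕ} (hp : p.natDegree ≤ j) (x z : ℂ) :
    eval ![z, x, 1] (homogenization p j) = p.eval x := by
  rw [Polynomial.eval_eq_sum_range' (Nat.lt_succ_of_le hp)]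
  simp [homogenization]

/-- An irreducible plane curve stays connected when the branch points are removed: a property of
its points that is locally constant along the branches holds everywhere or nowhere.
The sums of the powers of the roots with the property would be polynomials in `x`, and would
combine to a form of degree `n - 1` that vanishes at the points without the property and at no
others. -/
theorem forall_of_locally_constant (hn : 2 ≤ n) (hF : Prime F) (hFh : F.IsHomogeneous n)
    (h1 : eval (Pi.single 0 1) F = 1) {d : Polynomial ℂ} (hd0 : d ≠ 0)
    (hd : ∀ x z : ℂ, d.eval x ≠ 0 → (fiber F x).eval z = 0 →
      (fiber F x).derivative.eval z ≠ 0) {P : ℂ → ℂ → Prop}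
    (hP : ∀ (x₁ : ℂ) (δ : ℝ) (ζ : Fin n → ℂ → ℂ), IsBranchSystem F x₁ δ ζ → ∀ i,
      ∀ y ∈ Metric.ball x₁ δ, ∀ w ∈ Metric.ball x₁ δ, P y (ζ i y) → P w (ζ i w))
    {x₀ z₀ : ℂ} (hx₀ : d.eval x₀ ≠ 0) (hz₀ : (fiber F x₀).eval z₀ = 0) (h₀ : P x₀ z₀)
    {x z : ℂ} (hx : d.eval x ≠ 0) (hz : (fiber F x).eval z = 0) : P x z := by
  classical
  by_contra hcon
  -- the roots over `x` with the property; their power sums are polynomials in `x`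
  let T : ℂ → Finset ℂ := fun x => (fiber F x).roots.toFinset.filter fun z => P x z
  have hmT : ∀ x z, z ∈ T x ↔ (fiber F x).eval z = 0 ∧ P x z := by
    intro x z
    rw [Finset.mem_filter, Multiset.mem_toFinset,
      Polynomial.mem_roots (fiber_monic hFh h1 x).ne_zero, Polynomial.IsRoot.def]
  let Z : Set ℂ := {x | d.eval x = 0}
  have hZ : Z.Finite := Polynomial.finite_setOfPred_isRoot hd0
  obtain ⟨B, hB0, hB⟩ := exists_root_bound hFh h1
  have hpoly : ∀ j, ∃ p : Polynomial ℂ, p.natDegree ≤ j ∧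
      ∀ x ∉ Z, ∑ w ∈ T x, w ^ j = p.eval x := by
    intro j
    refine exists_polynomial_of_growth_off_finite (h := fun x => ∑ w ∈ T x, w ^ j) hZ ?_
      (A := n * B ^ j) ?_
    · intro x₁ hx₁
      obtain ⟨δ, ζ, hζ⟩ := exists_isBranchSystem hFh h1 (x₁ := x₁) fun z => hd _ z hx₁
      have hc : x₁ ∈ Metric.ball x₁ δ := Metric.mem_ball_self hζ.pos
      -- near `x₁` the sum runs over the branches with the property at `x₁`
      have heq : ∀ y ∈ Metric.ball x₁ δ, ∑ w ∈ T y, w ^ j =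
          ∑ i ∈ Finset.univ.filter (fun i => P x₁ (ζ i x₁)), ζ i y ^ j := by
        intro y hy
        have himg : T y = (Finset.univ.filter (fun i => P x₁ (ζ i x₁))).image fun i => ζ i y := by
          ext w
          rw [hmT, Finset.mem_image, hζ.root_iff y hy]
          constructor
          · rintro ⟨⟨i, rfl⟩, hp⟩
            exact ⟨i, by simpa using hP _ _ _ hζ i y hy x₁ hc hp, rfl⟩
          · rintro ⟨i, hi, rfl⟩
            exact ⟨⟨i, rfl⟩, hP _ _ _ hζ i x₁ hc y hy (by simpa using hi)⟩
        rw [himg, Finset.sum_image fun i _ i' _ h => hζ.injective y hy h]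
      have hdiff : DifferentiableOn ℂ
          (fun y => ∑ i ∈ Finset.univ.filter (fun i => P x₁ (ζ i x₁)), ζ i y ^ j)
          (Metric.ball x₁ δ) :=
        DifferentiableOn.fun_sum fun i _ => (hζ.differentiableOn i).pow j
      exact ((hdiff.congr heq).differentiableAt
        (Metric.ball_mem_nhds x₁ hζ.pos)).differentiableWithinAt
    · intro x _
      have hcard : ((T x).card : ℝ) ≤ n := by
        have h : (T x).card ≤ (fiber F x).natDegree :=
          (Finset.card_filter_le _ _).trans ((Multiset.toFinset_card_le _).trans
            (Polynomial.card_roots' (fiber F x)))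
        rw [natDegree_fiber hFh h1] at h
        exact_mod_cast h
      refine (norm_sum_le _ _).trans ?_
      calc ∑ w ∈ T x, ‖w ^ j‖ ≤ ∑ w ∈ T x, (B * (1 + ‖x‖)) ^ j := by
            refine Finset.sum_le_sum fun w hw => ?_
            rw [norm_pow]
            gcongr
            exact hB x w ((hmT x w).1 hw).1
        _ = (T x).card * (B * (1 + ‖x‖)) ^ j := by rw [Finset.sum_const, nsmul_eq_mul]
        _ ≤ n * (B * (1 + ‖x‖)) ^ j := by gcongr
        _ = _ := by rw [mul_pow]; ring
  choose p hpdeg hp using hpoly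
  let S : ℕ → MvPolynomial (Fin 3) ℂ := fun j => homogenization (p j) j
  have hS : ∀ x ∉ Z, ∀ z j, eval ![z, x, 1] (S j) = ∑ w ∈ T x, w ^ j := fun x hx z j => by
    rw [eval_homogenization (hpdeg j), hp j x hx]
  have hQe : ∀ x ∉ Z, ∀ z, (fiber F x).eval z = 0 → eval ![z, x, 1] (traceForm F S) =
      if z ∈ T x then (fiber F x).derivative.eval z else 0 := fun x hx z hz =>
    eval_traceForm_of_root (hS x hx z) (fun w hw => ((hmT x w).1 hw).1) hz
  have hQ0 : traceForm F S = 0 := by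
    obtain ⟨δ, ζ, hζ⟩ := exists_isBranchSystem hFh h1 (x₁ := x) fun z => hd _ z hx
    obtain ⟨δ', hδ', hball⟩ := Metric.eventually_nhds_iff_ball.1
      (d.continuous.continuousAt.eventually_ne hx)
    replace hζ := hζ.mono (lt_min hζ.pos hδ') (min_le_left δ δ')
    have hc : x ∈ Metric.ball x (min δ δ') := Metric.mem_ball_self hζ.pos
    obtain ⟨i, hi⟩ := (hζ.root_iff x hc z).1 hz
    refine (hζ.isUniformizedBy i).eq_zero_of_lt hF hFh (m := n - 1) (by omega)
      (traceForm_isHomogeneous hFh fun j => homogenization_isHomogeneous _ _)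
      Metric.isOpen_ball subset_rfl ⟨x, hc⟩ fun y hy => ?_
    rw [hQe y (hball y (Metric.ball_subset_ball (min_le_right _ _) hy)) _
      ((hζ.root_iff y hy _).2 ⟨i, rfl⟩), if_neg]
    rw [hmT]
    rintro ⟨-, hPy⟩
    exact hcon (hi ▸ hP _ _ _ hζ i y hy x hc hPy)
  have := hQe x₀ hx₀ z₀ hz₀
  rw [hQ0, map_zero, if_pos ((hmT _ _).2 ⟨hz₀, h₀⟩)] at this
  exact hd x₀ z₀ hx₀ hz₀ this.symm

end Connected

/-! ### Bounding a form modulo the equation of the curve -/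

section Reduction

variable {F : MvPolynomial (Fin 3) ℂ} {n : ℕ}

/-- Division by `F`, which is monic in the first variable. -/
lemma exists_reduced (hn : n ≠ 0) (hFh : F.IsHomogeneous n) (h1 : eval (Pi.single 0 1) F = 1)
    {m : ℕ} {G : MvPolynomial (Fin 3) ℂ} (hG : G.IsHomogeneous m) :
    ∃ H R : MvPolynomial (Fin 3) ℂ, G = F * H + R ∧ R.IsHomogeneous m ∧
      ∀ d ∈ R.support, d 0 < n := by
  obtain ⟨hm, hdeg⟩ := finSuccEquiv_monic hFh h1
  let φ := finSuccEquiv ℂ 2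
  let R₀ := φ.symm (φ G %ₘ φ F)
  let H₀ := φ.symm (φ G /ₘ φ F)
  have hdiv : F * H₀ + R₀ = G := φ.injective (by
    rw [map_add, map_mul]
    simp only [R₀, H₀, AlgEquiv.apply_symm_apply]
    rw [add_comm]
    exact Polynomial.modByMonic_add_div (φ G) (φ F))
  have hR₀ : ∀ d ∈ R₀.support, d 0 < n := by
    rw [← degreeOf_lt_iff (Nat.pos_of_ne_zero hn), ← natDegree_finSuccEquiv]
    simp only [R₀, φ, AlgEquiv.apply_symm_apply]
    rw [← hdeg]
    refine Polynomial.natDegree_modByMonic_lt _ hm fun h => ?_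
    rw [h, Polynomial.natDegree_one] at hdeg
    exact hn hdeg.symm
  have hcomp := congrArg (homogeneousComponent m) hdiv
  rw [map_add, homogeneousComponent_mul_of_isHomogeneous hFh, homogeneousComponent_of_mem hG,
    if_pos rfl] at hcomp
  refine ⟨if n ≤ m then homogeneousComponent (m - n) H₀ else 0, homogeneousComponent m R₀, ?_,
    homogeneousComponent_isHomogeneous _ _, fun d hd => hR₀ d ?_⟩
  · rw [← hcomp]
    split_ifs <;> simp
  · rw [mem_support_iff, coeff_homogeneousComponent] at hd
    rw [mem_support_iff]
    split_ifs at hd with h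
    · exact hd
    · exact absurd rfl hd

/-- The coefficients of a polynomial of degree less than `n` are bounded by its values at the
branches, uniformly near `x₁`: the Vandermonde matrix of the branches is invertible. -/
lemma IsBranchSystem.exists_coeff_bound {x₁ : ℂ} {δ : ℝ} {ζ : Fin n → ℂ → ℂ}
    (h : IsBranchSystem F x₁ δ ζ) :
    ∃ A : ℝ, 0 ≤ A ∧ ∀ᶠ y in nhds x₁, ∀ (c : Fin n → ℂ) (E : ℝ),
      (∑ i, ‖∑ j, c j * ζ i y ^ (j : ℕ)‖) ≤ E → ∀ j, ‖c j‖ ≤ A * E := by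
  let V : ℂ → Matrix (Fin n) (Fin n) ℂ := fun y => Matrix.vandermonde fun i => ζ i y
  have hx : x₁ ∈ Metric.ball x₁ δ := Metric.mem_ball_self h.pos
  have hVc : ContinuousAt V x₁ := by
    refine continuousAt_pi.2 fun i => continuousAt_pi.2 fun j => ?_
    exact (h.continuousAt i hx).pow _
  have hdet : ∀ y ∈ Metric.ball x₁ δ, (V y).det ≠ 0 := fun y hy =>
    Matrix.det_vandermonde_ne_zero_iff.2 (h.injective y hy)
  have hinv : ContinuousAt (fun y => (V y)⁻¹) x₁ := by
    simp only [Matrix.inv_def, Ring.inverse_eq_inv']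
    have hd : ContinuousAt (fun y => (V y).det) x₁ :=
      ContinuousAt.comp (g := Matrix.det) (continuous_id.matrix_det.continuousAt) hVc
    have ha : ContinuousAt (fun y => (V y).adjugate) x₁ :=
      ContinuousAt.comp (g := Matrix.adjugate) (continuous_id.matrix_adjugate.continuousAt) hVc
    exact (hd.inv₀ (hdet x₁ hx)).smul ha
  have hbd : ∀ᶠ y in nhds x₁, ∀ j i, ‖(V y)⁻¹ j i‖ < (∑ j, ∑ i, ‖(V x₁)⁻¹ j i‖) + 1 := by
    refine Filter.eventually_all.2 fun j => Filter.eventually_all.2 fun i => ?_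
    have hc : ContinuousAt (fun y => (V y)⁻¹ j i) x₁ :=
      continuousAt_pi.1 (continuousAt_pi.1 hinv j) i
    refine hc.norm.eventually_lt_const (lt_of_le_of_lt ?_ (lt_add_one _))
    calc ‖(V x₁)⁻¹ j i‖ ≤ ∑ i, ‖(V x₁)⁻¹ j i‖ :=
          Finset.single_le_sum (f := fun i => ‖(V x₁)⁻¹ j i‖) (fun _ _ => norm_nonneg _)
            (Finset.mem_univ i)
      _ ≤ _ := Finset.single_le_sum (f := fun j => ∑ i, ‖(V x₁)⁻¹ j i‖)
            (fun _ _ => Finset.sum_nonneg fun _ _ => norm_nonneg _) (Finset.mem_univ j)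
  refine ⟨(∑ j, ∑ i, ‖(V x₁)⁻¹ j i‖) + 1, by positivity, ?_⟩
  filter_upwards [hbd, Metric.ball_mem_nhds x₁ h.pos] with y hy hyb c E hE j
  have hc : c = (V y)⁻¹.mulVec ((V y).mulVec c) := by
    rw [Matrix.mulVec_mulVec, Matrix.nonsing_inv_mul _ (isUnit_iff_ne_zero.2 (hdet y hyb)),
      Matrix.one_mulVec]
  have hv : ∀ i, (V y).mulVec c i = ∑ j, c j * ζ i y ^ (j : ℕ) := fun i => by
    simp [Matrix.mulVec, dotProduct, V, Matrix.vandermonde_apply, mul_comm]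
  rw [hc]
  simp only [Matrix.mulVec, dotProduct] at hv ⊢
  refine (norm_sum_le _ _).trans ?_
  calc _ ≤ ∑ i, ((∑ j, ∑ i, ‖(V x₁)⁻¹ j i‖) + 1) * ‖∑ j, c j * ζ i y ^ (j : ℕ)‖ := by
        refine Finset.sum_le_sum fun i _ => ?_
        rw [norm_mul, hv]
        gcongr
        exact (hy j i).le
    _ ≤ _ := by
        rw [← Finset.mul_sum]
        gcongr

/-- The coefficient of `zʲ` in `G(z, x, 1)`, as a polynomial in `x`. -/
def fiberCoeff (G : MvPolynomial (Fin 3) ℂ) (j : ℕ) : Polynomial ℂ :=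
  ∑ d ∈ G.support with d 0 = j, Polynomial.C (coeff d G) * Polynomial.X ^ d 1

lemma coeff_fiberCoeff {m : ℕ} {G : MvPolynomial (Fin 3) ℂ} (hG : G.IsHomogeneous m)
    {d : Fin 3 →₀ ℕ} (hd : d ∈ G.support) : (fiberCoeff G (d 0)).coeff (d 1) = coeff d G := by
  rw [fiberCoeff, Polynomial.finsetSum_coeff, Finset.sum_eq_single d]
  · simp
  · intro e he hne
    rw [Polynomial.coeff_C_mul_X_pow, if_neg]
    rintro h1
    have h0 := (Finset.mem_filter.1 he).2
    have hs1 := hG.sum_eq hd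
    have hs2 := hG.sum_eq (Finset.mem_filter.1 he).1
    rw [Fin.sum_univ_three] at hs1 hs2
    apply hne
    ext i
    fin_cases i
    · exact h0
    · exact h1.symm
    · change e 2 = d 2
      omega
  · intro h
    exact absurd (show d ∈ G.support.filter (fun e => e 0 = d 0) from
      Finset.mem_filter.2 ⟨hd, rfl⟩) h

lemma natDegree_fiberCoeff_le {m : ℕ} {G : MvPolynomial (Fin 3) ℂ} (hG : G.IsHomogeneous m)
    (j : ℕ) : (fiberCoeff G j).natDegree ≤ m := by
  refine Polynomial.natDegree_sum_le_of_forall_le _ _ fun d hd => ?_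
  refine (Polynomial.natDegree_C_mul_X_pow_le _ _).trans ?_
  have hs := hG.sum_eq (Finset.mem_filter.1 hd).1
  rw [Fin.sum_univ_three] at hs
  omega

lemma sum_fiberCoeff {G : MvPolynomial (Fin 3) ℂ} (hG : ∀ d ∈ G.support, d 0 < n) (x z : ℂ) :
    ∑ j : Fin n, (fiberCoeff G j).eval x * z ^ (j : ℕ) = eval ![z, x, 1] G := by
  rw [eval_eq', ← Finset.sum_range (fun j => (fiberCoeff G j).eval x * z ^ j),
    ← Finset.sum_fiberwise_of_maps_to (s := G.support) (t := Finset.range n) (g := fun d => d 0)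
    fun d hd => Finset.mem_range.2 (hG d hd)]
  refine Finset.sum_congr rfl fun j _ => ?_
  rw [fiberCoeff, Polynomial.eval_finsetSum, Finset.sum_mul]
  refine Finset.sum_congr rfl fun d hd => ?_
  rw [← (Finset.mem_filter.1 hd).2]
  simp [Fin.prod_univ_three]
  ring

lemma card_support_le {m : ℕ} {G : MvPolynomial (Fin 3) ℂ} (hG : G.IsHomogeneous m) :
    (G.support.card : ℝ) ≤ 4 ^ m := by
  have h : G.support.card ≤ ((Finset.range (m + 1)) ×ˢ (Finset.range (m + 1))).card := by
    refine Finset.card_le_card_of_injOn (fun d => (d 0, d 1)) (fun d hd => ?_) fun d hd e he h => ?_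
    · have hs := hG.sum_eq hd
      rw [Fin.sum_univ_three] at hs
      simp only [Finset.coe_product, Set.mem_prod, Finset.coe_range, Set.mem_Iio]
      omega
    · have hs1 := hG.sum_eq hd
      have hs2 := hG.sum_eq he
      rw [Fin.sum_univ_three] at hs1 hs2
      obtain ⟨h0, h1⟩ := Prod.mk.inj h
      ext i
      fin_cases i
      · exact h0
      · exact h1
      · change d 2 = e 2
        omega
  have h2 : m + 1 ≤ 2 ^ m := Nat.lt_two_pow_self
  rw [Finset.card_product, Finset.card_range] at h
  have : G.support.card ≤ 4 ^ m := by
    calc _ ≤ (m + 1) * (m + 1) := h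
      _ ≤ 2 ^ m * 2 ^ m := Nat.mul_le_mul h2 h2
      _ = 4 ^ m := by rw [← mul_pow]; rfl
  exact_mod_cast this

/-- A form of degree less than `n` in the first variable is bounded by its values on the branches
over a small disc, up to a constant to the power of the degree. -/
lemma IsBranchSystem.exists_coeffNorm_bound {x₁ : ℂ} {δ : ℝ} {ζ : Fin n → ℂ → ℂ}
    (h : IsBranchSystem F x₁ δ ζ) {N : Set ℂ} (hN : N ∈ nhds x₁) :
    ∃ A : ℝ, 1 ≤ A ∧ ∀ (m : ℕ) (G : MvPolynomial (Fin 3) ℂ), G.IsHomogeneous m →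
      (∀ d ∈ G.support, d 0 < n) → ∀ e : Fin n → ℝ,
      (∀ y ∈ N, ∀ i, ‖eval ![ζ i y, y, 1] G‖ ≤ e i) → coeffNorm G ≤ A ^ (m + 1) * ∑ i, e i := by
  obtain ⟨A, hA, hev⟩ := h.exists_coeff_bound
  obtain ⟨r, hr, hrb⟩ := Metric.nhds_basis_closedBall.mem_iff.1
    (Filter.inter_mem hev hN)
  obtain ⟨B, hBdef⟩ : ∃ B : ℝ, B = 2 * ((1 + r⁻¹) * (1 + ‖x₁‖)) := ⟨_, rfl⟩
  have hB : 0 ≤ B := by rw [hBdef]; positivity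
  refine ⟨1 + A + 4 * B, by linarith, fun m G hG hGd e he => ?_⟩
  have hEnn : 0 ≤ ∑ i, e i := Finset.sum_nonneg fun i _ =>
    (norm_nonneg _).trans (he x₁ (mem_of_mem_nhds hN) i)
  have hcoef : ∀ d ∈ G.support, ‖coeff d G‖ ≤ A * (∑ i, e i) * B ^ m := by
    intro d hd
    rw [← coeff_fiberCoeff hG hd, hBdef]
    refine norm_coeff_le_of_ball hr (natDegree_fiberCoeff_le hG _) (fun y hy => ?_) _
    refine (hrb hy).1 (fun j => (fiberCoeff G j).eval y) _ ?_ ⟨d 0, hGd d hd⟩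
    refine Finset.sum_le_sum fun i _ => ?_
    rw [sum_fiberCoeff hGd]
    exact he y (hrb hy).2 i
  calc coeffNorm G ≤ ∑ d ∈ G.support, A * (∑ i, e i) * B ^ m := Finset.sum_le_sum hcoef
    _ = G.support.card * (A * (∑ i, e i) * B ^ m) := by rw [Finset.sum_const, nsmul_eq_mul]
    _ ≤ 4 ^ m * (A * (∑ i, e i) * B ^ m) := by gcongr; exact card_support_le hG
    _ = (4 * B) ^ m * A * ∑ i, e i := by rw [mul_pow 4 B]; ring
    _ ≤ (1 + A + 4 * B) ^ m * (1 + A + 4 * B) * ∑ i, e i := by gcongr <;> linarith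
    _ = _ := by rw [pow_succ]

/-- Forms of degree less than `n` in the first variable are bounded by their values on any part of
the curve. -/
theorem exists_reduced_bound (hn : 2 ≤ n) (hF : Prime F) (hFh : F.IsHomogeneous n)
    (h1 : eval (Pi.single 0 1) F = 1) {D : Set ℂ} {ξ : ℂ → Fin 3 → ℂ} (hξ : IsUniformizedBy F D ξ)
    {K : Set ℂ} {t₀ : ℂ} {ρ : ℝ} (hρ : 0 < ρ) (hD : Metric.ball t₀ ρ ⊆ D)
    (hK : Metric.ball t₀ ρ ⊆ K) :
    ∃ A : ℝ, 1 ≤ A ∧ ∀ (m : ℕ) (ε : ℝ) (G : MvPolynomial (Fin 3) ℂ), IsSmallForm ξ K m ε G →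
      (∀ d ∈ G.support, d 0 < n) → coeffNorm G = 1 → 1 ≤ A ^ (m + 1) * ε := by
  obtain ⟨d, hd0, hd⟩ := exists_fiber_discriminant (by omega) hFh h1 hF
  obtain ⟨x₀, z₀, hx₀, hz₀, hc₀⟩ := exists_isControlled hn hF hFh h1 hξ hρ hD hK hd0 hd
  have hall : ∀ x z, d.eval x ≠ 0 → (fiber F x).eval z = 0 → IsControlled F ξ K x z :=
    fun x z hx hz => forall_of_locally_constant hn hF hFh h1 hd0 hd
      (fun _ _ _ hB i _ hy _ hw hc => hc.spread hB i hy hw) hx₀ hz₀ hc₀ hx hz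
  obtain ⟨δ, ζ, hB⟩ := exists_isBranchSystem hFh h1 (x₁ := x₀) fun z => hd _ z hx₀
  have hxb : x₀ ∈ Metric.ball x₀ δ := Metric.mem_ball_self hB.pos
  choose k A hk hA hev using fun i => (isControlled_branch_iff hB i hxb).1
    (hall x₀ (ζ i x₀) hx₀ ((hB.root_iff x₀ hxb _).2 ⟨i, rfl⟩))
  obtain ⟨C, hC, hCb⟩ := hB.exists_coeffNorm_bound (Filter.eventually_all.2 hev)
  have hn0 : (1 : ℝ) ≤ n := by exact_mod_cast (by omega : 1 ≤ n)
  have hterm : ∀ i, 1 ≤ (n * C) ^ k i * A i := fun i =>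
    one_le_mul_of_one_le_of_one_le (one_le_pow₀ (one_le_mul_of_one_le_of_one_le hn0 hC)) (hA i)
  refine ⟨1 + ∑ i, (n * C) ^ k i * A i, ?_, fun m ε G hG hGd hG1 => ?_⟩
  · have : 0 ≤ ∑ i, (n * C) ^ k i * A i := Finset.sum_nonneg fun i _ => by linarith [hterm i]
    linarith
  have hε := hG.nonneg
  have he : ∀ i, ∃ e : ℝ, 0 ≤ e ∧ e ^ k i = A i ^ (m + 1) * ε := fun i => by
    have := hA i
    exact ⟨(A i ^ (m + 1) * ε) ^ ((k i : ℝ)⁻¹), by positivity,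
      Real.rpow_inv_natCast_pow (by positivity) (hk i).ne'⟩
  choose e he0 he using he
  have hbound := hCb m G hG.isHomogeneous hGd e fun y hy i => by
    rw [← pow_le_pow_iff_left₀ (norm_nonneg _) (he0 i) (hk i).ne', he i]
    exact hy i m ε G hG
  rw [hG1] at hbound
  -- one of the `n` terms of the sum is at least the mean
  obtain ⟨i, hi⟩ : ∃ i, 1 ≤ n * C ^ (m + 1) * e i := by
    by_contra! hcon
    have : ∑ i, n * C ^ (m + 1) * e i < ∑ _i : Fin n, (1 : ℝ) :=
      Finset.sum_lt_sum_of_nonempty ⟨⟨0, by omega⟩, Finset.mem_univ _⟩ fun i _ => hcon i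
    rw [← Finset.mul_sum, Finset.sum_const, Finset.card_univ, Fintype.card_fin, nsmul_eq_mul,
      mul_one, mul_assoc] at this
    nlinarith
  calc (1 : ℝ) ≤ (n * C ^ (m + 1) * e i) ^ k i := one_le_pow₀ hi
    _ = (n * C ^ (m + 1)) ^ k i * (A i ^ (m + 1) * ε) := by rw [mul_pow _ (e i), he]
    _ ≤ ((n * C) ^ (m + 1)) ^ k i * (A i ^ (m + 1) * ε) := by
        have := hA i
        have hle : n * C ^ (m + 1) ≤ (n * C) ^ (m + 1) := by
          rw [mul_pow]
          gcongr
          exact le_self_pow₀ hn0 m.succ_ne_zero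
        gcongr
    _ = ((n * C) ^ k i * A i) ^ (m + 1) * ε := by
        rw [← pow_mul, mul_pow ((n * C) ^ k i), ← pow_mul, mul_comm (m + 1)]; ring
    _ ≤ (1 + ∑ i, (n * C) ^ k i * A i) ^ (m + 1) * ε := by
        gcongr
        · linarith [hterm i]
        · have := Finset.single_le_sum (f := fun i => (n * C) ^ k i * A i)
            (fun i _ => by linarith [hterm i]) (Finset.mem_univ i)
          linarith

/-- The key estimate, when the equation of the curve is monic in the first variable. -/
theorem exists_division_bound_of_monic (hn : 2 ≤ n) (hF : Prime F) (hFh : F.IsHomogeneous n)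
    (h1 : eval (Pi.single 0 1) F = 1) {D : Set ℂ} {ξ : ℂ → Fin 3 → ℂ} (hξ : IsUniformizedBy F D ξ)
    {K : Set ℂ} (hKD : K ⊆ D) {t₀ : ℂ} {ρ : ℝ} (hρ : 0 < ρ) (hK : Metric.ball t₀ ρ ⊆ K) :
    ∃ A : ℝ, 1 ≤ A ∧ ∀ (m : ℕ) (ε : ℝ) (G : MvPolynomial (Fin 3) ℂ), 0 ≤ ε → G.IsHomogeneous m →
      (∀ t ∈ K, ‖eval (ξ t) G‖ ≤ ε) →
      ∃ H R : MvPolynomial (Fin 3) ℂ, G = F * H + R ∧ R.IsHomogeneous m ∧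
        coeffNorm R ≤ A ^ (m + 1) * ε := by
  obtain ⟨A, hA, hAb⟩ := exists_reduced_bound hn hF hFh h1 hξ hρ (hK.trans hKD) hK
  refine ⟨A, hA, fun m ε G hε hG hGK => ?_⟩
  obtain ⟨H, R, hGR, hR, hRd⟩ := exists_reduced (by omega) hFh h1 hG
  refine ⟨H, R, hGR, hR, ?_⟩
  rcases (coeffNorm_nonneg R).eq_or_lt with h0 | hpos
  · rw [← h0]; positivity
  have hnorm : ‖(((coeffNorm R)⁻¹ : ℝ) : ℂ)‖ = (coeffNorm R)⁻¹ := by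
    rw [Complex.norm_real, Real.norm_of_nonneg (by positivity)]
  have hν : coeffNorm ((((coeffNorm R)⁻¹ : ℝ) : ℂ) • R) = 1 := by
    rw [coeffNorm_smul, hnorm, inv_mul_cancel₀ hpos.ne']
  have := hAb m ((coeffNorm R)⁻¹ * ε) ((((coeffNorm R)⁻¹ : ℝ) : ℂ) • R)
    { isHomogeneous := by rw [smul_eq_C_mul]; exact hR.C_mul _
      coeffNorm_le := hν.le
      nonneg := by positivity
      norm_le := fun t ht => by
        rw [smul_eval, norm_mul, hnorm]
        gcongr
        have := hGK t ht
        rwa [hGR, map_add, map_mul, hξ.mem_curve t (hKD ht), zero_mul, zero_add] at this }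
    (fun d hd => hRd d (support_smul hd)) hν
  rw [← mul_assoc, mul_comm _ (coeffNorm R)⁻¹, mul_assoc, inv_mul_eq_div, one_le_div hpos] at this
  exact this

end Reduction

/-! ### Linear changes of coordinates -/

/-- The substitution `G ↦ G ∘ L` of a linear map in the polynomial `G`. -/
def linearSubst (L : (Fin 3 → ℂ) →L[ℂ] (Fin 3 → ℂ)) :
    MvPolynomial (Fin 3) ℂ →ₐ[ℂ] MvPolynomial (Fin 3) ℂ :=
  aeval fun i => linearForm fun j => L (Pi.single j 1) i

lemma eval_linearForm (a v : Fin 3 → ℂ) : eval v (linearForm a) = ∑ i, a i * v i := by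
  simp [linearForm]

lemma eval_linearSubst (L : (Fin 3 → ℂ) →L[ℂ] (Fin 3 → ℂ)) (G : MvPolynomial (Fin 3) ℂ)
    (v : Fin 3 → ℂ) : eval v (linearSubst L G) = eval (L v) G := by
  have hv : L v = fun i => ∑ j, L (Pi.single j 1) i * v j := by
    ext i
    conv_lhs => rw [pi_eq_sum_univ' v]
    simp [mul_comm]
  have hc : (aeval v).comp (linearSubst L) =
      aeval fun i => ∑ j, L (Pi.single j 1) i * v j := by
    refine algHom_ext fun i => ?_
    simp [linearSubst, eval_linearForm]
  rw [hv]
  simpa [coe_aeval_eq_eval] using DFunLike.congr_fun hc G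

lemma linearSubst_isHomogeneous (L : (Fin 3 → ℂ) →L[ℂ] (Fin 3 → ℂ)) {m : ℕ}
    {G : MvPolynomial (Fin 3) ℂ} (hG : G.IsHomogeneous m) : (linearSubst L G).IsHomogeneous m := by
  have := hG.aeval (fun i => linearForm fun j => L (Pi.single j 1) i)
    fun i => linearForm_isHomogeneous _
  rwa [one_mul] at this

lemma exists_coeffNorm_linearSubst_le (L : (Fin 3 → ℂ) →L[ℂ] (Fin 3 → ℂ)) :
    ∃ B : ℝ, 1 ≤ B ∧ ∀ (m : ℕ) (G : MvPolynomial (Fin 3) ℂ), G.IsHomogeneous m →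
      coeffNorm (linearSubst L G) ≤ coeffNorm G * B ^ m := by
  let l : Fin 3 → MvPolynomial (Fin 3) ℂ := fun i => linearForm fun j => L (Pi.single j 1) i
  let B : ℝ := 1 + ∑ i, coeffNorm (l i)
  have hl : ∀ i, coeffNorm (l i) ≤ B := fun i => by
    have := Finset.single_le_sum (f := fun i => coeffNorm (l i)) (fun i _ => coeffNorm_nonneg _)
      (Finset.mem_univ i)
    linarith
  have hB : 1 ≤ B := le_add_of_nonneg_right (Finset.sum_nonneg fun i _ => coeffNorm_nonneg _)
  refine ⟨B, hB, fun m G hG => ?_⟩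
  have hG' : linearSubst L G = ∑ d ∈ G.support, coeff d G • ∏ i, l i ^ d i := by
    rw [linearSubst, aeval_def, eval₂_eq']
    exact Finset.sum_congr rfl fun d _ => by rw [algebraMap_eq, smul_eq_C_mul]
  rw [hG', coeffNorm.eq_def G, Finset.sum_mul]
  refine (coeffNorm_sum_le _ _).trans (Finset.sum_le_sum fun d hd => ?_)
  rw [coeffNorm_smul]
  gcongr
  rw [← hG.sum_eq hd, Fin.prod_univ_three, Fin.sum_univ_three, pow_add, pow_add]
  have hp : ∀ i, coeffNorm (l i ^ d i) ≤ B ^ d i := fun i =>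
    (coeffNorm_pow_le _ _).trans (pow_le_pow_left₀ (coeffNorm_nonneg _) (hl i) _)
  refine (coeffNorm_mul_le _ _).trans (mul_le_mul ((coeffNorm_mul_le _ _).trans ?_) (hp 2)
    (coeffNorm_nonneg _) (by positivity))
  exact mul_le_mul (hp 0) (hp 1) (coeffNorm_nonneg _) (by positivity)

lemma linearSubst_symm_apply (L : (Fin 3 → ℂ) ≃L[ℂ] (Fin 3 → ℂ)) (G : MvPolynomial (Fin 3) ℂ) :
    linearSubst L.symm (linearSubst L G) = G := by
  refine MvPolynomial.funext fun v => ?_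
  rw [eval_linearSubst, eval_linearSubst]
  simp

lemma linearSubst_apply_symm (L : (Fin 3 → ℂ) ≃L[ℂ] (Fin 3 → ℂ)) (G : MvPolynomial (Fin 3) ℂ) :
    linearSubst L (linearSubst L.symm G) = G := linearSubst_symm_apply L.symm G

lemma prime_linearSubst (L : (Fin 3 → ℂ) ≃L[ℂ] (Fin 3 → ℂ)) {F : MvPolynomial (Fin 3) ℂ}
    (hF : Prime F) : Prime (linearSubst L F) := by
  let e : MvPolynomial (Fin 3) ℂ ≃ₐ[ℂ] MvPolynomial (Fin 3) ℂ :=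
    AlgEquiv.ofAlgHom (linearSubst L) (linearSubst L.symm)
      (AlgHom.ext fun G => linearSubst_apply_symm L G)
      (AlgHom.ext fun G => linearSubst_symm_apply L G)
  exact (MulEquiv.prime_iff e.toMulEquiv).2 hF

lemma IsUniformizedBy.linearSubst {F : MvPolynomial (Fin 3) ℂ} {D : Set ℂ} {ξ : ℂ → Fin 3 → ℂ}
    (hξ : IsUniformizedBy F D ξ) (L : (Fin 3 → ℂ) ≃L[ℂ] (Fin 3 → ℂ)) :
    IsUniformizedBy (linearSubst L F) D (fun t => L.symm (ξ t)) where
  isOpen := hξ.isOpen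
  isPreconnected := hξ.isPreconnected
  differentiableOn := L.symm.differentiable.comp_differentiableOn hξ.differentiableOn
  ne_zero t ht h := hξ.ne_zero t ht (by simpa using h)
  mem_curve t ht := by
    rw [eval_linearSubst]
    simpa using hξ.mem_curve t ht
  nonconstant := by
    obtain ⟨s, hs, t, ht, h⟩ := hξ.nonconstant
    refine ⟨s, hs, t, ht, ?_⟩
    have := h.map' (L.symm.toLinearEquiv : (Fin 3 → ℂ) →ₗ[ℂ] (Fin 3 → ℂ))
      (LinearEquiv.ker L.symm.toLinearEquiv)
    have he : L.symm.toLinearEquiv ∘ ![ξ s, ξ t] = ![L.symm (ξ s), L.symm (ξ t)] := by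
      ext i j
      fin_cases i <;> rfl
    exact he ▸ this

/-- The key estimate: a form of degree `m` that is small on a part of the curve is a multiple of
the equation of the curve up to a form whose coefficients are small, with a loss that is at most
exponential in `m`. -/
theorem exists_division_bound {n : ℕ} (hn : 2 ≤ n) {F : MvPolynomial (Fin 3) ℂ} (hF : Prime F)
    (hFh : F.IsHomogeneous n) {D : Set ℂ} {ξ : ℂ → Fin 3 → ℂ} (hξ : IsUniformizedBy F D ξ)
    {K : Set ℂ} (hKD : K ⊆ D) {t₀ : ℂ} {ρ : ℝ} (hρ : 0 < ρ) (hK : Metric.ball t₀ ρ ⊆ K) :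
    ∃ A : ℝ, 1 ≤ A ∧ ∀ (m : ℕ) (ε : ℝ) (G : MvPolynomial (Fin 3) ℂ), 0 ≤ ε → G.IsHomogeneous m →
      (∀ t ∈ K, ‖eval (ξ t) G‖ ≤ ε) →
      ∃ H R : MvPolynomial (Fin 3) ℂ, G = F * H + R ∧ coeffNorm R ≤ A ^ (m + 1) * ε := by
  -- a vector `v` with `F v = 1`
  obtain ⟨w, hw⟩ : ∃ w, eval w F ≠ 0 := by
    by_contra! h
    exact hF.ne_zero (MvPolynomial.funext fun v => by rw [h v, map_zero])
  obtain ⟨c, hc⟩ := IsAlgClosed.exists_pow_nat_eq (eval w F)⁻¹ (by omega : 0 < n)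
  have hv : eval (c • w) F = 1 := by rw [hFh.eval_smul, hc, inv_mul_cancel₀ hw]
  have hv0 : c • w ≠ 0 := by
    intro h
    have h1 := hFh.eval_smul 0 (c • w)
    rw [h, smul_zero, ← h, hv, zero_pow (by omega), zero_mul] at h1
    exact one_ne_zero h1
  obtain ⟨L, hL⟩ := SeparatingDual.exists_continuousLinearEquiv_apply_eq (R := ℂ)
    (x := (Pi.single 0 1 : Fin 3 → ℂ)) (y := c • w) (by simp) hv0
  obtain ⟨A, hA, hAb⟩ := exists_division_bound_of_monic hn (prime_linearSubst L hF)
    (linearSubst_isHomogeneous _ hFh) (by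
      rw [eval_linearSubst]
      exact (congrArg (fun v => eval v F) hL).trans hv) (hξ.linearSubst L) hKD hρ hK
  obtain ⟨B, hB, hBb⟩ := exists_coeffNorm_linearSubst_le L.symm
  refine ⟨A * B, one_le_mul_of_one_le_of_one_le hA hB, fun m ε G hε hG hGK => ?_⟩
  obtain ⟨H, R, hGR, hR, hRb⟩ := hAb m ε (linearSubst L G) hε (linearSubst_isHomogeneous _ hG)
    fun t ht => by
      rw [eval_linearSubst]
      simpa using hGK t ht
  refine ⟨linearSubst L.symm H, linearSubst L.symm R, ?_, ?_⟩
  · have := congrArg (linearSubst L.symm) hGR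
    rwa [map_add, map_mul, linearSubst_symm_apply, linearSubst_symm_apply] at this
  · calc _ ≤ coeffNorm R * B ^ m := hBb m R hR
      _ ≤ A ^ (m + 1) * ε * B ^ (m + 1) := by
        gcongr
        exact m.le_succ
      _ = _ := by rw [mul_pow]; ring

/-! ### Expansion of real-analytic functions in forms -/

/-- A point of `ℝ³` as a point of `ℂ³`. -/
def complexPoint (h : Fin 3 → ℝ) : Fin 3 → ℂ := fun i => (h i : ℂ)

@[simp] lemma complexPoint_apply (h : Fin 3 → ℝ) (i : Fin 3) : complexPoint h i = (h i : ℂ) := rfl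

/-- The expansion `f (p + h) = ∑ Pₘ(h)`, valid for small `h`, into forms `Pₘ` of degree `m` whose
coefficients grow at most exponentially. -/
structure HasFormExpansion (f : (Fin 3 → ℝ) → ℂ) (p : Fin 3 → ℝ)
    (P : ℕ → MvPolynomial (Fin 3) ℂ) : Prop where
  isHomogeneous : ∀ m, (P m).IsHomogeneous m
  exists_bound : ∃ A B : ℝ, 0 ≤ A ∧ 1 ≤ B ∧ ∀ m, coeffNorm (P m) ≤ A * B ^ m
  eventually_hasSum : ∀ᶠ h : Fin 3 → ℝ in nhds 0,
    HasSum (fun m => eval (complexPoint h) (P m)) (f (p + h))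

/-- The form `h ↦ φ(h, …, h)` of a multilinear `φ`. -/
def diagonalForm {m : ℕ} (φ : ContinuousMultilinearMap ℝ (fun _ : Fin m => Fin 3 → ℝ) ℂ) :
    MvPolynomial (Fin 3) ℂ :=
  ∑ σ : Fin m → Fin 3, C (φ fun k => Pi.single (σ k) 1) * ∏ k, X (σ k)

lemma diagonalForm_isHomogeneous {m : ℕ}
    (φ : ContinuousMultilinearMap ℝ (fun _ : Fin m => Fin 3 → ℝ) ℂ) :
    (diagonalForm φ).IsHomogeneous m := by
  refine IsHomogeneous.sum _ _ _ fun σ _ => IsHomogeneous.C_mul ?_ _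
  simpa using IsHomogeneous.prod Finset.univ (fun k => X (σ k)) (fun _ => 1)
    fun k _ => isHomogeneous_X ℂ (σ k)

lemma eval_diagonalForm {m : ℕ} (φ : ContinuousMultilinearMap ℝ (fun _ : Fin m => Fin 3 → ℝ) ℂ)
    (h : Fin 3 → ℝ) : eval (complexPoint h) (diagonalForm φ) = φ fun _ => h := by
  have hh : (fun _ : Fin m => h) =
      fun _ : Fin m => ∑ i, h i • (Pi.single i 1 : Fin 3 → ℝ) := by
    funext _
    exact pi_eq_sum_univ' h
  rw [hh, ContinuousMultilinearMap.map_sum, diagonalForm, map_sum]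
  refine Finset.sum_congr rfl fun σ _ => ?_
  rw [ContinuousMultilinearMap.map_smul_univ]
  simp [mul_comm, map_prod]

lemma coeffNorm_diagonalForm_le {m : ℕ}
    (φ : ContinuousMultilinearMap ℝ (fun _ : Fin m => Fin 3 → ℝ) ℂ) :
    coeffNorm (diagonalForm φ) ≤ 3 ^ m * ‖φ‖ := by
  refine (coeffNorm_sum_le _ _).trans ?_
  have hcard : (3 : ℝ) ^ m = ∑ _σ : Fin m → Fin 3, 1 := by simp
  rw [hcard, Finset.sum_mul]
  refine Finset.sum_le_sum fun σ _ => ?_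
  have hprod : coeffNorm (∏ k, X (σ k)) ≤ 1 := by
    have : ∀ s : Finset (Fin m), coeffNorm (∏ k ∈ s, X (σ k)) ≤ 1 := by
      intro s
      induction s using Finset.induction_on with
      | empty => simp [coeffNorm_one]
      | insert a s ha ih =>
        rw [Finset.prod_insert ha]
        refine (coeffNorm_mul_le _ _).trans (mul_le_one₀ ?_ (coeffNorm_nonneg _) ih)
        rw [X, coeffNorm_monomial, norm_one]
    exact this _
  rw [← smul_eq_C_mul, coeffNorm_smul, one_mul]
  refine (mul_le_of_le_one_right (norm_nonneg _) hprod).trans ?_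
  refine (φ.le_opNorm _).trans (mul_le_of_le_one_right (norm_nonneg _) ?_)
  exact Finset.prod_le_one (fun _ _ => norm_nonneg _) fun k _ =>
    ((Pi.norm_single (G := fun _ : Fin 3 => ℝ) (i := σ k) (1 : ℝ)).trans norm_one).le

lemma AnalyticAt.exists_hasFormExpansion {f : (Fin 3 → ℝ) → ℂ} {p : Fin 3 → ℝ}
    (hf : AnalyticAt ℝ f p) : ∃ P, HasFormExpansion f p P := by
  obtain ⟨φ, hφ⟩ := hf
  obtain ⟨R, hR⟩ := hφ
  obtain ⟨r, hr0, hr⟩ := ENNReal.lt_iff_exists_nnreal_btwn.1 (hR.r_pos.trans_le hR.r_le)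
  have hr0' : 0 < r := by exact_mod_cast hr0
  obtain ⟨A, hA, hAb⟩ := φ.norm_le_div_pow_of_pos_of_lt_radius hr0' hr
  refine ⟨fun m => diagonalForm (φ m), fun m => diagonalForm_isHomogeneous _,
    ⟨A, 1 + 3 / r, hA.le, le_add_of_nonneg_right (by positivity), fun m => ?_⟩, ?_⟩
  · calc coeffNorm (diagonalForm (φ m)) ≤ 3 ^ m * (A / r ^ m) :=
          (coeffNorm_diagonalForm_le _).trans (by gcongr; exact hAb m)
      _ = A * (3 / r) ^ m := by rw [div_pow]; ring
      _ ≤ A * (1 + 3 / r) ^ m := by gcongr; linarith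
  · filter_upwards [hR.hasFPowerSeriesAt.eventually_hasSum] with h hh
    simpa only [eval_diagonalForm] using hh

lemma isHomogeneous_pderiv {m : ℕ} {P : MvPolynomial (Fin 3) ℂ} (hP : P.IsHomogeneous m)
    (i : Fin 3) : (pderiv i P).IsHomogeneous (m - 1) := hP.pderiv

lemma coeffNorm_pderiv_le {m : ℕ} {P : MvPolynomial (Fin 3) ℂ} (hP : P.IsHomogeneous m)
    (i : Fin 3) : coeffNorm (pderiv i P) ≤ m * coeffNorm P := by
  conv_lhs => rw [P.as_sum, map_sum]
  refine (coeffNorm_sum_le _ _).trans ?_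
  rw [coeffNorm, Finset.mul_sum]
  refine Finset.sum_le_sum fun d hd => ?_
  rw [pderiv_monomial, coeffNorm_monomial, norm_mul, mul_comm, Complex.norm_natCast]
  gcongr
  rw [← hP.sum_eq hd]
  exact Finset.single_le_sum (f := fun i => d i) (fun _ _ => Nat.zero_le _) (Finset.mem_univ i)

/-- The derivative in the direction of a coordinate axis. -/
lemma hasDerivAt_eval_line (P : MvPolynomial (Fin 3) ℂ) (h : Fin 3 → ℝ) (i : Fin 3) (s : ℝ) :
    HasDerivAt (fun s : ℝ => eval (complexPoint (h + s • Pi.single i 1)) P)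
      (eval (complexPoint (h + s • Pi.single i 1)) (pderiv i P)) s := by
  induction P using MvPolynomial.induction_on with
  | C a => simpa using hasDerivAt_const s a
  | add p q hp hq =>
    simp only [map_add]
    exact hp.add hq
  | mul_X p j hp =>
    have hX : HasDerivAt (fun s : ℝ => (((h + s • (Pi.single i 1 : Fin 3 → ℝ)) j : ℝ) : ℂ))
        ((Pi.single i 1 : Fin 3 → ℝ) j : ℝ) s := by
      have : HasDerivAt (fun s : ℝ => (h + s • (Pi.single i 1 : Fin 3 → ℝ)) j)
          ((Pi.single i 1 : Fin 3 → ℝ) j) s := by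
        simpa using ((hasDerivAt_id s).mul_const ((Pi.single i 1 : Fin 3 → ℝ) j)).const_add (h j)
      exact this.ofReal_comp
    have hm := hp.mul hX
    have hv : eval (complexPoint (h + s • Pi.single i 1)) (pderiv i (p * X j)) =
        eval (complexPoint (h + s • Pi.single i 1)) (pderiv i p) *
          ((h + s • (Pi.single i 1 : Fin 3 → ℝ)) j : ℝ) +
        eval (complexPoint (h + s • Pi.single i 1)) p * ((Pi.single i 1 : Fin 3 → ℝ) j : ℝ) := by
      rw [Derivation.leibniz, pderiv_X, smul_eq_mul, smul_eq_mul, map_add, map_mul, map_mul,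
        eval_X, complexPoint_apply]
      by_cases hij : i = j
      · subst hij; simp; ring
      · simp [Ne.symm hij, mul_comm]
    rw [hv]
    refine hm.congr_of_eventuallyEq (Filter.Eventually.of_forall fun s => ?_)
    simp only [map_mul, eval_X, complexPoint_apply, Pi.mul_apply]

/-- Termwise differentiation. -/
lemma HasFormExpansion.partialDeriv {f : (Fin 3 → ℝ) → ℂ} {p : Fin 3 → ℝ}
    {P : ℕ → MvPolynomial (Fin 3) ℂ} (hP : HasFormExpansion f p P) (hf : AnalyticAt ℝ f p)
    (i : Fin 3) : HasFormExpansion (partialDeriv i f) p fun m => pderiv i (P (m + 1)) := by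
  obtain ⟨A, B, hA, hB, hAB⟩ := hP.exists_bound
  have hbd : ∀ m, coeffNorm (pderiv i (P (m + 1))) ≤ A * (2 * B) * (2 * B) ^ m := fun m => by
    have h2 : ((m + 1 : ℕ) : ℝ) ≤ 2 ^ (m + 1) := by
      exact_mod_cast (Nat.lt_two_pow_self (n := m + 1)).le
    calc _ ≤ ((m + 1 : ℕ) : ℝ) * (A * B ^ (m + 1)) :=
          (coeffNorm_pderiv_le (hP.isHomogeneous _) i).trans (by gcongr; exact hAB _)
      _ ≤ 2 ^ (m + 1) * (A * B ^ (m + 1)) := by gcongr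
      _ = _ := by rw [mul_pow]; ring
  refine ⟨fun m => isHomogeneous_pderiv (hP.isHomogeneous (m + 1)) i,
    ⟨A * (2 * B), 2 * B, by positivity, by linarith, hbd⟩, ?_⟩
  have hdiff : ∀ᶠ h : Fin 3 → ℝ in nhds 0, DifferentiableAt ℝ f (p + h) := by
    have : Filter.Tendsto (fun h : Fin 3 → ℝ => p + h) (nhds 0) (nhds p) := by
      simpa using (continuous_const_add p).tendsto 0
    exact this.eventually (hf.eventually_analyticAt.mono fun _ h => h.differentiableAt)
  obtain ⟨r₀, hr₀, hball⟩ := Metric.eventually_nhds_iff_ball.1 (hP.eventually_hasSum.and hdiff)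
  obtain ⟨r, hr, hrr₀, hrB⟩ : ∃ r : ℝ, 0 < r ∧ r ≤ r₀ ∧ 2 * B * r ≤ 2⁻¹ :=
    ⟨min r₀ (4 * B)⁻¹, by positivity, min_le_left _ _, by
      calc 2 * B * min r₀ (4 * B)⁻¹ ≤ 2 * B * (4 * B)⁻¹ := by gcongr; exact min_le_right _ _
        _ = 2⁻¹ := by field_simp; norm_num⟩
  filter_upwards [Metric.ball_mem_nhds 0 (half_pos hr)] with h hh
  rw [mem_ball_zero_iff] at hh
  have hmem : ∀ s ∈ Metric.ball (0 : ℝ) (r / 2), ‖h + s • (Pi.single i 1 : Fin 3 → ℝ)‖ < r := by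
    intro s hs
    rw [mem_ball_zero_iff] at hs
    calc _ ≤ ‖h‖ + ‖s • (Pi.single i 1 : Fin 3 → ℝ)‖ := norm_add_le _ _
      _ = ‖h‖ + ‖s‖ := by rw [norm_smul, Pi.norm_single]; simp
      _ < r := by linarith
  let u : ℕ → ℝ := fun m => coeffNorm (pderiv i (P m)) * r ^ (m - 1)
  have hu : Summable u := by
    rw [← summable_nat_add_iff 1]
    refine Summable.of_nonneg_of_le (fun m => mul_nonneg (coeffNorm_nonneg _) (by positivity))
      (fun m => ?_) ((summable_geometric_of_lt_one (r := (2⁻¹ : ℝ)) (by norm_num)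
        (by norm_num)).mul_left (A * (2 * B)))
    calc u (m + 1) ≤ A * (2 * B) * (2 * B) ^ m * r ^ m := by
          simp only [u, Nat.add_sub_cancel]
          gcongr
          exact hbd m
      _ = A * (2 * B) * (2 * B * r) ^ m := by rw [mul_pow (2 * B) r]; ring
      _ ≤ _ := by gcongr
  have hterm : ∀ m, ∀ s ∈ Metric.ball (0 : ℝ) (r / 2),
      ‖eval (complexPoint (h + s • Pi.single i 1)) (pderiv i (P m))‖ ≤ u m := by
    intro m s hs
    refine norm_eval_le (isHomogeneous_pderiv (hP.isHomogeneous m) i) fun j => ?_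
    rw [complexPoint_apply, Complex.norm_real]
    exact (norm_le_pi_norm _ j).trans (hmem s hs).le
  have h0 : (0 : ℝ) ∈ Metric.ball (0 : ℝ) (r / 2) := Metric.mem_ball_self (half_pos hr)
  have hsum : ∀ s ∈ Metric.ball (0 : ℝ) (r / 2),
      HasSum (fun m => eval (complexPoint (h + s • Pi.single i 1)) (P m))
        (f (p + (h + s • Pi.single i 1))) ∧
      DifferentiableAt ℝ f (p + (h + s • Pi.single i 1)) := fun s hs =>
    hball _ (mem_ball_zero_iff.2 ((hmem s hs).trans_le hrr₀))
  have hd := hasDerivAt_tsum_of_isPreconnected hu Metric.isOpen_ball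
    (convex_ball _ _).isPreconnected (fun m s _ => hasDerivAt_eval_line (P m) h i s) hterm h0
    (hsum 0 h0).1.summable h0
  have hline : HasDerivAt (fun s : ℝ => f (p + (h + s • Pi.single i 1)))
      (fderiv ℝ f (p + h) (Pi.single i 1)) 0 := by
    have hl : HasDerivAt (fun s : ℝ => p + (h + s • (Pi.single i 1 : Fin 3 → ℝ)))
        (Pi.single i 1) 0 := by
      simpa using (((hasDerivAt_id (0 : ℝ)).smul_const (Pi.single i 1 : Fin 3 → ℝ)).const_add
        h).const_add p
    have hfd := (hsum 0 h0).2.hasFDerivAt.comp_hasDerivAt (0 : ℝ) hl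
    simp only [zero_smul, add_zero] at hfd
    exact hfd
  have heq : (fun s : ℝ => f (p + (h + s • Pi.single i 1))) =ᶠ[nhds 0]
      fun s => ∑' m, eval (complexPoint (h + s • Pi.single i 1)) (P m) := by
    filter_upwards [Metric.ball_mem_nhds 0 (half_pos hr)] with s hs
    exact (hsum s hs).1.tsum_eq.symm
  have hval := hline.unique (hd.congr_of_eventuallyEq heq)
  have hs : HasSum (fun m => eval (complexPoint (h + (0 : ℝ) • Pi.single i 1))
      (pderiv i (P m))) (_root_.partialDeriv i f (p + h)) := by
    rw [_root_.partialDeriv, hval]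
    exact (Summable.of_norm_bounded hu fun m => hterm m 0 h0).hasSum
  rw [← hasSum_nat_add_iff' 1] at hs
  -- the constant term of the expansion has derivative zero
  have hP0 : pderiv i (P 0) = 0 := by
    have := totalDegree_eq_zero_iff_eq_C.1
      (Nat.le_zero.1 (hP.isHomogeneous 0).totalDegree_le)
    rw [this, pderiv_C]
  simpa [hP0] using hs

lemma AnalyticAt.partialDeriv {f : (Fin 3 → ℝ) → ℂ} {p : Fin 3 → ℝ} (hf : AnalyticAt ℝ f p)
    (i : Fin 3) : AnalyticAt ℝ (partialDeriv i f) p :=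
  ((ContinuousLinearMap.apply ℝ ℂ (Pi.single i 1 : Fin 3 → ℝ)).analyticAt _).comp hf.fderiv

lemma HasFormExpansion.iterate_partialDeriv {f : (Fin 3 → ℝ) → ℂ} {p : Fin 3 → ℝ}
    {P : ℕ → MvPolynomial (Fin 3) ℂ} (hP : HasFormExpansion f p P) (hf : AnalyticAt ℝ f p)
    (i : Fin 3) (k : ℕ) : AnalyticAt ℝ ((_root_.partialDeriv i)^[k] f) p ∧
      HasFormExpansion ((_root_.partialDeriv i)^[k] f) p fun m =>
        ((pderiv i).toLinearMap ^ k : Module.End ℂ (MvPolynomial (Fin 3) ℂ)) (P (m + k)) := by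
  induction k with
  | zero => exact ⟨hf, hP⟩
  | succ k ih =>
    rw [Function.iterate_succ_apply']
    refine ⟨ih.1.partialDeriv i, ?_⟩
    have := ih.2.partialDeriv ih.1 i
    simp only [add_right_comm _ 1 k] at this
    simp only [pow_succ']
    exact this

lemma HasFormExpansion.add {f g : (Fin 3 → ℝ) → ℂ} {p : Fin 3 → ℝ}
    {P Q : ℕ → MvPolynomial (Fin 3) ℂ} (hP : HasFormExpansion f p P)
    (hQ : HasFormExpansion g p Q) : HasFormExpansion (fun x => f x + g x) p fun m => P m + Q m where
  isHomogeneous m := (hP.isHomogeneous m).add (hQ.isHomogeneous m)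
  exists_bound := by
    obtain ⟨A, B, hA, hB, h⟩ := hP.exists_bound
    obtain ⟨A', B', hA', hB', h'⟩ := hQ.exists_bound
    refine ⟨A + A', max B B', add_nonneg hA hA', hB.trans (le_max_left _ _), fun m => ?_⟩
    calc _ ≤ A * B ^ m + A' * B' ^ m := (coeffNorm_add_le _ _).trans (add_le_add (h m) (h' m))
      _ ≤ A * (max B B') ^ m + A' * (max B B') ^ m := by
        gcongr
        · exact le_max_left _ _
        · exact le_max_right _ _
      _ = _ := by ring
  eventually_hasSum := by
    filter_upwards [hP.eventually_hasSum, hQ.eventually_hasSum] with h h1 h2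
    simpa only [map_add] using h1.add h2

lemma HasFormExpansion.const_smul {f : (Fin 3 → ℝ) → ℂ} {p : Fin 3 → ℝ}
    {P : ℕ → MvPolynomial (Fin 3) ℂ} (hP : HasFormExpansion f p P) (c : ℂ) :
    HasFormExpansion (fun x => c * f x) p fun m => c • P m where
  isHomogeneous m := by
    rw [smul_eq_C_mul]
    exact (hP.isHomogeneous m).C_mul c
  exists_bound := by
    obtain ⟨A, B, hA, hB, h⟩ := hP.exists_bound
    refine ⟨‖c‖ * A, B, by positivity, hB, fun m => ?_⟩
    rw [coeffNorm_smul, mul_assoc]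
    gcongr
    exact h m
  eventually_hasSum := by
    filter_upwards [hP.eventually_hasSum] with h h1
    simpa only [smul_eval] using h1.mul_left c

lemma HasFormExpansion.sum {ι : Type*} (s : Finset ι) {f : ι → (Fin 3 → ℝ) → ℂ} {p : Fin 3 → ℝ}
    {P : ι → ℕ → MvPolynomial (Fin 3) ℂ} (hP : ∀ i ∈ s, HasFormExpansion (f i) p (P i)) :
    HasFormExpansion (fun x => ∑ i ∈ s, f i x) p fun m => ∑ i ∈ s, P i m := by
  classical
  induction s using Finset.induction_on with
  | empty =>
    exact ⟨fun m => by simpa using isHomogeneous_zero _ _ _, ⟨0, 1, le_rfl, le_rfl, by simp⟩,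
      Filter.Eventually.of_forall fun h => by simp⟩
  | insert a s ha ih =>
    simp only [Finset.sum_insert ha]
    exact (hP a (Finset.mem_insert_self _ _)).add
      (ih fun i hi => hP i (Finset.mem_insert_of_mem hi))

/-- The expansion is unique. -/
lemma HasFormExpansion.eq_zero {f : (Fin 3 → ℝ) → ℂ} {p : Fin 3 → ℝ}
    {P : ℕ → MvPolynomial (Fin 3) ℂ} (hP : HasFormExpansion f p P)
    (h0 : ∀ᶠ x in nhds p, f x = 0) (m : ℕ) : P m = 0 := by
  have hreal : ∀ h : Fin 3 → ℝ, eval (complexPoint h) (P m) = 0 := by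
    intro h
    -- restrict to the line through `p` in the direction `h`
    have hline : Filter.Tendsto (fun s : ℝ => s • h) (nhds 0) (nhds 0) := by
      have : Continuous fun s : ℝ => s • h := by fun_prop
      simpa using this.tendsto 0
    have hshift : Filter.Tendsto (fun s : ℝ => p + s • h) (nhds 0) (nhds p) := by
      simpa using hline.const_add p
    let φ : FormalMultilinearSeries ℝ ℝ ℂ := fun k =>
      ContinuousMultilinearMap.mkPiRing ℝ (Fin k) (eval (complexPoint h) (P k))
    have hφ : HasFPowerSeriesAt 0 φ 0 := by
      rw [hasFPowerSeriesAt_iff]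
      filter_upwards [hline.eventually hP.eventually_hasSum, hshift.eventually h0] with s h1 h2
      rw [h2] at h1
      have hs : complexPoint (s • h) = (s : ℂ) • complexPoint h := by
        ext i
        simp
      refine h1.congr_fun fun k => ?_
      rw [hs, (hP.isHomogeneous k).eval_smul]
      simp [FormalMultilinearSeries.coeff, φ]
    have := congrFun hφ.eq_zero m
    simpa [φ] using congrArg (fun ψ => ψ fun _ => (1 : ℝ)) this
  refine MvPolynomial.funext_set (fun _ => Set.range ((↑) : ℝ → ℂ))
    (fun _ => Set.infinite_range_of_injective Complex.ofReal_injective) fun v hv => ?_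
  choose h hh using fun i => hv i (Set.mem_univ i)
  rw [← funext hh, map_zero]
  exact hreal h

/-- The forms in the expansion of a solution are solutions. -/
theorem HasFormExpansion.polyDiffOp_eq_zero {n : ℕ} {F : MvPolynomial (Fin 3) ℂ}
    (hFh : F.IsHomogeneous n) {f : (Fin 3 → ℝ) → ℂ} {p : Fin 3 → ℝ}
    {P : ℕ → MvPolynomial (Fin 3) ℂ} (hP : HasFormExpansion f p P) (hf : AnalyticAt ℝ f p)
    (h0 : ∀ᶠ x in nhds p, diffOp F f x = 0) (m : ℕ) : polyDiffOp F (P m) = 0 := by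
  rcases lt_or_ge m n with hmn | hmn
  · -- the result is constant, and its constant coefficient is an apolar pairing
    have hc := polyDiffOp_isHomogeneous hFh (hP.isHomogeneous m)
    rw [Nat.sub_eq_zero_of_le hmn.le] at hc
    rw [totalDegree_eq_zero_iff_eq_C.1 (Nat.le_zero.1 hc.totalDegree_le), ← apolar_apply,
      apolar_eq_zero_of_isHomogeneous hmn.ne' hFh (hP.isHomogeneous m), C_0]
  · obtain ⟨k, rfl⟩ := Nat.exists_eq_add_of_le' hmn
    have hmono : ∀ d ∈ F.support, HasFormExpansion (fun x => F.coeff d *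
        ((_root_.partialDeriv 0)^[d 0] ((_root_.partialDeriv 1)^[d 1]
          ((_root_.partialDeriv 2)^[d 2] f))) x) p
        fun m => F.coeff d • monomialDiffOp d (P (m + n)) := by
      intro d hd
      have h2 := hP.iterate_partialDeriv hf 2 (d 2)
      have h1 := h2.2.iterate_partialDeriv h2.1 1 (d 1)
      have h0 := (h1.2.iterate_partialDeriv h1.1 0 (d 0)).2.const_smul (F.coeff d)
      have hs := hFh.sum_eq hd
      rw [Fin.sum_univ_three] at hs
      have he : ∀ m, m + d 0 + d 1 + d 2 = m + n := fun m => by omega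
      simp only [he] at h0
      exact h0
    have hsum := (HasFormExpansion.sum F.support hmono).eq_zero h0 k
    rw [polyDiffOp, LinearMap.sum_apply]
    exact hsum

/-! ### Functionals on continuous functions and their Cauchy kernels -/

/-- A linear functional that is bounded in terms of a linear map `T` factors through `T`, by the
Hahn–Banach theorem. -/
lemma exists_functional_of_bound {V E : Type*} [AddCommGroup V] [Module ℂ V]
    [NormedAddCommGroup E] [NormedSpace ℂ E] (T : V →ₗ[ℂ] E) (f : V →ₗ[ℂ] ℂ) {M : ℝ} (hM : 0 ≤ M)
    (h : ∀ v, ‖f v‖ ≤ M * ‖T v‖) : ∃ ℓ : E →L[ℂ] ℂ, ‖ℓ‖ ≤ M ∧ ∀ v, ℓ (T v) = f v := by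
  obtain ⟨s, hs⟩ := T.rangeRestrict.exists_rightInverse_of_surjective T.range_rangeRestrict
  have hs' : ∀ x : LinearMap.range T, T (s x) = x := fun x =>
    congrArg Subtype.val (LinearMap.congr_fun hs x)
  let g : LinearMap.range T →L[ℂ] ℂ := (f ∘ₗ s).mkContinuous M fun x => by
    have := h (s x)
    rwa [hs'] at this
  obtain ⟨ℓ, hℓ, hnorm⟩ := exists_extension_norm_eq (LinearMap.range T) g
  refine ⟨ℓ, hnorm.le.trans (LinearMap.mkContinuous_norm_le _ hM _), fun v => ?_⟩
  have h1 : ℓ (T v) = f (s (T.rangeRestrict v)) := hℓ (T.rangeRestrict v)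
  have h2 := h (s (T.rangeRestrict v) - v)
  have hT : ((T.rangeRestrict v : LinearMap.range T) : E) = T v := rfl
  rw [map_sub, map_sub, hs', hT, sub_self, norm_zero, mul_zero,
    norm_le_zero_iff, sub_eq_zero] at h2
  rw [h1, h2]

lemma norm_apolar_le {m : ℕ} {P : MvPolynomial (Fin 3) ℂ} (hP : P.IsHomogeneous m)
    (G : MvPolynomial (Fin 3) ℂ) : ‖apolar G P‖ ≤ m.factorial * (coeffNorm P * coeffNorm G) := by
  rw [apolar_comm, apolar_eq_sum, coeffNorm.eq_def P, Finset.sum_mul, Finset.mul_sum]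
  refine (norm_sum_le _ _).trans (Finset.sum_le_sum fun d hd => ?_)
  rw [norm_mul, norm_mul, Complex.norm_natCast]
  gcongr
  · have hdvd := Nat.prod_factorial_dvd_factorial_sum Finset.univ d
    rw [hP.sum_eq hd, Fin.prod_univ_three] at hdvd
    exact Nat.le_of_dvd m.factorial_pos hdvd
  · exact norm_coeff_le_coeffNorm G d

/-- The functional of a homogeneous solution `P`: it takes the value `P(h)` at the restriction to
`K` of `t ↦ (ξ(t) ⬝ h)ᵐ`. -/
theorem exists_functional_of_division_bound {F : MvPolynomial (Fin 3) ℂ} {ξ : ℂ → Fin 3 → ℂ}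
    {K : Set ℂ} [CompactSpace K] (hξ : ContinuousOn ξ K) {A : ℝ} (hA : 0 ≤ A)
    (hdiv : ∀ (m : ℕ) (ε : ℝ) (G : MvPolynomial (Fin 3) ℂ), 0 ≤ ε → G.IsHomogeneous m →
      (∀ t ∈ K, ‖eval (ξ t) G‖ ≤ ε) →
      ∃ H R : MvPolynomial (Fin 3) ℂ, G = F * H + R ∧ coeffNorm R ≤ A ^ (m + 1) * ε)
    {m : ℕ} {P : MvPolynomial (Fin 3) ℂ} (hP : P.IsHomogeneous m) (hFP : polyDiffOp F P = 0) :
    ∃ ℓ : C(K, ℂ) →L[ℂ] ℂ, ‖ℓ‖ ≤ coeffNorm P * A ^ (m + 1) ∧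
      ∀ (v : Fin 3 → ℂ) (g : C(K, ℂ)), (∀ s : K, g s = (∑ i, ξ s i * v i) ^ m) →
        ℓ g = eval v P := by
  have hc : ∀ G : MvPolynomial (Fin 3) ℂ, Continuous fun t : K => eval (ξ t) G := fun G =>
    G.continuous_eval.comp (continuousOn_iff_continuous_domRestrict.1 hξ)
  let T : homogeneousSubmodule (Fin 3) ℂ m →ₗ[ℂ] C(K, ℂ) :=
    { toFun := fun G => ⟨fun t => eval (ξ t) G.1, hc G.1⟩
      map_add' := fun G H => by ext t; simp
      map_smul' := fun c G => by ext t; simp }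
  let f : homogeneousSubmodule (Fin 3) ℂ m →ₗ[ℂ] ℂ :=
    (m.factorial : ℂ)⁻¹ • (apolar.flip P ∘ₗ Submodule.subtype _)
  have hm0 : (m.factorial : ℝ) ≠ 0 := by exact_mod_cast m.factorial_ne_zero
  have hf : ∀ G, f G = (m.factorial : ℂ)⁻¹ * apolar G.1 P := fun G => rfl
  obtain ⟨ℓ, hℓ, hT⟩ := exists_functional_of_bound T f
    (M := coeffNorm P * A ^ (m + 1)) (mul_nonneg (coeffNorm_nonneg P) (by positivity)) fun G => by
      obtain ⟨H, R, hGR, hR⟩ := hdiv m ‖T G‖ G.1 (norm_nonneg _) G.2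
        fun t ht => (T G).norm_coe_le_norm ⟨t, ht⟩
      -- multiples of `F` are orthogonal to the solution `P`
      have hap : apolar G.1 P = apolar R P := by
        rw [hGR, map_add, LinearMap.add_apply, mul_comm, apolar_mul, hFP, map_zero, zero_add]
      rw [hf, hap, norm_mul, norm_inv, Complex.norm_natCast]
      calc _ ≤ (m.factorial : ℝ)⁻¹ * (m.factorial * (coeffNorm P * coeffNorm R)) := by
            gcongr; exact norm_apolar_le hP R
        _ = coeffNorm P * coeffNorm R := by rw [inv_mul_cancel_left₀ hm0]
        _ ≤ coeffNorm P * (A ^ (m + 1) * ‖T G‖) := by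
            gcongr; exact coeffNorm_nonneg P
        _ = _ := by rw [mul_assoc]
  refine ⟨ℓ, hℓ, fun v g hg => ?_⟩
  let G : homogeneousSubmodule (Fin 3) ℂ m :=
    ⟨linearForm v ^ m, linearForm_pow_isHomogeneous v m⟩
  have hgT : g = T G := by
    ext t
    rw [hg t]
    change _ = eval (ξ t) (linearForm v ^ m)
    rw [map_pow, eval_linearForm]
    simp only [mul_comm]
  rw [hgT, hT, hf, apolar_comm]
  change _ * apolar P (linearForm v ^ m) = _
  rw [apolar_linearForm_pow hP, inv_mul_cancel_left₀ (by exact_mod_cast m.factorial_ne_zero)]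

/-- The Cauchy kernel `φ(t) = (2πi)⁻¹ ℓ((t - ·)⁻¹)` of a functional on the continuous functions on
a set in a disc of radius `r` represents the functional on holomorphic functions. -/
theorem exists_kernel {K : Set ℂ} [CompactSpace K] {t₀ : ℂ} {r s R : ℝ}
    (hK : K ⊆ Metric.closedBall t₀ r) (hrs : r < s) (hsR : s < R) (hs : 0 < s)
    (ℓ : C(K, ℂ) →L[ℂ] ℂ) :
    ∃ φ φ' : ℂ → ℂ, (∀ t, s < dist t t₀ → HasDerivAt φ (φ' t) t ∧
        ‖φ t‖ ≤ ‖ℓ‖ * (s - r)⁻¹ ∧ ‖φ' t‖ ≤ ‖ℓ‖ * ((s - r)⁻¹ * (s - r)⁻¹)) ∧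
      ∀ (g : ℂ → ℂ) (gK : C(K, ℂ)), DiffContOnCl ℂ g (Metric.ball t₀ R) → (∀ t : K, gK t = g t) →
        ∮ t in C(t₀, R), φ t * g t = ℓ gK := by
  let X : C(K, ℂ) := ⟨Subtype.val, continuous_subtype_val⟩
  have hR : 0 < R := hs.trans hsR
  have hdist : ∀ t, s < dist t t₀ → ∀ u : K, s - r ≤ ‖t - u‖ := fun t ht u => by
    have h1 := dist_triangle t u t₀
    have h2 := Metric.mem_closedBall.1 (hK u.2)
    rw [← dist_eq_norm]
    linarith
  have hpos : 0 < s - r := sub_pos.2 hrs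
  have hres : ∀ t, s < dist t t₀ → t ∈ resolventSet ℂ X := fun t ht => by
    rw [← Set.notMem_compl_iff]
    change t ∉ spectrum ℂ X
    rw [ContinuousMap.spectrum_eq_range]
    rintro ⟨u, rfl⟩
    have := hdist _ ht u
    change s - r ≤ ‖(u : ℂ) - u‖ at this
    rw [sub_self, norm_zero] at this
    linarith
  have heval : ∀ t, s < dist t t₀ → ∀ u : K, resolvent X t u = (t - u)⁻¹ := fun t ht u => by
    have h1 := Ring.inverse_mul_cancel _ (hres t ht)
    have h2 := DFunLike.congr_fun h1 u
    exact eq_inv_of_mul_eq_one_left h2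
  have hnorm : ∀ t, s < dist t t₀ → ‖resolvent X t‖ ≤ (s - r)⁻¹ := fun t ht => by
    refine (ContinuousMap.norm_le _ (inv_nonneg.2 hpos.le)).2 fun u => ?_
    rw [heval t ht, norm_inv]
    exact inv_anti₀ hpos (hdist t ht u)
  let c : ℂ := (2 * Real.pi * Complex.I)⁻¹
  have hc0 : (2 * Real.pi * Complex.I : ℂ) ≠ 0 := Complex.two_pi_I_ne_zero
  have hc : ‖c‖ ≤ 1 := by
    simp only [c, norm_inv, norm_mul, Complex.norm_I, Complex.norm_real, Complex.norm_ofNat,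
      Real.norm_of_nonneg Real.pi_pos.le, mul_one]
    exact inv_le_one_of_one_le₀ (by linarith [Real.pi_gt_three])
  have hbound : ∀ (x : C(K, ℂ)) (b : ℝ), ‖x‖ ≤ b → ‖c * ℓ x‖ ≤ ‖ℓ‖ * b := fun x b hx => by
    rw [norm_mul]
    calc ‖c‖ * ‖ℓ x‖ ≤ 1 * (‖ℓ‖ * ‖x‖) := by gcongr; exact ℓ.le_opNorm x
      _ ≤ _ := by rw [one_mul]; gcongr
  refine ⟨fun t => c * ℓ (resolvent X t), fun t => c * ℓ (-resolvent X t ^ 2), fun t ht =>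
    ⟨(ℓ.hasFDerivAt.comp_hasDerivAt t
      (spectrum.hasDerivAt_resolvent_const_left (hres t ht))).const_mul c,
      hbound _ _ (hnorm t ht), hbound _ _ ?_⟩, fun g gK hg hgK => ?_⟩
  · rw [norm_neg, sq]
    exact (norm_mul_le _ _).trans (mul_le_mul (hnorm t ht) (hnorm t ht) (norm_nonneg _)
      (inv_nonneg.2 hpos.le))
  · have hsph : ∀ t ∈ Metric.sphere t₀ R, s < dist t t₀ := fun t ht => by
      rw [Metric.mem_sphere.1 ht]; exact hsR
    have hcont : ContinuousOn (fun t => g t • resolvent X t) (Metric.sphere t₀ R) := by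
      refine ContinuousOn.smul (hg.continuousOn_ball.mono Metric.sphere_subset_closedBall)
        fun t ht => ?_
      exact (spectrum.hasDerivAt_resolvent_const_left
        (hres t (hsph t ht))).continuousAt.continuousWithinAt
    have hint : CircleIntegrable (fun t => g t • resolvent X t) t₀ R :=
      hcont.circleIntegrable hR.le
    have hcomm : ∀ L : C(K, ℂ) →L[ℂ] ℂ, L (∮ t in C(t₀, R), g t • resolvent X t) =
        ∮ t in C(t₀, R), L (g t • resolvent X t) := fun L => by
      rw [circleIntegral, circleIntegral, ← L.intervalIntegral_comp_comm hint.out]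
      simp only [map_smul]
    -- the Cauchy integral formula at every point of `K`
    have hval : ∮ t in C(t₀, R), g t • resolvent X t = (2 * Real.pi * Complex.I : ℂ) • gK := by
      ext u
      have hu : (u : ℂ) ∈ Metric.ball t₀ R :=
        Metric.mem_ball.2 ((Metric.mem_closedBall.1 (hK u.2)).trans_lt (hrs.trans hsR))
      have h1 := hcomm (ContinuousMap.evalCLM ℂ u)
      have h2 := hg.circleIntegral_sub_inv_smul hu
      rw [ContinuousMap.evalCLM_apply] at h1
      rw [h1, ContinuousMap.smul_apply, hgK u, ← h2]
      refine circleIntegral.integral_congr hR.le fun t ht => ?_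
      simp [heval t (hsph t ht), mul_comm]
    have h3 := hcomm ℓ
    rw [hval, map_smul] at h3
    calc ∮ t in C(t₀, R), c * ℓ (resolvent X t) * g t
        = ∮ t in C(t₀, R), c • ℓ (g t • resolvent X t) := by
          refine circleIntegral.integral_congr hR.le fun t _ => ?_
          simp only [map_smul, smul_eq_mul]
          ring
      _ = c • (2 * Real.pi * Complex.I : ℂ) • ℓ gK := by rw [circleIntegral.integral_smul, h3]
      _ = ℓ gK := by rw [smul_smul, inv_mul_cancel₀ hc0, one_smul]

/-! ### The integral representation -/

lemma norm_mul_pow_le_of_geometric {x w : ℂ} {M q r : ℝ} {m : ℕ} (hM : 0 ≤ M) (hq : 0 ≤ q)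
    (hqr : q * r ≤ 2⁻¹) (hx : ‖x‖ ≤ M * q ^ m) (hw : ‖w‖ ≤ r) : ‖x * w ^ m‖ ≤ M * 2⁻¹ ^ m := by
  have hr : 0 ≤ r := (norm_nonneg w).trans hw
  rw [norm_mul, norm_pow]
  calc ‖x‖ * ‖w‖ ^ m ≤ M * q ^ m * r ^ m := by gcongr
    _ = M * (q * r) ^ m := by rw [mul_pow]; ring
    _ ≤ _ := by gcongr

/-- A power series in `w` whose coefficients are holomorphic functions of `t` is holomorphic in
`(w, t)`, given geometric bounds on the coefficients and on their derivatives. -/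
lemma differentiableOn_tsum_mul_pow {φ φ' : ℕ → ℂ → ℂ} {T : Set ℂ} (hT : IsOpen T) {M q r : ℝ}
    (hM : 0 ≤ M) (hq : 0 ≤ q) (hqr : q * r ≤ 2⁻¹)
    (hφ : ∀ m, ∀ t ∈ T, HasDerivAt (φ m) (φ' m t) t ∧ ‖φ m t‖ ≤ M * q ^ m ∧
      ‖φ' m t‖ ≤ M * q ^ m) :
    DifferentiableOn ℂ (fun v : ℂ × ℂ => ∑' m, φ m v.2 * v.1 ^ m) (Metric.ball 0 r ×ˢ T) := by
  rintro ⟨w, t⟩ ⟨hw, ht⟩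
  obtain ⟨δ, hδ, hδT⟩ := Metric.isOpen_iff.1 hT t ht
  let s : Set (ℂ × ℂ) := Metric.ball 0 r ×ˢ Metric.ball t δ
  have hs : (w, t) ∈ s := ⟨hw, Metric.mem_ball_self hδ⟩
  let f' : ℕ → ℂ × ℂ → ℂ × ℂ →L[ℂ] ℂ := fun m v =>
    φ m v.2 • ((m * v.1 ^ (m - 1)) • ContinuousLinearMap.fst ℂ ℂ ℂ) +
      v.1 ^ m • (φ' m v.2 • ContinuousLinearMap.snd ℂ ℂ ℂ)
  let u : ℕ → ℝ := fun m => M * q * (m * 2⁻¹ ^ (m - 1)) + M * 2⁻¹ ^ m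
  have hgeo : Summable fun m : ℕ => (2⁻¹ : ℝ) ^ m :=
    summable_geometric_of_lt_one (by norm_num) (by norm_num)
  have hu : Summable u := by
    refine Summable.add (Summable.mul_left _ ?_) (hgeo.mul_left M)
    rw [← summable_nat_add_iff 1]
    have h1 : Summable fun m : ℕ => (m : ℝ) * 2⁻¹ ^ m := by
      simpa using summable_pow_mul_geometric_of_norm_lt_one 1 (r := (2⁻¹ : ℝ)) (by norm_num)
    refine (h1.add hgeo).congr fun m => ?_
    rw [Nat.add_sub_cancel]
    push_cast
    ring
  have hderiv : ∀ m, ∀ v ∈ s, HasFDerivAt (fun v : ℂ × ℂ => φ m v.2 * v.1 ^ m) (f' m v) v := by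
    intro m v hv
    have h1 := (hφ m v.2 (hδT hv.2)).1.comp_hasFDerivAt v
      (hasFDerivAt_snd (𝕜 := ℂ) (E := ℂ) (F := ℂ) (p := v))
    have h2 := (hasDerivAt_pow m v.1).comp_hasFDerivAt v
      (hasFDerivAt_fst (𝕜 := ℂ) (E := ℂ) (F := ℂ) (p := v))
    exact h1.mul h2
  have hbound : ∀ m, ∀ v ∈ s, ‖f' m v‖ ≤ u m := by
    intro m v hv
    have hv1 : ‖v.1‖ ≤ r := (mem_ball_zero_iff.1 hv.1).le
    have hr : 0 ≤ r := (norm_nonneg _).trans hv1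
    obtain ⟨-, h1, h2⟩ := hφ m v.2 (hδT hv.2)
    refine (norm_add_le _ _).trans (add_le_add ?_ ?_)
    · rw [norm_smul, norm_smul, norm_mul, norm_pow, Complex.norm_natCast]
      calc _ ≤ M * q ^ m * (m * r ^ (m - 1) * 1) := by
            gcongr
            exact ContinuousLinearMap.norm_fst_le ℂ ℂ ℂ
        _ ≤ M * q * (m * 2⁻¹ ^ (m - 1)) := by
            rcases m with _ | k
            · simp
            · rw [Nat.add_sub_cancel]
              calc _ = M * q * ((k + 1 : ℕ) * (q * r) ^ k) := by rw [mul_pow]; ring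
                _ ≤ _ := by gcongr
    · rw [smul_smul, norm_smul, mul_comm (v.1 ^ m)]
      exact mul_le_of_le_one_right (norm_nonneg _) (ContinuousLinearMap.norm_snd_le ℂ ℂ ℂ)
        |>.trans (norm_mul_pow_le_of_geometric hM hq hqr h2 hv1)
  have hsum : Summable fun m => φ m t * w ^ m :=
    Summable.of_norm_bounded (hgeo.mul_left M) fun m =>
      norm_mul_pow_le_of_geometric hM hq hqr (hφ m t ht).2.1 (mem_ball_zero_iff.1 hw).le
  exact (hasFDerivAt_tsum_of_isPreconnected hu (Metric.isOpen_ball.prod Metric.isOpen_ball)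
    ((convex_ball _ _).prod (convex_ball _ _)).isPreconnected hderiv hbound hs hsum
    hs).differentiableAt.differentiableWithinAt

lemma hasSum_circleIntegral {f : ℕ → ℂ → ℂ} {u : ℕ → ℝ} {c : ℂ} {R : ℝ} (hR : 0 ≤ R)
    (hu : Summable u) (hf : ∀ m, ContinuousOn (f m) (Metric.sphere c R))
    (hfu : ∀ m, ∀ t ∈ Metric.sphere c R, ‖f m t‖ ≤ u m) :
    HasSum (fun m => ∮ t in C(c, R), f m t) (∮ t in C(c, R), ∑' m, f m t) := by
  have h := TendstoUniformlyOn.tendsto_circleIntegral_of_continuousOn hR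
    (Filter.Eventually.of_forall fun s : Finset ℕ => continuousOn_finsetSum s fun m _ => hf m)
    (tendstoUniformlyOn_tsum hu hfu)
  refine h.congr fun s => ?_
  exact circleIntegral.integral_fun_sum fun m _ => (hf m).circleIntegrable hR

/-- Circle integrals as integrals over `[0, 1]`. -/
lemma integral_circleMap_two_pi_mul (f : ℂ → ℂ) (c : ℂ) (R : ℝ) :
    ∫ τ in (0 : ℝ)..1, f (circleMap c R (2 * Real.pi * τ)) *
      deriv (fun τ : ℝ => circleMap c R (2 * Real.pi * τ)) τ = ∮ t in C(c, R), f t := by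
  have hd : ∀ τ : ℝ, deriv (fun τ : ℝ => circleMap c R (2 * Real.pi * τ)) τ =
      (2 * Real.pi) • deriv (circleMap c R) (2 * Real.pi * τ) := fun τ =>
    deriv_comp_mul_left (2 * Real.pi) (circleMap c R) τ
  have h := intervalIntegral.smul_integral_comp_mul_left (a := 0) (b := 1)
    (f := fun θ => deriv (circleMap c R) θ • f (circleMap c R θ)) (2 * Real.pi)
  rw [mul_zero, mul_one] at h
  rw [circleIntegral, ← h, ← intervalIntegral.integral_smul]
  refine intervalIntegral.integral_congr fun τ _ => ?_
  simp only [hd, smul_eq_mul, Complex.real_smul]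
  ring

lemma norm_sum_mul_complexPoint_le (v : Fin 3 → ℂ) (h : Fin 3 → ℝ) :
    ‖∑ i, v i * (h i : ℂ)‖ ≤ 3 * (‖v‖ * ‖h‖) := by
  refine (norm_sum_le _ _).trans ((Finset.sum_le_card_nsmul Finset.univ _ (‖v‖ * ‖h‖)
    fun i _ => ?_).trans (by simp))
  rw [norm_mul, Complex.norm_real]
  exact mul_le_mul (norm_le_pi_norm v i) (norm_le_pi_norm h i) (norm_nonneg _) (norm_nonneg _)

/-- The representation of solutions by integrals over a circle in `D`. The circle depends neither on
the solution nor on the point `p`. -/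
theorem exists_integral_representation {n : ℕ} (hn : 2 ≤ n) {F : MvPolynomial (Fin 3) ℂ}
    (hF : Prime F) (hFh : F.IsHomogeneous n) {D : Set ℂ} {ξ : ℂ → Fin 3 → ℂ}
    (hξ : IsUniformizedBy F D ξ) :
    ∃ γ : ℝ → ℂ, ContDiff ℝ 1 γ ∧ (∀ τ ∈ Set.Icc (0 : ℝ) 1, γ τ ∈ D) ∧
      ∀ (U : Set (Fin 3 → ℝ)) (V : (Fin 3 → ℝ) → ℂ), IsOpen U → AnalyticOnNhd ℝ V U →
        (∀ x ∈ U, diffOp F V x = 0) →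
        ∀ p ∈ U, ∃ O : Set (Fin 3 → ℝ), IsOpen O ∧ p ∈ O ∧ O ⊆ U ∧
          ∃ (W : Set (ℂ × ℂ)) (Φ : ℂ × ℂ → ℂ), IsOpen W ∧ DifferentiableOn ℂ Φ W ∧
            ∀ x ∈ O,
              (∀ τ ∈ Set.Icc (0 : ℝ) 1, (∑ i, ξ (γ τ) i * (x i : ℂ), γ τ) ∈ W) ∧
              V x = ∫ τ in (0 : ℝ)..1, Φ (∑ i, ξ (γ τ) i * (x i : ℂ), γ τ) * deriv γ τ := by
  obtain ⟨t₀, ht₀, -⟩ := hξ.nonconstant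
  obtain ⟨R, hR, hRD⟩ := Metric.nhds_basis_closedBall.mem_iff.1 (hξ.isOpen.mem_nhds ht₀)
  -- the small disc `K` carries the functionals; the kernels are holomorphic at distance `> s`
  obtain ⟨r, s, hr, hrs, hsR⟩ : ∃ r s : ℝ, 0 < r ∧ r < s ∧ s < R :=
    ⟨R / 3, 2 * R / 3, by linarith, by linarith, by linarith⟩
  have hKD : Metric.closedBall t₀ r ⊆ D :=
    (Metric.closedBall_subset_closedBall (hrs.trans hsR).le).trans hRD
  obtain ⟨A, hA, hdiv⟩ := exists_division_bound hn hF hFh hξ hKD hr Metric.ball_subset_closedBall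
  have hsph : ∀ t ∈ Metric.sphere t₀ R, t ∈ D ∧ s < dist t t₀ := fun t ht =>
    ⟨hRD (Metric.sphere_subset_closedBall ht), by rw [Metric.mem_sphere.1 ht]; exact hsR⟩
  have hγ : ∀ τ : ℝ, circleMap t₀ R (2 * Real.pi * τ) ∈ Metric.sphere t₀ R := fun τ =>
    circleMap_mem_sphere t₀ hR.le _
  refine ⟨fun τ => circleMap t₀ R (2 * Real.pi * τ),
    (contDiff_circleMap t₀ R).comp (contDiff_const.mul contDiff_id),
    fun τ _ => (hsph _ (hγ τ)).1, fun U V hU hV hsol p hp => ?_⟩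
  obtain ⟨P, hP⟩ := (hV p hp).exists_hasFormExpansion
  have hFP := hP.polyDiffOp_eq_zero hFh (hV p hp)
    (Filter.mem_of_superset (hU.mem_nhds hp) hsol)
  obtain ⟨a, b, ha, hb, hab⟩ := hP.exists_bound
  choose ℓ hℓ hval using fun m => exists_functional_of_division_bound
    (hξ.differentiableOn.continuousOn.mono hKD) (zero_le_one.trans hA) hdiv (hP.isHomogeneous m)
    (hFP m)
  choose φ φ' hφ hint using fun m =>
    exists_kernel (K := Metric.closedBall t₀ r) le_rfl hrs hsR (hr.trans hrs) (ℓ m)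
  let c : ℝ := (s - r)⁻¹
  have hc : 0 ≤ c := inv_nonneg.2 (sub_pos.2 hrs).le
  let q : ℝ := b * A
  let M : ℝ := a * A * (c + c * c)
  have hA0 : 0 ≤ A := zero_le_one.trans hA
  have hq : 0 < q := by positivity
  have hM : 0 ≤ M := by positivity
  have hℓM : ∀ m, ‖ℓ m‖ ≤ a * A * q ^ m := fun m =>
    calc ‖ℓ m‖ ≤ a * b ^ m * A ^ (m + 1) := (hℓ m).trans (by gcongr; exact hab m)
      _ = _ := by simp only [q, mul_pow]; ring
  let T : Set ℂ := D ∩ {t | s < dist t t₀}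
  have hT : IsOpen T := hξ.isOpen.inter
    (isOpen_lt continuous_const (continuous_id.dist continuous_const))
  have hφT : ∀ m, ∀ t ∈ T, HasDerivAt (φ m) (φ' m t) t ∧ ‖φ m t‖ ≤ M * q ^ m ∧
      ‖φ' m t‖ ≤ M * q ^ m := by
    intro m t ht
    obtain ⟨h1, h2, h3⟩ := hφ m t ht.2
    refine ⟨h1, h2.trans ?_, h3.trans ?_⟩
    · calc ‖ℓ m‖ * c ≤ a * A * q ^ m * (c + c * c) := by
            gcongr
            · exact hℓM m
            · exact le_add_of_nonneg_right (mul_nonneg hc hc)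
        _ = M * q ^ m := by simp only [M]; ring
    · calc ‖ℓ m‖ * (c * c) ≤ a * A * q ^ m * (c + c * c) := by
            gcongr
            · exact hℓM m
            · exact le_add_of_nonneg_left hc
        _ = M * q ^ m := by simp only [M]; ring
  let ρ : ℝ := (2 * q)⁻¹
  have hρ : 0 < ρ := by positivity
  have hqρ : q * ρ ≤ 2⁻¹ := by
    simp only [ρ]
    rw [mul_inv, mul_left_comm, mul_inv_cancel₀ hq.ne', mul_one]
  have hΨ := differentiableOn_tsum_mul_pow hT hM hq.le hqρ hφT
  have hpairing : ∀ x : Fin 3 → ℝ, DifferentiableOn ℂ (fun t => ∑ i, ξ t i * (x i : ℂ)) D :=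
    fun x => DifferentiableOn.fun_sum fun i _ =>
      (differentiableOn_pi.1 hξ.differentiableOn i).mul_const _
  -- the coordinates `(σ, t) ↦ (σ - ξ(t) ⬝ p, t)`, in which `Φ` is a power series
  let g : ℂ × ℂ → ℂ × ℂ := fun v => (v.1 - ∑ i, ξ v.2 i * (p i : ℂ), v.2)
  have hg : DifferentiableOn ℂ g (Set.univ ×ˢ D) := by
    refine (differentiableOn_fst.sub ?_).prodMk differentiableOn_snd
    exact (hpairing p).comp differentiableOn_snd fun v hv => hv.2
  obtain ⟨N, hN⟩ := (isCompact_sphere t₀ R).exists_bound_of_continuousOn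
    (hξ.differentiableOn.continuousOn.mono fun t ht => (hsph t ht).1)
  have hN0 : 0 ≤ N := (norm_nonneg _).trans (hN _ (hγ 0))
  obtain ⟨η₀, hη₀, hsum⟩ := Metric.eventually_nhds_iff_ball.1 hP.eventually_hasSum
  obtain ⟨η, hη, hηη₀, hηρ⟩ : ∃ η : ℝ, 0 < η ∧ η ≤ η₀ ∧ 3 * (N + 1) * η ≤ ρ :=
    ⟨min η₀ (ρ / (3 * (N + 1))), by positivity, min_le_left _ _, by
      calc _ ≤ 3 * (N + 1) * (ρ / (3 * (N + 1))) := by gcongr; exact min_le_right _ _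
        _ = ρ := by field_simp⟩
  refine ⟨U ∩ Metric.ball p η, hU.inter Metric.isOpen_ball, ⟨hp, Metric.mem_ball_self hη⟩,
    Set.inter_subset_left, (Set.univ ×ˢ D) ∩ g ⁻¹' (Metric.ball 0 ρ ×ˢ T),
    fun v => ∑' m, φ m (g v).2 * (g v).1 ^ m,
    hg.continuousOn.isOpen_inter_preimage (isOpen_univ.prod hξ.isOpen)
      (Metric.isOpen_ball.prod hT),
    hΨ.comp (hg.mono Set.inter_subset_left) fun v hv => hv.2, fun x hx => ?_⟩
  obtain ⟨h, rfl⟩ : ∃ h, x = p + h := ⟨x - p, by simp⟩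
  have hh : ‖h‖ < η := by simpa using hx.2
  have hgx : ∀ t, g (∑ i, ξ t i * ((p + h) i : ℂ), t) = (∑ i, ξ t i * (h i : ℂ), t) := fun t => by
    simp only [g, Pi.add_apply, Complex.ofReal_add, mul_add, Finset.sum_add_distrib,
      add_sub_cancel_left]
  have hsmall : ∀ t ∈ Metric.sphere t₀ R, ‖∑ i, ξ t i * (h i : ℂ)‖ < ρ := fun t ht =>
    calc _ ≤ 3 * (‖ξ t‖ * ‖h‖) := norm_sum_mul_complexPoint_le _ _
      _ ≤ 3 * (N * ‖h‖) := by gcongr; exact hN t ht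
      _ ≤ 3 * (N + 1) * ‖h‖ := by nlinarith [norm_nonneg h]
      _ < 3 * (N + 1) * η := by gcongr
      _ ≤ ρ := hηρ
  refine ⟨fun τ _ => ⟨⟨Set.mem_univ _, (hsph _ (hγ τ)).1⟩, ?_⟩, ?_⟩
  · rw [Set.mem_preimage, hgx]
    exact ⟨mem_ball_zero_iff.2 (hsmall _ (hγ τ)), hsph _ (hγ τ)⟩
  · have hcirc := hasSum_circleIntegral (f := fun m t => φ m t * (∑ i, ξ t i * (h i : ℂ)) ^ m) hR.le
      ((summable_geometric_of_lt_one (r := (2⁻¹ : ℝ)) (by norm_num) (by norm_num)).mul_left M)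
      (fun m => ContinuousOn.mul
        (fun t ht => (hφT m t (hsph t ht)).1.continuousAt.continuousWithinAt)
        (((hpairing h).continuousOn.mono fun t ht => (hsph t ht).1).pow m))
      (fun m t ht => norm_mul_pow_le_of_geometric hM hq.le hqρ (hφT m t (hsph t ht)).2.1
        (hsmall t ht).le)
    have hterm : ∀ m, ∮ t in C(t₀, R), φ m t * (∑ i, ξ t i * (h i : ℂ)) ^ m =
        eval (complexPoint h) (P m) := fun m => by
      have hpow : DifferentiableOn ℂ (fun t => (∑ i, ξ t i * (h i : ℂ)) ^ m) D :=
        (hpairing h).pow m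
      let gK : C(Metric.closedBall t₀ r, ℂ) :=
        ⟨fun t => (∑ i, ξ t i * (h i : ℂ)) ^ m,
          continuousOn_iff_continuous_domRestrict.1 (hpow.continuousOn.mono hKD)⟩
      rw [hint m _ gK (hpow.mono (Metric.closure_ball_subset_closedBall.trans hRD)).diffContOnCl
        fun t => rfl]
      exact hval m (complexPoint h) gK fun t => rfl
    simp only [hterm] at hcirc
    rw [(hsum h (mem_ball_zero_iff.2 (hh.trans_le hηη₀))).unique hcirc,
      ← integral_circleMap_two_pi_mul]
    simp only [hgx]

end

theorem mainTheorem1 (n : ℕ) (hn : 2 ≤ n) (F : MvPolynomial (Fin 3) ℂ) (hF : F.IsHomogeneous n)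
    (hsmooth : IsSmoothPlaneCurve F) (D : Set ℂ) (ξ : ℂ → Fin 3 → ℂ)
    (hξ : IsUniformizedBy F D ξ) :
    (∃ γ : ℝ → ℂ, ContDiff ℝ 1 γ ∧ (∀ τ ∈ Set.Icc (0 : ℝ) 1, γ τ ∈ D) ∧
      ∀ (U : Set (Fin 3 → ℝ)) (V : (Fin 3 → ℝ) → ℂ), IsOpen U → AnalyticOnNhd ℝ V U →
        (∀ x ∈ U, diffOp F V x = 0) →
        ∀ p ∈ U, ∃ O : Set (Fin 3 → ℝ), IsOpen O ∧ p ∈ O ∧ O ⊆ U ∧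
          ∃ (W : Set (ℂ × ℂ)) (Φ : ℂ × ℂ → ℂ), IsOpen W ∧ DifferentiableOn ℂ Φ W ∧
            ∀ x ∈ O,
              (∀ τ ∈ Set.Icc (0 : ℝ) 1, (∑ i, ξ (γ τ) i * (x i : ℂ), γ τ) ∈ W) ∧
              V x = ∫ τ in (0 : ℝ)..1, Φ (∑ i, ξ (γ τ) i * (x i : ℂ), γ τ) * deriv γ τ) ∧
    (∀ m : ℕ, Module.finrank ℂ (homogeneousSolutions F m) = solutionCount n m ∧
      ∃ t : Fin (solutionCount n m) → ℂ, (∀ i, t i ∈ D) ∧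
        ∃ b : Module.Basis (Fin (solutionCount n m)) ℂ (homogeneousSolutions F m),
          ∀ i, (b i : MvPolynomial (Fin 3) ℂ) = linearForm (ξ (t i)) ^ m) := by
  have hFp := hsmooth.prime hn hF
  exact ⟨exists_integral_representation hn hFp hF hξ,
    homogeneousSolutions_basis hn hFp hF hξ⟩
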